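/- **Setting.** Let $\omega\subset\mathbb{R}^2$ be a bounded Lipschitz domain and let $\gamma=b([\alpha,\beta])$, $\alpha<\beta$, be a simple (possibly closed) curve with $b((\alpha,\beta))\subset\omega$, where $b$ is continuous, piecewise $C^1$ and satisfies $|b'|=1$. Assume that $\gamma$ partitions $\omega$ into two disjoint Lipschitz domains, $\omega\setminus\gamma=\omega_1\cup\omega_2$. Put $$I(v)=\frac12\int_{\omega\setminus\gamma}|D^2v|^2\,dx,\qquad V=\{v\in H^2(\omega\setminus\gamma;\mathbb{R}^3)\cap W^{1,\infty}(\omega;\mathbb{R}^3):(\nabla v)^{\sf T}\nabla v=I_{2\times2}\ \text{a.e.}\}.$$ For every $m\in\mathbb{N}$ let $\alpha=s_0<s_1<\dots<s_{n}=\beta$ ($n=n_m$) be parameters, let $c_i=b(s_i)$ be the vertices of the polygonal curve $\gamma_m$ that interpolates $b$ linearly, and let $\mathcal{T}_m$ be a finite conforming triangulation of $\overline\omega$ that contains each segment $[c_{i-1},c_i]$ as an edge. The triangulations are uniformly shape regular and their maximal mesh size tends to $0$ as $m\to\infty$. Let $\widehat\gamma_m$ (the fattened crease) be the union of a set of triangles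 of $\mathcal{T}_m$, each of which has one of the segments $[c_{i-1},c_i]$ as an edge, such that $\gamma\subset\widehat\gamma_m$, the sets $\widehat\omega_{m,\ell}=\omega_\ell\setminus\widehat\gamma_m$, $\ell=1,2$, are nonempty and connected, and each interior vertex $c_i$, $0<i<n$, belongs to the closures of both $\widehat\omega_{m,1}$ and $\widehat\omega_{m,2}$. Put $$\widetilde I_m(v)=\frac12\int_{\omega\setminus\widehat\gamma_m}|D^2v|^2\,dx,$$ $$\widetilde V_m=\{v\in H^2(\omega\setminus\widehat\gamma_m;\mathbb{R}^3):(\nabla v)^{\sf T}\nabla v=I_{2\times2}\ \text{a.e.},\ v\text{ continuous in }c_0,\dots,c_n\},$$ where continuity in $c_i$ means that $v(x)$ has a limit as $x\to c_i$, $x\in\omega\setminus\widehat\gamma_m$. Functions on $\omega\setminus\widehat\gamma_m$ are identified with their extensions by zero to $\omega$. **Proposition (Gamma convergence).** (i) Let $v_m\in\widetilde V_m$ and $\widetilde I_m(v_m)\le c$ for all $m$. If $(v_m)$ is bounded in $L^2(\omega;\mathbb{R}^3)$, then there are $v\in V$ and a subsequence of $(v_m)$ that converges to $v$ in $L^2(\omega;\mathbb{R}^3)$,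 and $I(v)\le\liminf_{m\to\infty}\widetilde I_m(v_m)$. Without the boundedness in $L^2$ the same holds up to translations: there are $a_m\in\mathbb{R}^3$ and $v\in V$ such that a subsequence of the functions $(v_m-a_m)|_{\omega\setminus\widehat\gamma_m}$ converges to $v$ in $L^2(\omega;\mathbb{R}^3)$, and $I(v)\le\liminf_{m\to\infty}\widetilde I_m(v_m)$. (ii) Let $v\in V$. Then the restrictions $v_m=v|_{\omega\setminus\widehat\gamma_m}$ satisfy $v_m\in\widetilde V_m$ for all $m$, $v_m\to v$ in $L^2(\omega;\mathbb{R}^3)$, and $\widetilde I_m(v_m)\to I(v)$ as $m\to\infty$. -/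

import Mathlib

open Set Filter Topology MeasureTheory
open scoped ENNReal NNReal Matrix

namespace Folding

/-- The reference plane `ℝ²` with its Euclidean norm. -/
abbrev Plane := EuclideanSpace ℝ (Fin 2)

/-- The target space `ℝ³` with its Euclidean norm. -/
abbrev Space := EuclideanSpace ℝ (Fin 3)

/-! ### Sobolev spaces on open subsets of the plane -/

/-- `g` is the weak partial derivative `∂ᵢ f` on the open set `U`. -/
def HasWeakPartial (U : Set Plane) (i : Fin 2) (f g : Plane → Space) : Prop :=
  LocallyIntegrableOn f U volume ∧ LocallyIntegrableOn g U volume ∧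
    ∀ φ : Plane → ℝ, ContDiff ℝ (⊤ : ℕ∞) φ → HasCompactSupport φ → tsupport φ ⊆ U →
      ∫ x in U, (fderiv ℝ φ x (EuclideanSpace.single i 1)) • f x = - ∫ x in U, φ x • g x

/-- `G j = ∂ⱼ v` weakly on `U`, for `j = 0, 1`. -/
def IsWeakGradient (U : Set Plane) (v : Plane → Space) (G : Fin 2 → Plane → Space) : Prop :=
  ∀ j, HasWeakPartial U j v (G j)

/-- `H j k = ∂ₖ ∂ⱼ v` weakly on `U`. -/
def IsWeakHessian (U : Set Plane) (v : Plane → Space)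
    (H : Fin 2 → Fin 2 → Plane → Space) : Prop :=
  ∃ G : Fin 2 → Plane → Space, IsWeakGradient U v G ∧ ∀ j, IsWeakGradient U (G j) (H j)

/-- `v ∈ H²(U; ℝ³)`. -/
def MemH2 (U : Set Plane) (v : Plane → Space) : Prop :=
  MemLp v 2 (volume.restrict U) ∧
    ∃ (G : Fin 2 → Plane → Space) (H : Fin 2 → Fin 2 → Plane → Space),
      IsWeakGradient U v G ∧ (∀ j, MemLp (G j) 2 (volume.restrict U)) ∧
      (∀ j, IsWeakGradient U (G j) (H j)) ∧ ∀ j k, MemLp (H j k) 2 (volume.restrict U)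

/-- `v ∈ W^{1,∞}(U; ℝ³)`. -/
def MemW1Infty (U : Set Plane) (v : Plane → Space) : Prop :=
  MemLp v ∞ (volume.restrict U) ∧
    ∃ G : Fin 2 → Plane → Space,
      IsWeakGradient U v G ∧ ∀ j, MemLp (G j) ∞ (volume.restrict U)

/-- The `3 × 2` matrix with columns `G 0 x` and `G 1 x`. -/
def jacobian (G : Fin 2 → Plane → Space) (x : Plane) : Matrix (Fin 3) (Fin 2) ℝ :=
  Matrix.of fun k j => G j x k

/-- The isometry condition `(∇v)ᵀ ∇v = I` almost everywhere in `U`. -/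
def IsIsometric (U : Set Plane) (v : Plane → Space) : Prop :=
  ∃ G : Fin 2 → Plane → Space, IsWeakGradient U v G ∧
    ∀ᵐ x ∂(volume.restrict U), (jacobian G x)ᵀ * jacobian G x = 1

/-- The bending energy `½ ∫_U |D²v|²` with the Frobenius norm. The weak Hessian is unique up to
null sets, so the infimum runs over a single value, and it is `∞` if there is no weak Hessian. -/
noncomputable def bendingEnergy (U : Set Plane) (v : Plane → Space) : ℝ≥0∞ :=
  ⨅ (H : Fin 2 → Fin 2 → Plane → Space) (_ : IsWeakHessian U v H),
    2⁻¹ * ∫⁻ x in U, ∑ j, ∑ k, ‖H j k x‖ₑ ^ 2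

/-! ### The sheet and its crease -/

/-- Bounded Lipschitz domain: nonempty, open, connected, bounded, and in a ball around each boundary
point the set is, in suitable orthonormal coordinates, the part of the ball strictly above the
graph of a Lipschitz function. -/
structure IsLipschitzDomain (U : Set Plane) : Prop where
  isOpen : IsOpen U
  isConnected : IsConnected U
  isBounded : Bornology.IsBounded U
  graph : ∀ x ∈ frontier U, ∃ (R : Plane ≃ₗᵢ[ℝ] Plane) (r : ℝ) (L : ℝ≥0) (g : ℝ → ℝ),
    0 < r ∧ LipschitzWith L g ∧
      ∀ y ∈ Metric.ball x r, y ∈ U ↔ g (R (y - x) 0) < R (y - x) 1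

/-- `b` is a continuous, piecewise `C¹` curve on `[α, β]` with `|b'| = 1`. -/
def IsPiecewiseC1UnitSpeed (b : ℝ → Plane) (α β : ℝ) : Prop :=
  ContinuousOn b (Icc α β) ∧
    ∃ (n : ℕ) (t : Fin (n + 1) → ℝ), StrictMono t ∧ t 0 = α ∧ t (Fin.last n) = β ∧
      ∀ j : Fin n,
        ContDiffOn ℝ 1 b (Icc (t j.castSucc) (t j.succ)) ∧
        ∀ s ∈ Icc (t j.castSucc) (t j.succ),
          ‖derivWithin b (Icc (t j.castSucc) (t j.succ)) s‖ = 1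

/-- The simple curve `γ = b([α, β])`, which runs inside `ω` except possibly for its end points,
partitions the Lipschitz domain `ω` into the two Lipschitz domains `ω₁` and `ω₂`.
(A closed curve, with `b α = b β`, is allowed.) -/
structure IsCreased (ω ω₁ ω₂ : Set Plane) (b : ℝ → Plane) (α β : ℝ) : Prop where
  lt : α < β
  lipschitz : IsLipschitzDomain ω
  lipschitz₁ : IsLipschitzDomain ω₁
  lipschitz₂ : IsLipschitzDomain ω₂
  curve : IsPiecewiseC1UnitSpeed b α β
  injOn : InjOn b (Ico α β)
  inside : b '' Ioo α β ⊆ ω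
  disjoint : Disjoint ω₁ ω₂
  partition : ω \ b '' Icc α β = ω₁ ∪ ω₂

/-- The set `V` of isometries of `ω` that are continuous across the crease `γ` and `H²` off it. -/
def MemV (ω γ : Set Plane) (v : Plane → Space) : Prop :=
  MemH2 (ω \ γ) v ∧ MemW1Infty ω v ∧ IsIsometric ω v

/-! ### Polygonal creases, triangulations, and fattened creases -/

/-- The data of one approximation: parameters `node 0, …, node n` of the interpolation points,
a triangulation, and the triangles whose union is the fattened crease. -/
structure CreaseMesh where
  n : ℕ
  node : Fin (n + 1) → ℝ
  mesh : Geometry.SimplicialComplex ℝ Plane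
  fat : Set (Finset Plane)

namespace CreaseMesh

/-- The fattened crease: the union of the selected closed triangles. -/
def fatCrease (M : CreaseMesh) : Set Plane :=
  ⋃ t ∈ M.fat, convexHull ℝ (t : Set Plane)

/-- Compatibility of the data with the sheet. The vertices of the polygonal crease are the points
`b (M.node i)`; it is the piecewise linear interpolant of `b` in these points. -/
structure IsAdmissible (M : CreaseMesh) (ω ω₁ ω₂ : Set Plane) (b : ℝ → Plane) (α β : ℝ) :
    Prop where
  node_strictMono : StrictMono M.node
  node_zero : M.node 0 = α
  node_last : M.node (Fin.last M.n) = β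
  /-- The mesh is a finite conforming triangulation of the closure of `ω`. -/
  finite : M.mesh.faces.Finite
  space_eq : M.mesh.space = closure ω
  /-- The triangulation matches the polygonal crease: each of its segments is an edge. -/
  segment_mem : ∀ i : Fin M.n, ∃ e ∈ M.mesh.faces,
    (e : Set Plane) = {b (M.node i.castSucc), b (M.node i.succ)}
  /-- The fattened crease consists of triangles of the mesh that have one of these segments
  as an edge. -/
  fat_triangle : ∀ t ∈ M.fat, t ∈ M.mesh.faces ∧ t.card = 3 ∧
    ∃ i : Fin M.n, b (M.node i.castSucc) ∈ t ∧ b (M.node i.succ) ∈ t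
  /-- The exact crease is contained in the fattened crease. -/
  crease_subset : b '' Icc α β ⊆ M.fatCrease
  /-- The two parts of `ω` left by the fattened crease are (connected) subdomains. -/
  connected₁ : IsConnected (ω₁ \ M.fatCrease)
  connected₂ : IsConnected (ω₂ \ M.fatCrease)
  /-- The two subdomains meet in the interior vertices of the polygonal crease. -/
  vertex_mem : ∀ i : Fin (M.n + 1), i ≠ 0 → i ≠ Fin.last M.n →
    b (M.node i) ∈ closure (ω₁ \ M.fatCrease) ∩ closure (ω₂ \ M.fatCrease)

end CreaseMesh

/-- Uniform shape regularity: every triangle contains a ball whose radius is at least a fixed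
multiple of the diameter. -/
def ShapeRegular (M : ℕ → CreaseMesh) : Prop :=
  ∃ κ : ℝ, 0 < κ ∧ ∀ m, ∀ t ∈ (M m).mesh.faces, t.card = 3 →
    ∃ x, Metric.closedBall x (κ * Metric.diam (t : Set Plane)) ⊆ convexHull ℝ (t : Set Plane)

/-- The maximal mesh size tends to zero. -/
def VanishingMeshSize (M : ℕ → CreaseMesh) : Prop :=
  ∀ ε : ℝ, 0 < ε → ∀ᶠ m in atTop, ∀ t ∈ (M m).mesh.faces, Metric.diam (t : Set Plane) < ε

/-- `v`, as an element of `L²(U)`, is continuous in the point `p` of the closure of `U`: it has a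
limit there, up to null sets. For `v` with a continuous representative on the open set `U` this says
that the representative has a limit at `p` from `U`. -/
def ContinuousInPoint (U : Set Plane) (v : Plane → Space) (p : Plane) : Prop :=
  ∃ y : Space, Tendsto v (𝓝 p ⊓ ae (volume.restrict U)) (𝓝 y)

/-- The set `Ṽₘ` of isometries that are `H²` off the fattened crease and continuous in the vertices
of the polygonal crease. Values of `v` on the fattened crease or outside `ω` play no role. -/
def MemVTilde (ω : Set Plane) (b : ℝ → Plane) (M : CreaseMesh) (v : Plane → Space) : Prop :=
  MemH2 (ω \ M.fatCrease) v ∧ IsIsometric (ω \ M.fatCrease) v ∧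
    ∀ i, ContinuousInPoint (ω \ M.fatCrease) v (b (M.node i))

/-- `wₖ → w` in `L²(ω; ℝ³)`. -/
def TendstoL2 (ω : Set Plane) (w : ℕ → Plane → Space) (w₀ : Plane → Space) : Prop :=
  Tendsto (fun k => eLpNorm (w k - w₀) 2 (volume.restrict ω)) atTop (𝓝 0)

end Folding

/-! An isometry has a representative that does not increase lengths along segments, and it suffices
to control such representatives. The difficulty is geometric: the sets `ω₁ \ M.fatCrease` are cut
out by triangles and are not Lipschitz domains with uniform constants, so a bound along segments
gives no uniform modulus of continuity up to the crease. What is uniform is the length of their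
boundaries. By shape regularity the diameter of a triangle of the fattened crease is controlled by
its crease edge, hence by an arc of the crease, and each edge belongs to at most two triangles
(`sum_diam_le`, `hausdorffMeasure_frontier_le`).

Boundary length controls oscillation (`abs_limitValue_sub_le`). The boundary values of a function
that is `1`-Lipschitz on triangles form a set of measure at most twice the length of the boundary.
If two limit values at points of the connected fattened crease were farther apart, an interval of
values between them would be avoided on the boundary. The points with values in this interval would
then form a closed set that separates the two points, although these lie in a connected set outside
the domain. `not_separated_near_preconnected` excludes this because circle-valued maps on the plane
have a continuous argument. Used globally, this bounds the oscillation of each side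
(`exists_oscillation_bound`). Used in a box of size `δ` around a regular crease point, it shows that
one side has limit values within a multiple of `δ` of its value at a nearby point off the crease
(`LocalBox.abs_sub_limitValue_le`). Both sides have the same limit in the vertices, so the limit map
does not jump across the crease and is Lipschitz on `ω` (`lipschitz_limit`,
`exists_lipschitz_extension`).

The analytic part uses weak `L²` limits of gradients and Hessians along an ultrafilter that realises
the lower limit of the energies; weak lower semicontinuity gives the energy inequality. The isometry
constraint is quadratic in weakly convergent gradients. Integration by parts rewrites it as pairings
of one strongly and one weakly convergent factor (`jacobian_eq_one_of_weakTendsto`). Since the limit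
is Lipschitz on `ω`, its gradient has no contribution on the crease. Without an `L²` bound, the
value at one point is subtracted first.

For recovery, a map in `V` has a Lipschitz representative on `ω`, which has limits in all vertices.
Every point off the crease is eventually off the fattened creases and the crease is a null set, so
the energies converge by dominated convergence. -/

namespace Folding

/-! ### A separation principle in the plane -/

/-- A continuous circle-valued function on the plane has a continuous argument. -/
theorem exists_continuous_arg (g : Plane → Circle) (hg : Continuous g) :
    ∃ h : Plane → ℝ, Continuous h ∧ ∀ x, Circle.exp (h x) = g x := by
  obtain ⟨e₀, he⟩ := Circle.exp_surjective (g 0)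
  obtain ⟨F, ⟨-, hF⟩, -⟩ := Circle.isCoveringMap_exp.existsUnique_continuousMap_lifts
    (⟨g, hg⟩ : C(Plane, Circle)) 0 e₀ he
  exact ⟨F, F.continuous, fun x => congrFun hF x⟩

/-- An integer-valued continuous function on a preconnected set is constant. -/
theorem IsPreconnected.eq_of_int_valued {X : Type*} [TopologicalSpace X] {K : Set X}
    (hK : IsPreconnected K) {h : X → ℝ} (hc : ContinuousOn h K)
    (hintg : ∀ x ∈ K, ∃ n : ℤ, h x = n) {p q : X} (hp : p ∈ K) (hq : q ∈ K) : h p = h q := by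
  by_contra hne
  wlog hlt : h p < h q generalizing p q
  · exact this hq hp (Ne.symm hne) (lt_of_le_of_ne (not_lt.1 hlt) (Ne.symm hne))
  obtain ⟨n, hn⟩ := hintg p hp
  obtain ⟨m, hm⟩ := hintg q hq
  have hnm : n + 1 ≤ m := by
    have : (n : ℝ) < m := by rw [← hn, ← hm]; exact hlt
    exact_mod_cast this
  have hnm' : (n : ℝ) + 1 ≤ m := by exact_mod_cast hnm
  obtain ⟨x, hx, hxv⟩ := hK.intermediate_value hp hq hc
    (show (n : ℝ) + 1 / 2 ∈ Icc (h p) (h q) by constructor <;> linarith)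
  obtain ⟨k, hk⟩ := hintg x hx
  have h1 : (n : ℝ) + 1 / 2 = k := by rw [← hxv, hk]
  have h2 : (n : ℝ) < k := by linarith
  have h3 : (k : ℝ) < n + 1 := by linarith
  have h2' : n < k := by exact_mod_cast h2
  have h3' : k < n + 1 := by exact_mod_cast h3
  omega

/-- Let `D` be a connected open set in the plane and `K` a connected set disjoint from it.
If the set where a continuous function `f` on `D` takes values in `[a, b]` is closed in the plane,
then `f` cannot be below `a` near one point of `K` and above `b` near another one. -/
theorem not_separated_near_preconnected {D K : Set Plane} (hD : IsOpen D) (hDc : IsPreconnected D)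
    (hK : IsPreconnected K) (hKD : Disjoint K D) {f : Plane → ℝ} (hf : ContinuousOn f D)
    {a b : ℝ} (hab : a < b) (hcl : IsClosed {x | x ∈ D ∧ f x ∈ Icc a b}) {p q : Plane}
    (hp : p ∈ K) (hq : q ∈ K) (hpa : p ∈ closure {x | x ∈ D ∧ f x < a})
    (hqb : q ∈ closure {x | x ∈ D ∧ b < f x}) : False := by
  classical
  -- The clamped level function is wrapped once around the circle. Both ends of `[0, 1]` go to `1`,
  -- so extension by `1` off `D` is continuous: points with an intermediate value cannot accumulate
  -- outside `D` by `hcl`.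
  set χ : Plane → ℝ := fun x => max 0 (min 1 ((f x - a) / (b - a))) with hχ
  have hba : 0 < b - a := sub_pos.2 hab
  have χ0 : ∀ x, f x < a → χ x = 0 := fun x hx => by
    have : (f x - a) / (b - a) ≤ 0 := div_nonpos_of_nonpos_of_nonneg (by linarith) hba.le
    exact max_eq_left ((min_le_right _ _).trans this)
  have χ1 : ∀ x, b < f x → χ x = 1 := fun x hx => by
    have : 1 ≤ (f x - a) / (b - a) := by rw [le_div_iff₀ hba]; linarith
    simp only [hχ, min_eq_left this]; norm_num
  have hχc : ContinuousOn χ D := by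
    have h1 : ContinuousOn (fun x => (f x - a) / (b - a)) D :=
      (hf.sub continuousOn_const).div_const _
    exact continuousOn_const.sup (continuousOn_const.inf h1)
  set g : Plane → Circle := fun x => if x ∈ D then Circle.exp (2 * Real.pi * χ x) else 1 with hg
  have hgc : Continuous g := by
    rw [continuous_iff_continuousAt]
    intro x
    by_cases hx : x ∈ D
    · have h1 : ContinuousAt (fun x => Circle.exp (2 * Real.pi * χ x)) x :=
        (Circle.exp.continuous.continuousAt).comp
          (continuousAt_const.mul (hχc.continuousAt (hD.mem_nhds hx)))
      refine h1.congr ?_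
      filter_upwards [hD.mem_nhds hx] with y hy
      simp [hg, hy]
    · have hx' : x ∈ {x | x ∈ D ∧ f x ∈ Icc a b}ᶜ := fun h => hx h.1
      have h1 : g =ᶠ[𝓝 x] fun _ => 1 := by
        filter_upwards [hcl.isOpen_compl.mem_nhds hx'] with y hy
        by_cases hyD : y ∈ D
        · simp only [hg, hyD, if_true]
          have : f y < a ∨ b < f y := by
            by_contra hcon
            push Not at hcon
            exact hy ⟨hyD, hcon⟩
          rcases this with h | h
          · rw [χ0 y h]; simp
          · rw [χ1 y h]; simp
        · simp [hg, hyD]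
      exact continuousAt_const.congr h1.symm
  obtain ⟨h, hhc, hh⟩ := exists_continuous_arg g hgc
  have hpi : (2 * Real.pi) ≠ 0 := by positivity
  have hintg : ∀ x t, Circle.exp (h x) = Circle.exp (2 * Real.pi * t) →
      ∃ n : ℤ, h x / (2 * Real.pi) - t = n := by
    intro x t hxt
    obtain ⟨n, hn⟩ := Circle.exp_eq_exp.1 hxt
    refine ⟨n, ?_⟩
    rw [hn]; field_simp; ring
  -- In full turns, the argument of `g` is an integer on `K`, hence constant there. On `D` it is `χ`
  -- plus a constant. Approaching `p` and `q` from `D` gives values that differ by one.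
  have hintK : ∀ x ∈ K, ∃ n : ℤ, h x / (2 * Real.pi) = n := by
    intro x hx
    have hxD : x ∉ D := fun h => (hKD.le_bot ⟨hx, h⟩).elim
    obtain ⟨n, hn⟩ := hintg x 0 (by rw [hh x]; simp [hg, hxD])
    exact ⟨n, by simpa using hn⟩
  have hKeq := IsPreconnected.eq_of_int_valued hK
    (h := fun x => h x / (2 * Real.pi)) ((hhc.div_const _).continuousOn) hintK hp hq
  have hDint : ∀ x ∈ D, ∃ n : ℤ, h x / (2 * Real.pi) - χ x = n := by
    intro x hx
    exact hintg x (χ x) (by rw [hh x]; simp [hg, hx])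
  have hDc' : ContinuousOn (fun x => h x / (2 * Real.pi) - χ x) D :=
    ((hhc.div_const _).continuousOn).sub hχc
  obtain ⟨x₀, hx₀, hx₀a⟩ : ({x | x ∈ D ∧ f x < a}).Nonempty := by
    rw [← closure_nonempty_iff]; exact ⟨p, hpa⟩
  set k := h x₀ / (2 * Real.pi) - χ x₀ with hk
  have hDk : ∀ x ∈ D, h x / (2 * Real.pi) = χ x + k := fun x hx => by
    have := IsPreconnected.eq_of_int_valued hDc hDc' hDint hx hx₀
    linarith
  have hpk : h p / (2 * Real.pi) = k := by
    have hclosed : IsClosed {x | h x / (2 * Real.pi) = k} :=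
      isClosed_eq (hhc.div_const _) continuous_const
    refine hclosed.closure_subset_iff.2 ?_ hpa
    rintro x ⟨hx, hxa⟩
    simp [hDk x hx, χ0 x hxa]
  have hqk : h q / (2 * Real.pi) = 1 + k := by
    have hclosed : IsClosed {x | h x / (2 * Real.pi) = 1 + k} :=
      isClosed_eq (hhc.div_const _) continuous_const
    refine hclosed.closure_subset_iff.2 ?_ hqb
    rintro x ⟨hx, hxb⟩
    simp [hDk x hx, χ1 x hxb]
  linarith

end Folding

/-! ### Functions that are `1`-Lipschitz along segments -/

namespace Folding

/-- `f` is `1`-Lipschitz along all segments contained in `U`. -/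
def SegLip {E : Type*} [NormedAddCommGroup E] (U : Set Plane) (f : Plane → E) : Prop :=
  ∀ x y, segment ℝ x y ⊆ U → ‖f x - f y‖ ≤ ‖x - y‖

section SegLip

variable {E : Type*} [NormedAddCommGroup E] {U W : Set Plane} {f : Plane → E}

theorem SegLip.mono (hf : SegLip W f) (h : U ⊆ W) : SegLip U f :=
  fun x y hxy => hf x y (hxy.trans h)

theorem SegLip.norm_sub_le_of_convex (hf : SegLip U f) (hU : Convex ℝ U) {x y : Plane}
    (hx : x ∈ U) (hy : y ∈ U) : ‖f x - f y‖ ≤ ‖x - y‖ :=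
  hf x y (hU.segment_subset hx hy)

theorem SegLip.sub_const (hf : SegLip U f) (a : E) : SegLip U (fun x => f x - a) := by
  intro x y hxy
  simpa using hf x y hxy

/-- Reduces Lipschitz estimates for vector-valued functions to the scalar case. -/
theorem SegLip.norm_sub (hf : SegLip U f) (a : E) : SegLip U (fun x => ‖f x - a‖) := by
  intro x y hxy
  rw [Real.norm_eq_abs]
  refine (abs_norm_sub_norm_le _ _).trans ?_
  simpa using hf x y hxy

theorem SegLip.continuousOn (hU : IsOpen U) (hf : SegLip U f) : ContinuousOn f U := by
  intro x hx
  obtain ⟨r, hr, hball⟩ := Metric.isOpen_iff.1 hU x hx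
  refine ContinuousAt.continuousWithinAt ?_
  rw [Metric.continuousAt_iff]
  intro ε hε
  refine ⟨min ε r, lt_min hε hr, fun y hy => ?_⟩
  rw [dist_eq_norm]
  refine ((hf.mono hball).norm_sub_le_of_convex (convex_ball x r)
    (Metric.mem_ball.2 (hy.trans_le (min_le_right _ _))) (Metric.mem_ball_self hr)).trans_lt ?_
  rw [← dist_eq_norm]
  exact hy.trans_le (min_le_left _ _)

theorem SegLip.coord {f : Plane → Space} (hf : SegLip U f) (k : Fin 3) :
    SegLip U (fun x => f x k) := by
  intro x y hxy
  refine le_trans ?_ (hf x y hxy)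
  have := PiLp.norm_apply_le (f x - f y) k
  simpa using this

end SegLip

/-! ### Charts of Lipschitz domains -/

/-- The coordinates `ξ` of a chart. -/
theorem chart_coord_sub_le (R : Plane ≃ₗᵢ[ℝ] Plane) (x y : Plane) (i : Fin 2) :
    |R x i - R y i| ≤ ‖x - y‖ := by
  have := PiLp.norm_apply_le (R (x - y)) i
  rw [LinearIsometryEquiv.norm_map] at this
  simpa using this

theorem chart_up_zero (R : Plane ≃ₗᵢ[ℝ] Plane) (y : Plane) (τ : ℝ) :
    R (y + τ • R.symm (EuclideanSpace.single 1 1)) 0 = R y 0 := by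
  simp

theorem chart_up_one (R : Plane ≃ₗᵢ[ℝ] Plane) (y : Plane) (τ : ℝ) :
    R (y + τ • R.symm (EuclideanSpace.single 1 1)) 1 = R y 1 + τ := by
  simp

theorem chart_up_norm (R : Plane ≃ₗᵢ[ℝ] Plane) (τ : ℝ) :
    ‖τ • R.symm (EuclideanSpace.single 1 1)‖ = |τ| := by
  simp [norm_smul]

/-- In a ball around a boundary point in which a Lipschitz domain is an epigraph, functions that are
`1`-Lipschitz along segments are Lipschitz. -/
theorem SegLip.norm_sub_le_of_chart {E : Type*} [NormedAddCommGroup E] {U : Set Plane}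
    {z : Plane} {R : Plane ≃ₗᵢ[ℝ] Plane} {r : ℝ} {L : ℝ≥0} {g : ℝ → ℝ} (hg : LipschitzWith L g)
    (hU : ∀ y ∈ Metric.ball z r, y ∈ U ↔ g (R (y - z) 0) < R (y - z) 1)
    {F : Plane → E} (hF : SegLip U F) {ρ : ℝ} (hρ : ρ * (1 + 2 * L) ≤ r) {x y : Plane}
    (hx : x ∈ Metric.ball z ρ) (hy : y ∈ Metric.ball z ρ) (hxU : x ∈ U) (hyU : y ∈ U) :
    ‖F x - F y‖ ≤ (1 + 2 * L) * ‖x - y‖ := by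
  set e : Plane := R.symm (EuclideanSpace.single 1 1) with he
  -- Both points are lifted by `τ` before they are joined: between their first coordinates the graph
  -- rises above its chord by at most `τ`. The detour has length `τ + ‖x - y‖ + τ`.
  set τ : ℝ := L * ‖x - y‖ with hτ
  have hL : (0 : ℝ) ≤ L := L.2
  have hτ0 : 0 ≤ τ := by positivity
  have hρ0 : 0 < ρ := lt_of_le_of_lt dist_nonneg hx
  have hxy : ‖x - y‖ < 2 * ρ := by
    rw [← dist_eq_norm]
    have := dist_triangle_right x y z
    have h1 := Metric.mem_ball.1 hx
    have h2 := Metric.mem_ball.1 hy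
    linarith
  have hτρ : τ ≤ L * (2 * ρ) := mul_le_mul_of_nonneg_left hxy.le hL
  -- The factor `1 + 2 * L` between the radii pays for the lift, since `τ ≤ L * (2 * ρ)`.
  have hshift : ∀ (w : Plane) (t : ℝ), w ∈ Metric.ball z ρ → 0 ≤ t → t ≤ τ →
      w + t • e ∈ Metric.ball z r := by
    intro w t hw ht htτ
    rw [Metric.mem_ball, dist_eq_norm] at hw ⊢
    have : ‖w + t • e - z‖ ≤ ‖w - z‖ + ‖t • e‖ := by
      rw [show w + t • e - z = (w - z) + t • e by abel]; exact norm_add_le _ _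
    rw [he, chart_up_norm, abs_of_nonneg ht] at this
    nlinarith
  have hball : ∀ w ∈ Metric.ball z ρ, w ∈ Metric.ball z r := fun w hw => by
    simpa using hshift w 0 hw le_rfl hτ0
  have hcoord : ∀ (w : Plane) (t : ℝ) , R (w + t • e - z) 0 = R (w - z) 0 ∧
      R (w + t • e - z) 1 = R (w - z) 1 + t := by
    intro w t
    rw [show w + t • e - z = (w - z) + t • e by abel, he]
    exact ⟨chart_up_zero R _ _, chart_up_one R _ _⟩
  have hvert : ∀ w ∈ Metric.ball z ρ, w ∈ U → segment ℝ w (w + τ • e) ⊆ U := by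
    intro w hw hwU q hq
    rw [segment_eq_image'] at hq
    obtain ⟨θ, ⟨h0, h1⟩, rfl⟩ := hq
    simp only [add_sub_cancel_left, smul_smul]
    have hθ : 0 ≤ θ * τ := by positivity
    rw [hU _ (hshift w _ hw hθ (by nlinarith)), (hcoord w _).1, (hcoord w _).2]
    have := (hU w (hball w hw)).1 hwU
    linarith
  have hmid : segment ℝ (x + τ • e) (y + τ • e) ⊆ U := by
    intro q hq
    obtain ⟨α, β, h0, h1, hs, rfl⟩ := hq
    have hw : α • x + β • y ∈ Metric.ball z ρ := (convex_ball z ρ) hx hy h0 h1 hs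
    have hq : α • (x + τ • e) + β • (y + τ • e) = (α • x + β • y) + τ • e := by
      have : (α • x + β • y) + τ • e = (α • x + β • y) + (α + β) • (τ • e) := by
        rw [hs, one_smul]
      rw [this]; module
    rw [hq, hU _ (hshift _ _ hw hτ0 le_rfl), (hcoord _ _).1, (hcoord _ _).2]
    have e1 : ∀ i, R (α • x + β • y - z) i = α * R (x - z) i + β * R (y - z) i := by
      intro i
      have : α • x + β • y - z = α • (x - z) + β • (y - z) := by
        have : z = (α + β) • z := by rw [hs, one_smul]
        nth_rw 1 [this]; module
      rw [this]; simp
    rw [e1, e1]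
    have gx := (hU x (hball x hx)).1 hxU
    have gy := (hU y (hball y hy)).1 hyU
    set a := R (x - z) 0
    set b := R (y - z) 0
    have hab : |a - b| ≤ ‖x - y‖ := by
      have := chart_coord_sub_le R (x - z) (y - z) 0
      rwa [sub_sub_sub_cancel_right] at this
    have k1 : g (α * a + β * b) ≤ g a + L * (β * |a - b|) := by
      have := hg.dist_le_mul (α * a + β * b) a
      rw [Real.dist_eq, Real.dist_eq] at this
      have e2 : α * a + β * b - a = -(β * (a - b)) := by
        have : α = 1 - β := by linarith
        rw [this]; ring
      rw [e2, abs_neg, abs_mul, abs_of_nonneg h1] at this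
      linarith [le_abs_self (g (α * a + β * b) - g a)]
    have k2 : g (α * a + β * b) ≤ g b + L * (α * |a - b|) := by
      have := hg.dist_le_mul (α * a + β * b) b
      rw [Real.dist_eq, Real.dist_eq] at this
      have e2 : α * a + β * b - b = (α * (a - b)) := by
        have : β = 1 - α := by linarith
        rw [this]; ring
      rw [e2, abs_mul, abs_of_nonneg h0] at this
      linarith [le_abs_self (g (α * a + β * b) - g b)]
    have k3 : g (α * a + β * b) ≤ α * g a + β * g b + L * (2 * α * β * |a - b|) := by
      have := add_le_add (mul_le_mul_of_nonneg_left k1 h0) (mul_le_mul_of_nonneg_left k2 h1)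
      have e3 : α * g (α * a + β * b) + β * g (α * a + β * b) = g (α * a + β * b) := by
        rw [← add_mul, hs, one_mul]
      nlinarith
    have k4 : 2 * α * β * |a - b| ≤ ‖x - y‖ := by
      have : 2 * α * β ≤ 1 := by nlinarith [sq_nonneg (α - β)]
      calc 2 * α * β * |a - b| ≤ 1 * |a - b| := by gcongr
        _ ≤ _ := by linarith
    have k5 : L * (2 * α * β * |a - b|) ≤ τ := mul_le_mul_of_nonneg_left k4 hL
    have k6 : α * g a + β * g b < α * R (x - z) 1 + β * R (y - z) 1 := by
      rcases h0.lt_or_eq with h | h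
      · have := mul_lt_mul_of_pos_left gx h
        have := mul_le_mul_of_nonneg_left gy.le h1
        linarith
      · have hb : β = 1 := by linarith
        rw [← h, hb]; linarith
    linarith
  have A := hF x (x + τ • e) (hvert x hx hxU)
  have B := hF _ _ hmid
  have C := hF y (y + τ • e) (hvert y hy hyU)
  have n1 : ‖x - (x + τ • e)‖ = τ := by
    rw [sub_add_cancel_left, norm_neg, he, chart_up_norm, abs_of_nonneg hτ0]
  have n2 : ‖y - (y + τ • e)‖ = τ := by
    rw [sub_add_cancel_left, norm_neg, he, chart_up_norm, abs_of_nonneg hτ0]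
  rw [n1] at A
  rw [n2] at C
  rw [add_sub_add_right_eq_sub] at B
  have : F x - F y = (F x - F (x + τ • e)) + (F (x + τ • e) - F (y + τ • e))
      - (F y - F (y + τ • e)) := by abel
  rw [this]
  refine (norm_sub_le _ _).trans ?_
  refine (add_le_add (norm_add_le _ _) le_rfl).trans ?_
  rw [hτ] at A C
  linarith

namespace IsLipschitzDomain

variable {U : Set Plane}

theorem isCompact_closure (hU : IsLipschitzDomain U) : IsCompact (closure U) :=
  hU.isBounded.isCompact_closure

/-- Around interior points a ball in the domain does, around boundary points the chart estimate. The
constant depends on the point but not on the function, which the compactness arguments need. -/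
theorem exists_local_lipschitz (hU : IsLipschitzDomain U) {z : Plane} (hz : z ∈ closure U) :
    ∃ ρ > 0, ∃ C : ℝ, 0 ≤ C ∧ ∀ F : Plane → ℝ, SegLip U F → ∀ x ∈ Metric.ball z ρ ∩ U,
      ∀ y ∈ Metric.ball z ρ ∩ U, |F x - F y| ≤ C * ‖x - y‖ := by
  by_cases hzU : z ∈ U
  · obtain ⟨r, hr, hball⟩ := Metric.isOpen_iff.1 hU.isOpen z hzU
    refine ⟨r, hr, 1, zero_le_one, fun F hF x hx y hy => ?_⟩
    rw [one_mul]
    exact (hF.mono hball).norm_sub_le_of_convex (convex_ball z r) hx.1 hy.1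
  · have hfr : z ∈ frontier U := by rw [hU.isOpen.frontier_eq]; exact ⟨hz, hzU⟩
    obtain ⟨R, r, L, g, hr, hg, hch⟩ := hU.graph z hfr
    have hpos : (0 : ℝ) < 1 + 2 * L := by positivity
    refine ⟨r / (1 + 2 * L), by positivity, 1 + 2 * L, hpos.le, fun F hF x hx y hy => ?_⟩
    exact hF.norm_sub_le_of_chart hg hch (by field_simp; exact le_rfl) hx.1 hy.1 hx.2 hy.2

/-- The points at which all such functions stay within a common bound of their value at `x₀` form an
open and relatively closed set, because local bounds propagate near every point of the closure.
Connectedness gives all of `U`, and compactness of `closure U` makes the bound uniform. -/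
theorem exists_bound (hU : IsLipschitzDomain U) :
    ∃ C : ℝ, ∀ F : Plane → ℝ, SegLip U F → ∀ x ∈ U, ∀ y ∈ U, |F x - F y| ≤ C := by
  obtain ⟨x₀, hx₀⟩ := hU.isConnected.nonempty
  set A : Set Plane := {x | x ∈ U ∧ ∃ C : ℝ, ∀ F : Plane → ℝ, SegLip U F → |F x - F x₀| ≤ C}
    with hA
  have hloc : ∀ z ∈ closure U, ∃ ρ > 0, ∃ C : ℝ, ∀ F : Plane → ℝ, SegLip U F →
      ∀ x ∈ Metric.ball z ρ ∩ U, ∀ y ∈ Metric.ball z ρ ∩ U, |F x - F y| ≤ C := by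
    intro z hz
    obtain ⟨ρ, hρ, C, hC, h⟩ := hU.exists_local_lipschitz hz
    refine ⟨ρ, hρ, C * (2 * ρ), fun F hF x hx y hy => (h F hF x hx y hy).trans ?_⟩
    gcongr
    have := dist_triangle_right x y z
    rw [← dist_eq_norm]
    have h1 := Metric.mem_ball.1 hx.1
    have h2 := Metric.mem_ball.1 hy.1
    linarith
  have hprop : ∀ z ∈ closure U, ∃ ρ > 0, ∀ x ∈ Metric.ball z ρ ∩ U, ∀ y ∈ Metric.ball z ρ ∩ U,
      x ∈ A → y ∈ A := by
    intro z hz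
    obtain ⟨ρ, hρ, C, h⟩ := hloc z hz
    refine ⟨ρ, hρ, fun x hx y hy hxA => ⟨hy.2, ?_⟩⟩
    obtain ⟨-, C', hC'⟩ := hxA
    refine ⟨C + C', fun F hF => ?_⟩
    have := abs_sub_le (F y) (F x) (F x₀)
    linarith [h F hF y hy x hx, hC' F hF]
  have hAU : U ⊆ A := by
    have hAo : IsOpen A := by
      rw [Metric.isOpen_iff]
      intro z hz
      obtain ⟨ρ, hρ, h⟩ := hprop z (subset_closure hz.1)
      obtain ⟨r, hr, hball⟩ := Metric.isOpen_iff.1 hU.isOpen z hz.1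
      refine ⟨min ρ r, lt_min hρ hr, fun y hy => h z ⟨Metric.mem_ball_self hρ, hz.1⟩ y
        ⟨Metric.ball_subset_ball (min_le_left _ _) hy,
          hball (Metric.ball_subset_ball (min_le_right _ _) hy)⟩ hz⟩
    refine hU.isConnected.isPreconnected.subset_of_closure_inter_subset hAo
      ⟨x₀, hx₀, hx₀, 0, fun F _ => by simp⟩ ?_
    rintro z ⟨hzA, hzU⟩
    obtain ⟨ρ, hρ, h⟩ := hprop z (subset_closure hzU)
    obtain ⟨y, hy, hyA⟩ := mem_closure_iff.1 hzA _ Metric.isOpen_ball (Metric.mem_ball_self hρ)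
    exact h y ⟨hy, hyA.1⟩ z ⟨Metric.mem_ball_self hρ, hzU⟩ hyA
  have hcomp : ∃ C : ℝ, ∀ F : Plane → ℝ, SegLip U F → ∀ x ∈ closure U ∩ U, |F x - F x₀| ≤ C := by
    refine hU.isCompact_closure.induction_on
      (p := fun s => ∃ C : ℝ, ∀ F : Plane → ℝ, SegLip U F → ∀ x ∈ s ∩ U, |F x - F x₀| ≤ C)
      ⟨0, by simp⟩ ?_ ?_ ?_
    · rintro s t hst ⟨C, hC⟩
      exact ⟨C, fun F hF x hx => hC F hF x ⟨hst hx.1, hx.2⟩⟩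
    · rintro s t ⟨C, hC⟩ ⟨C', hC'⟩
      refine ⟨max C C', fun F hF x hx => ?_⟩
      rcases hx.1 with h | h
      · exact (hC F hF x ⟨h, hx.2⟩).trans (le_max_left _ _)
      · exact (hC' F hF x ⟨h, hx.2⟩).trans (le_max_right _ _)
    · intro z hz
      obtain ⟨ρ, hρ, C, h⟩ := hloc z hz
      refine ⟨_, mem_nhdsWithin_of_mem_nhds (Metric.ball_mem_nhds z hρ), ?_⟩
      obtain ⟨y, hy, hyU⟩ := mem_closure_iff.1 hz _ Metric.isOpen_ball (Metric.mem_ball_self hρ)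
      obtain ⟨-, C', hC'⟩ := hAU hyU
      refine ⟨C + C', fun F hF x hx => ?_⟩
      have := abs_sub_le (F x) (F y) (F x₀)
      linarith [h F hF x hx y ⟨hy, hyU⟩, hC' F hF]
  obtain ⟨C, hC⟩ := hcomp
  refine ⟨C + C, fun F hF x hx y hy => ?_⟩
  have := abs_sub_le (F x) (F x₀) (F y)
  have h1 := hC F hF x ⟨subset_closure hx, hx⟩
  have h2 := hC F hF y ⟨subset_closure hy, hy⟩
  rw [abs_sub_comm] at h2
  linarith

/-- On a bounded Lipschitz domain, functions that are `1`-Lipschitz along segments are Lipschitz,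
with a constant that depends only on the domain. -/
theorem exists_lipschitz_real (hU : IsLipschitzDomain U) :
    ∃ C : ℝ, 0 ≤ C ∧ ∀ F : Plane → ℝ, SegLip U F → ∀ x ∈ U, ∀ y ∈ U,
      |F x - F y| ≤ C * ‖x - y‖ := by
  obtain ⟨C₀, hC₀⟩ := hU.exists_bound
  choose! ρ hρ C hC hloc using fun z (hz : z ∈ closure U) => hU.exists_local_lipschitz hz
  obtain ⟨t, ht, hcov⟩ := hU.isCompact_closure.elim_nhds_subcover
    (fun z => Metric.ball z (ρ z / 2)) (fun z hz => Metric.ball_mem_nhds z (half_pos (hρ z hz)))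
  obtain ⟨x₀, hx₀⟩ := hU.isConnected.nonempty
  have htne : t.Nonempty := by
    obtain ⟨z, hz, -⟩ := mem_iUnion₂.1 (hcov (subset_closure hx₀))
    exact ⟨z, hz⟩
  obtain ⟨z₀, hz₀, hmin⟩ := t.exists_min_image (fun z => ρ z / 2) htne
  -- A Lebesgue number of the cover: points closer than `lam` lie in a common ball, and for all
  -- others the bound `C₀` is at most `C₀ / lam * ‖x - y‖`.
  set lam := ρ z₀ / 2 with hlam
  have hlam0 : 0 < lam := half_pos (hρ z₀ (ht z₀ hz₀))
  have hC₀0 : 0 ≤ C₀ := (abs_nonneg _).trans (hC₀ (fun _ => 0) (fun _ _ _ => by simp) x₀ hx₀ x₀ hx₀)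
  have hCs : ∀ z ∈ t, C z ≤ ∑ z ∈ t, C z := fun z hz =>
    Finset.single_le_sum (f := C) (fun w hw => hC w (ht w hw)) hz
  have hCs0 : 0 ≤ ∑ z ∈ t, C z := Finset.sum_nonneg fun w hw => hC w (ht w hw)
  refine ⟨∑ z ∈ t, C z + C₀ / lam, by positivity, fun F hF x hx y hy => ?_⟩
  have hn := norm_nonneg (x - y)
  by_cases hxy : ‖x - y‖ < lam
  · obtain ⟨z, hz, hxz⟩ := mem_iUnion₂.1 (hcov (subset_closure hx))
    have hm : lam ≤ ρ z / 2 := hmin z hz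
    have hx' : x ∈ Metric.ball z (ρ z) := by
      rw [Metric.mem_ball] at hxz ⊢; linarith [hρ z (ht z hz)]
    have hy' : y ∈ Metric.ball z (ρ z) := by
      rw [Metric.mem_ball] at hxz ⊢
      have := dist_triangle y x z
      rw [dist_comm y x, dist_eq_norm x y] at this
      linarith
    refine (hloc z (ht z hz) F hF x ⟨hx', hx⟩ y ⟨hy', hy⟩).trans ?_
    have := hCs z hz
    have : 0 ≤ C₀ / lam := by positivity
    gcongr
    linarith
  · push Not at hxy
    refine (hC₀ F hF x hx y hy).trans ?_
    have h1 : C₀ ≤ C₀ / lam * ‖x - y‖ := by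
      rw [div_mul_eq_mul_div, le_div_iff₀ hlam0]; gcongr
    have h2 : 0 ≤ (∑ z ∈ t, C z) * ‖x - y‖ := by positivity
    linarith

/-- The scalar bound is applied to the distance of `F` from its value at one of the two points. -/
theorem exists_lipschitz (hU : IsLipschitzDomain U) :
    ∃ C : ℝ≥0, ∀ (E : Type) [NormedAddCommGroup E] (F : Plane → E), SegLip U F →
      LipschitzOnWith C F U := by
  obtain ⟨C, hC, h⟩ := hU.exists_lipschitz_real
  refine ⟨⟨C, hC⟩, fun E _ F hF => LipschitzOnWith.of_dist_le_mul fun x hx y hy => ?_⟩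
  have := h _ (hF.norm_sub (F y)) x hx y hy
  simp only [sub_self, norm_zero, sub_zero, abs_norm] at this
  rw [dist_eq_norm, dist_eq_norm]
  exact this

/-- Below the graph there are exterior points arbitrarily close to each boundary point. This is what
places open triangles of `closure ω` in `ω`. -/
theorem interior_closure (hU : IsLipschitzDomain U) : interior (closure U) = U := by
  refine subset_antisymm ?_ (interior_maximal subset_closure hU.isOpen)
  intro z hz
  by_contra hzU
  have hfr : z ∈ frontier U := by
    rw [hU.isOpen.frontier_eq]; exact ⟨interior_subset hz, hzU⟩
  obtain ⟨R, r, L, g, hr, hg, hch⟩ := hU.graph z hfr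
  have hgz : 0 ≤ g 0 := by
    have := hch z (Metric.mem_ball_self hr)
    simp only [sub_self, map_zero, PiLp.zero_apply] at this
    exact not_lt.1 fun h => hzU (this.2 h)
  obtain ⟨ε, hε, hball⟩ := Metric.isOpen_iff.1 isOpen_interior z hz
  set e : Plane := R.symm (EuclideanSpace.single 1 1) with he
  set τ := min ε r / 2 with hτ
  have hm : 0 < min ε r := lt_min hε hr
  have hτ0 : 0 < τ := half_pos hm
  set y := z + (-τ) • e with hy
  have hyz : dist y z = τ := by
    rw [hy, dist_eq_norm, add_sub_cancel_left, he, chart_up_norm, abs_neg, abs_of_pos hτ0]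
  have hy1 : y ∈ Metric.ball z ε := by
    rw [Metric.mem_ball, hyz]; have := min_le_left ε r; linarith
  have hy2 : y ∈ Metric.ball z r := by
    rw [Metric.mem_ball, hyz]; have := min_le_right ε r; linarith
  have hopen : IsOpen (Metric.ball z r ∩ {w | R (w - z) 1 < g (R (w - z) 0)}) := by
    refine Metric.isOpen_ball.inter (isOpen_lt ?_ (hg.continuous.comp ?_)) <;> fun_prop
  have hyO : y ∈ Metric.ball z r ∩ {w | R (w - z) 1 < g (R (w - z) 0)} := by
    refine ⟨hy2, ?_⟩
    have : y - z = 0 + (-τ) • e := by rw [hy]; abel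
    rw [Set.mem_ofPred_eq, this, he, chart_up_zero, chart_up_one]
    simp only [map_zero, PiLp.zero_apply]
    linarith
  obtain ⟨w, hwO, hwU⟩ := mem_closure_iff.1 (interior_subset (hball hy1)) _ hopen hyO
  have := (hch w hwO.1).1 hwU
  exact absurd hwO.2 (not_lt.2 this.le)

/-- The part of the boundary in a chart lies on the graph. -/
theorem frontier_chart (hUo : IsOpen U) {z : Plane} {R : Plane ≃ₗᵢ[ℝ] Plane} {r : ℝ} {L : ℝ≥0}
    {g : ℝ → ℝ} (hg : LipschitzWith L g)
    (hch : ∀ y ∈ Metric.ball z r, y ∈ U ↔ g (R (y - z) 0) < R (y - z) 1) {y : Plane}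
    (hy : y ∈ Metric.ball z r) (hyf : y ∈ frontier U) : g (R (y - z) 0) = R (y - z) 1 := by
  rw [hUo.frontier_eq] at hyf
  refine le_antisymm ?_ (not_lt.1 fun h => hyf.2 ((hch y hy).2 h))
  by_contra hlt
  push Not at hlt
  have hopen : IsOpen (Metric.ball z r ∩ {w | R (w - z) 1 < g (R (w - z) 0)}) := by
    refine Metric.isOpen_ball.inter (isOpen_lt ?_ (hg.continuous.comp ?_)) <;> fun_prop
  obtain ⟨w, hwO, hwU⟩ := mem_closure_iff.1 hyf.1 _ hopen ⟨hy, hlt⟩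
  exact absurd hwO.2 (not_lt.2 ((hch w hwO.1).1 hwU).le)

/-- Finitely many charts cover the boundary, and in each of them it is contained in the image of a
bounded interval under the Lipschitz parametrisation of the graph. -/
theorem hausdorffMeasure_frontier_lt_top (hU : IsLipschitzDomain U) :
    Measure.hausdorffMeasure 1 (frontier U) < ∞ := by
  have hc : IsCompact (frontier U) :=
    hU.isCompact_closure.of_isClosed_subset isClosed_frontier frontier_subset_closure
  refine hc.measure_lt_top_of_nhdsWithin fun z hz => ?_
  obtain ⟨R, r, L, g, hr, hg, hch⟩ := hU.graph z hz
  refine ⟨_, mem_nhdsWithin_iff_exists_mem_nhds_inter.2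
    ⟨Metric.ball z r, Metric.ball_mem_nhds z hr, (inter_comm _ _).subset⟩, ?_⟩
  set G : ℝ → Plane := fun t => z + R.symm (t • EuclideanSpace.single 0 1
    + g t • EuclideanSpace.single 1 1) with hG
  have hGL : LipschitzWith (1 + L) G := by
    refine LipschitzWith.of_dist_le_mul fun s t => ?_
    rw [hG, dist_add_left, LinearIsometryEquiv.dist_map, dist_eq_norm]
    have : s • EuclideanSpace.single 0 (1 : ℝ) + g s • EuclideanSpace.single 1 (1 : ℝ)
        - (t • EuclideanSpace.single 0 (1 : ℝ) + g t • EuclideanSpace.single 1 (1 : ℝ))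
        = ((s - t) • EuclideanSpace.single 0 (1 : ℝ)
          + (g s - g t) • EuclideanSpace.single 1 (1 : ℝ) : Plane) := by module
    rw [this]
    refine (norm_add_le _ _).trans ?_
    have hd := hg.dist_le_mul s t
    rw [Real.dist_eq] at hd
    simp only [norm_smul, Real.norm_eq_abs, PiLp.norm_single, norm_one, mul_one,
      NNReal.coe_add, NNReal.coe_one, add_mul, one_mul, Real.dist_eq]
    rw [Real.dist_eq] at hd
    linarith
  have hsub : frontier U ∩ Metric.ball z r ⊆ G '' Icc (-r) r := by
    rintro y ⟨hyf, hy⟩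
    have h1 := frontier_chart hU.isOpen hg hch hy hyf
    have h2 : |R (y - z) 0| ≤ r := by
      have := PiLp.norm_apply_le (R (y - z)) 0
      rw [LinearIsometryEquiv.norm_map, Real.norm_eq_abs, ← dist_eq_norm] at this
      exact this.trans (Metric.mem_ball.1 hy).le
    refine ⟨R (y - z) 0, abs_le.1 h2, ?_⟩
    simp only [hG]
    have : (R (y - z) 0 • EuclideanSpace.single 0 (1 : ℝ)
        + g (R (y - z) 0) • EuclideanSpace.single 1 (1 : ℝ) : Plane) = R (y - z) := by
      rw [h1]; ext i; fin_cases i <;> simp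
    rw [this]; simp
  refine (measure_mono hsub).trans_lt ?_
  refine (hGL.hausdorffMeasure_image_le zero_le_one _).trans_lt ?_
  rw [MeasureTheory.hausdorffMeasure_real]
  simp [ENNReal.mul_lt_top]

end IsLipschitzDomain

end Folding

namespace Folding

/-! ### Triangles -/

/-- The determinant of two plane vectors. -/
def cross (u w : Plane) : ℝ := u 0 * w 1 - u 1 * w 0

theorem cross_add_right (u v w : Plane) : cross u (v + w) = cross u v + cross u w := by
  simp [cross]; ring

theorem cross_smul_right (u w : Plane) (t : ℝ) : cross u (t • w) = t * cross u w := by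
  simp [cross]; ring

theorem cross_sub_right (u v w : Plane) : cross u (v - w) = cross u v - cross u w := by
  simp [cross]; ring

theorem cross_self (u : Plane) : cross u u = 0 := by simp [cross]; ring

theorem exists_smul_of_cross_eq_zero {u w : Plane} (hu : u ≠ 0) (h : cross u w = 0) :
    ∃ s : ℝ, w = s • u := by
  simp only [cross] at h
  by_cases h0 : u 0 = 0
  · have h1 : u 1 ≠ 0 := by
      intro h1; apply hu; ext i; fin_cases i <;> simp [h0, h1]
    refine ⟨w 1 / u 1, ?_⟩
    have : w 0 = 0 := by
      have : u 1 * w 0 = 0 := by rw [h0] at h; linarith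
      exact (mul_eq_zero.1 this).resolve_left h1
    ext i; fin_cases i
    · simp [h0, this]
    · simp [h1]
  · refine ⟨w 0 / u 0, ?_⟩
    ext i; fin_cases i
    · simp [h0]
    · simp; field_simp; linarith

theorem cross_ne_zero_of_affineIndependent {t : Finset Plane}
    (hind : AffineIndependent ℝ ((↑) : t → Plane)) {a b c : Plane} (ha : a ∈ t) (hb : b ∈ t)
    (hc : c ∈ t) (hab : a ≠ b) (hac : a ≠ c) (hbc : b ≠ c) : cross (b - a) (c - a) ≠ 0 := by
  intro h
  obtain ⟨s, hs⟩ := exists_smul_of_cross_eq_zero (sub_ne_zero.2 hab.symm) h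
  set e : Fin 3 ↪ t := ⟨![⟨a, ha⟩, ⟨b, hb⟩, ⟨c, hc⟩], by
    intro i j hij
    fin_cases i <;> fin_cases j <;> simp_all [eq_comm]⟩ with he
  have h3 := hind.comp_embedding e
  have h4 : AffineIndependent ℝ ![a, b, c] := by
    convert h3 using 1
    ext i : 1
    fin_cases i <;> rfl
  rw [affineIndependent_iff_not_collinear_set] at h4
  apply h4
  rw [collinear_iff_of_mem (p₀ := a) (by simp)]
  refine ⟨b - a, ?_⟩
  intro p hp
  rcases hp with rfl | rfl | rfl
  · exact ⟨0, by simp⟩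
  · exact ⟨1, by simp⟩
  · exact ⟨s, by rw [vadd_eq_add, ← hs]; abel⟩

theorem exists_eq_of_mem_convexHull_triple {a b c x : Plane}
    (hx : x ∈ convexHull ℝ ({a, b, c} : Set Plane)) :
    ∃ p q r : ℝ, 0 ≤ p ∧ 0 ≤ q ∧ 0 ≤ r ∧ p + q + r = 1 ∧ x = p • a + q • b + r • c := by
  rw [convexHull_insert (by simp), convexHull_pair, mem_convexJoin] at hx
  obtain ⟨a', rfl, y, ⟨s, t, hs, ht, hst, rfl⟩, ⟨u, v, hu, hv, huv, rfl⟩⟩ := hx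
  refine ⟨u, v * s, v * t, hu, by positivity, by positivity, ?_, ?_⟩
  · rw [add_assoc, ← mul_add, hst, mul_one, huv]
  · module

theorem mem_convexHull_triple {a b c : Plane} {p q r : ℝ} (hp : 0 ≤ p) (hq : 0 ≤ q) (hr : 0 ≤ r)
    (h : p + q + r = 1) : p • a + q • b + r • c ∈ convexHull ℝ ({a, b, c} : Set Plane) := by
  have hc := convex_convexHull ℝ ({a, b, c} : Set Plane)
  have ha : a ∈ convexHull ℝ ({a, b, c} : Set Plane) := subset_convexHull ℝ _ (by simp)
  have hb : b ∈ convexHull ℝ ({a, b, c} : Set Plane) := subset_convexHull ℝ _ (by simp)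
  have hc' : c ∈ convexHull ℝ ({a, b, c} : Set Plane) := subset_convexHull ℝ _ (by simp)
  have := hc.sum_mem (t := Finset.univ) (w := ![p, q, r]) (z := ![a, b, c])
    (by intro i _; fin_cases i <;> simpa) (by simp [Fin.sum_univ_three, h])
    (by intro i _; fin_cases i <;> simpa)
  simpa [Fin.sum_univ_three] using this

/-- A chord of a triangle that is parallel to an edge is not longer than this edge. -/
theorem two_mul_le_norm_edge {t : Finset Plane} (hind : AffineIndependent ℝ ((↑) : t → Plane))
    (hcard : t.card = 3) {a b : Plane} (ha : a ∈ t) (hb : b ∈ t) (hab : a ≠ b) {x : Plane} {ρ : ℝ}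
    (hρ : 0 ≤ ρ) (hball : Metric.closedBall x ρ ⊆ convexHull ℝ (t : Set Plane)) :
    2 * ρ ≤ ‖b - a‖ := by
  classical
  obtain ⟨c, hct, hca, hcb⟩ : ∃ c ∈ t, c ≠ a ∧ c ≠ b := by
    have : 0 < ((t.erase a).erase b).card := by
      rw [Finset.card_erase_of_mem (by simp [hb, hab.symm]), Finset.card_erase_of_mem ha, hcard]
      norm_num
    obtain ⟨c, hc⟩ := Finset.card_pos.1 this
    simp only [Finset.mem_erase] at hc
    exact ⟨c, hc.2.2, hc.2.1, hc.1⟩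
  have ht : t = {a, b, c} := by
    symm
    apply Finset.eq_of_subset_of_card_le
    · intro y hy; simp at hy; rcases hy with rfl | rfl | rfl <;> assumption
    · rw [hcard, Finset.card_eq_three.2 ⟨a, b, c, hab, hca.symm, hcb.symm, rfl⟩]
  have hcr := cross_ne_zero_of_affineIndependent hind ha hb hct hab hca.symm hcb.symm
  have hcoe : (t : Set Plane) = {a, b, c} := by rw [ht]; simp
  rw [hcoe] at hball
  have hn : 0 < ‖b - a‖ := norm_pos_iff.2 (sub_ne_zero.2 hab.symm)
  -- The diameter of the ball parallel to the edge has its end points in the triangle. Pairing with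
  -- `cross (b - a)` shows that these have the same barycentric coordinate at `c`, so they differ by
  -- a multiple of the edge with a factor in `[-1, 1]`.
  set u : Plane := (ρ / ‖b - a‖) • (b - a) with hu
  have hun : ‖u‖ = ρ := by
    rw [hu, norm_smul, Real.norm_of_nonneg (by positivity)]; field_simp
  obtain ⟨p, q, r, hp, hq, hr, hs, hx1⟩ := exists_eq_of_mem_convexHull_triple
    (hball (show x + u ∈ Metric.closedBall x ρ by simp [hun]))
  obtain ⟨p', q', r', hp', hq', hr', hs', hx2⟩ := exists_eq_of_mem_convexHull_triple
    (hball (show x - u ∈ Metric.closedBall x ρ by simp [hun]))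
  have e1 : x + u - a = q • (b - a) + r • (c - a) := by
    have : p = 1 - q - r := by linarith
    rw [hx1, this]; module
  have e2 : x - u - a = q' • (b - a) + r' • (c - a) := by
    have : p' = 1 - q' - r' := by linarith
    rw [hx2, this]; module
  have e3 : (2 : ℝ) • u = (q - q') • (b - a) + (r - r') • (c - a) := by
    have : (2 : ℝ) • u = (x + u - a) - (x - u - a) := by module
    rw [this, e1, e2]; module
  have h4 := congrArg (cross (b - a)) e3
  simp only [cross_add_right, cross_smul_right, hu, cross_self] at h4
  have h5 : r - r' = 0 := by
    have : (r - r') * cross (b - a) (c - a) = 0 := by linarith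
    exact (mul_eq_zero.1 this).resolve_right hcr
  rw [h5, zero_smul, add_zero] at e3
  have h6 := congrArg norm e3
  rw [norm_smul (2 : ℝ) u, hun, norm_smul] at h6
  have h7 : ‖q - q'‖ ≤ 1 := by rw [Real.norm_eq_abs, abs_le]; constructor <;> linarith
  have h8 : ‖(2 : ℝ)‖ = 2 := by norm_num
  rw [h8] at h6
  rw [h6]
  calc ‖q - q'‖ * ‖b - a‖ ≤ 1 * ‖b - a‖ := by gcongr
    _ = _ := one_mul _

/-- The hull of at most two points is a null set. -/
theorem volume_convexHull_eq_zero_of_card_le_two {s : Finset Plane} (hs : s.card ≤ 2) :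
    volume (convexHull ℝ (s : Set Plane)) = 0 := by
  refine measure_mono_null (convexHull_subset_affineSpan _)
    (Measure.addHaar_affineSubspace volume _ ?_)
  intro htop
  have hcol : Collinear ℝ (s : Set Plane) := by
    have h3 : s.card = 0 ∨ s.card = 1 ∨ s.card = 2 := by omega
    rcases h3 with h | h | h
    · rw [Finset.card_eq_zero.1 h]; simpa using collinear_empty ℝ Plane
    · obtain ⟨a, rfl⟩ := Finset.card_eq_one.1 h
      simpa using collinear_singleton ℝ a
    · obtain ⟨a, b, -, rfl⟩ := Finset.card_eq_two.1 h
      simpa using collinear_pair ℝ a b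
  rw [collinear_iff_finrank_le_one] at hcol
  rw [← direction_affineSpan, htop, AffineSubspace.direction_top, finrank_top] at hcol
  simp at hcol

/-- Triangles have nonempty interior. -/
theorem interior_convexHull_nonempty {t : Finset Plane}
    (hind : AffineIndependent ℝ ((↑) : t → Plane)) (hcard : t.card = 3) :
    (interior (convexHull ℝ (t : Set Plane))).Nonempty := by
  rw [interior_convexHull_nonempty_iff_affineSpan_eq_top]
  have := hind.affineSpan_eq_top_iff_card_eq_finrank_add_one.2 (by simp [hcard])
  simpa using this

theorem card_le_three {t : Finset Plane} (hind : AffineIndependent ℝ ((↑) : t → Plane)) :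
    t.card ≤ 3 := by
  have h := hind.card_le_finrank_succ
  have h2 := Submodule.finrank_le (vectorSpan ℝ (range ((↑) : t → Plane)))
  simp at h h2
  omega

theorem isCompact_convexHull_finset (t : Finset Plane) :
    IsCompact (convexHull ℝ (t : Set Plane)) :=
  t.finite_toSet.isCompact_convexHull ℝ

theorem closure_interior_convexHull {t : Finset Plane}
    (hind : AffineIndependent ℝ ((↑) : t → Plane)) (hcard : t.card = 3) :
    closure (interior (convexHull ℝ (t : Set Plane))) = convexHull ℝ (t : Set Plane) := by
  rw [(convex_convexHull ℝ _).closure_interior_eq_closure_of_nonempty_interior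
    (interior_convexHull_nonempty hind hcard), (isCompact_convexHull_finset t).isClosed.closure_eq]

section Complex

variable {K : Geometry.SimplicialComplex ℝ Plane}

theorem two_le_card_of_mem_convexHull {s : Finset Plane} {z : Plane} (hz : z ∉ s)
    (h : z ∈ convexHull ℝ (s : Set Plane)) : 2 ≤ s.card := by
  by_contra hlt
  have h3 : s.card = 0 ∨ s.card = 1 := by omega
  rcases h3 with h' | h'
  · rw [Finset.card_eq_zero.1 h'] at h; simp at h
  · obtain ⟨a, rfl⟩ := Finset.card_eq_one.1 h'
    simp at h hz; exact hz h

-- Conformity puts `z` into the hull of the common vertices. There are at least two of them because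
-- `z` is not a vertex, and fewer than three because the triangles differ.
open Classical in
theorem card_inter_eq_two {s t : Finset Plane} (hs : s ∈ K.faces) (ht : t ∈ K.faces)
    (hs3 : s.card = 3) (ht3 : t.card = 3) (hne : s ≠ t) {z : Plane} (hz : z ∉ s)
    (hzs : z ∈ convexHull ℝ (s : Set Plane)) (hzt : z ∈ convexHull ℝ (t : Set Plane)) :
    (s ∩ t).card = 2 ∧ z ∈ convexHull ℝ ((s ∩ t : Finset Plane) : Set Plane) := by
  have h := K.inter_subset_convexHull hs ht ⟨hzs, hzt⟩
  rw [← Finset.coe_inter] at h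
  refine ⟨le_antisymm ?_ (two_le_card_of_mem_convexHull (fun h => hz (Finset.mem_inter.1 h).1) h),
    h⟩
  by_contra hlt
  push Not at hlt
  have h1 : s ∩ t = s := Finset.eq_of_subset_of_card_le Finset.inter_subset_left (by omega)
  have h2 : s ∩ t = t := Finset.eq_of_subset_of_card_le Finset.inter_subset_right (by omega)
  exact hne (h1.symm.trans h2)

/-- Two different triangles of a complex cannot lie on the same side of a common edge. -/
theorem cross_mul_cross_neg {a b x y z : Plane} {s t : Finset Plane} (hs : s ∈ K.faces)
    (ht : t ∈ K.faces) (hsx : (s : Set Plane) = {a, b, x}) (hty : (t : Set Plane) = {a, b, y})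
    (hst : (s : Set Plane) ∩ t = {a, b}) (hab : a ≠ b) {θ : ℝ} (h0 : 0 < θ) (h1 : θ < 1)
    (hz : z = (1 - θ) • a + θ • b) :
    ¬ 0 < cross (b - a) (x - z) * cross (b - a) (y - z) := by
  intro hpos
  set u := b - a with hu
  have hu0 : u ≠ 0 := sub_ne_zero.2 hab.symm
  have hx0 : cross u (x - z) ≠ 0 := fun h => by rw [h, zero_mul] at hpos; exact lt_irrefl _ hpos
  have hy0 : cross u (y - z) ≠ 0 := fun h => by rw [h, mul_zero] at hpos; exact lt_irrefl _ hpos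
  set τ := cross u (y - z) / cross u (x - z) with hτ
  have hτ0 : 0 < τ := by
    rw [hτ, div_eq_mul_inv]
    have : cross u (y - z) * (cross u (x - z))⁻¹
      = (cross u (x - z) * cross u (y - z)) * ((cross u (x - z))⁻¹ ^ 2) := by field_simp
    rw [this]; positivity
  obtain ⟨σ, hσ⟩ := exists_smul_of_cross_eq_zero (u := u) (w := (y - z) - τ • (x - z)) hu0 (by
    rw [cross_sub_right, cross_smul_right, hτ]; field_simp; ring)
  have hyz : y - z = σ • u + τ • (x - z) := by rw [← hσ]; abel
  set m := min θ (1 - θ) with hm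
  have hm0 : 0 < m := lt_min h0 (by linarith)
  -- Small enough for the barycentric coordinates of `w` in `s` to be nonnegative. The tangential
  -- part `σ` may have either sign, whence `|σ|`.
  set ε := min 1 (m / (τ + |σ| + 1)) with hε
  have hden : 0 < τ + |σ| + 1 := by positivity
  have hε0 : 0 < ε := lt_min one_pos (by positivity)
  have hε1 : ε ≤ 1 := min_le_left _ _
  have hεm : ε * (τ + |σ| + 1) ≤ m := by
    have := min_le_right 1 (m / (τ + |σ| + 1))
    rwa [← hε, le_div_iff₀ hden] at this
  have habs := abs_nonneg σ
  have hσ1 := le_abs_self σ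
  have hσ2 := neg_abs_le σ
  have k1 : ε * τ + ε * |σ| ≤ m := by nlinarith
  have k2 : ε * σ ≤ ε * |σ| := by gcongr
  have k3 : -(ε * |σ|) ≤ ε * σ := by nlinarith
  have k4 : m ≤ θ := min_le_left _ _
  have k5 : m ≤ 1 - θ := min_le_right _ _
  have k6 : 0 < ε * τ := by positivity
  have k7 : ε * τ * θ ≤ ε * τ := by nlinarith
  -- A point of both triangles that is off the line through the edge. Conformity forces it onto the
  -- common edge, where `cross u (w - z)` vanishes.
  set w := z + ε • (y - z) with hw
  have hwt : w ∈ convexHull ℝ (t : Set Plane) := by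
    have : w = ((1 - ε) * (1 - θ)) • a + ((1 - ε) * θ) • b + ε • y := by
      rw [hw, hz]; module
    rw [this, hty]
    exact mem_convexHull_triple (mul_nonneg (by linarith) (by linarith))
      (mul_nonneg (by linarith) h0.le) hε0.le (by ring)
  have hws : w ∈ convexHull ℝ (s : Set Plane) := by
    have : w = ((1 - θ) * (1 - ε * τ) - ε * σ) • a + (θ * (1 - ε * τ) + ε * σ) • b
        + (ε * τ) • x := by
      rw [hw, hyz, hu, hz]; module
    rw [this, hsx]
    refine mem_convexHull_triple ?_ ?_ k6.le (by ring)
    · nlinarith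
    · nlinarith
  have hwi := K.inter_subset_convexHull hs ht ⟨hws, hwt⟩
  rw [hst, convexHull_pair] at hwi
  obtain ⟨p, q, -, -, hpq, hwe⟩ := hwi
  have : ε • (y - z) = (q - θ) • u := by
    have hp : p = 1 - q := by linarith
    have : ε • (y - z) = w - z := by rw [hw]; abel
    rw [this, ← hwe, hp, hz, hu]; module
  have h9 := congrArg (cross u) this
  rw [cross_smul_right, cross_smul_right, cross_self, mul_zero] at h9
  exact (mul_ne_zero hε0.ne' hy0) h9

/-- A point that is not a vertex lies in at most two triangles of the complex. -/
theorem not_mem_three_triangles {s t r : Finset Plane} (hs : s ∈ K.faces) (ht : t ∈ K.faces)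
    (hr : r ∈ K.faces) (hs3 : s.card = 3) (ht3 : t.card = 3) (hr3 : r.card = 3) (hst : s ≠ t)
    (hsr : s ≠ r) (htr : t ≠ r) {z : Plane} (hzs : z ∉ s) (hzt : z ∉ t)
    (hs' : z ∈ convexHull ℝ (s : Set Plane)) (ht' : z ∈ convexHull ℝ (t : Set Plane))
    (hr' : z ∈ convexHull ℝ (r : Set Plane)) : False := by
  classical
  obtain ⟨c1, z1⟩ := card_inter_eq_two hs ht hs3 ht3 hst hzs hs' ht'
  obtain ⟨c2, z2⟩ := card_inter_eq_two hs hr hs3 hr3 hsr hzs hs' hr'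
  -- Hulls of faces of one simplex intersect in the hull of their common vertices. Since `z` is not
  -- a vertex, all three triangles share one edge.
  have hz12 : z ∈ convexHull ℝ (((s ∩ t) ∩ (s ∩ r) : Finset Plane) : Set Plane) := by
    rw [Finset.coe_inter, AffineIndependent.convexHull_inter (K.indep hs)
      Finset.inter_subset_left Finset.inter_subset_left]
    exact ⟨z1, z2⟩
  have c12 := two_le_card_of_mem_convexHull
    (fun h => hzs (Finset.mem_inter.1 (Finset.mem_inter.1 h).1).1) hz12
  have e1 : (s ∩ t) ∩ (s ∩ r) = s ∩ t :=
    Finset.eq_of_subset_of_card_le Finset.inter_subset_left (by omega)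
  have e2 : (s ∩ t) ∩ (s ∩ r) = s ∩ r :=
    Finset.eq_of_subset_of_card_le Finset.inter_subset_right (by omega)
  have esr : s ∩ r = s ∩ t := e2.symm.trans e1
  obtain ⟨c3, z3⟩ := card_inter_eq_two ht hr ht3 hr3 htr hzt ht' hr'
  have etr : t ∩ r = s ∩ t := by
    symm
    apply Finset.eq_of_subset_of_card_le
    · intro y hy
      have : y ∈ s ∩ r := by rw [esr]; exact hy
      simp only [Finset.mem_inter] at hy this ⊢
      exact ⟨hy.2, this.2⟩
    · omega
  obtain ⟨a, b, hab, he⟩ := Finset.card_eq_two.1 c1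
  have third : ∀ q : Finset Plane, q.card = 3 → s ∩ t ⊆ q → ∃ x, (q : Set Plane) = {a, b, x} ∧
      x ≠ a ∧ x ≠ b := by
    intro q hq hsub
    rw [he] at hsub
    obtain ⟨x, hx⟩ := Finset.card_eq_one.1 (show (q \ {a, b}).card = 1 by
      rw [Finset.card_sdiff_of_subset hsub, hq, Finset.card_pair hab])
    have hxm : x ∈ q \ {a, b} := by rw [hx]; simp
    simp only [Finset.mem_sdiff, Finset.mem_insert, Finset.mem_singleton, not_or] at hxm
    refine ⟨x, ?_, hxm.2.1, hxm.2.2⟩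
    have : q = {a, b} ∪ (q \ {a, b}) := (Finset.union_sdiff_of_subset hsub).symm
    rw [this, hx]
    ext y; simp
  obtain ⟨x, hxs, hxa, hxb⟩ := third s hs3 Finset.inter_subset_left
  obtain ⟨y, hyt, hya, hyb⟩ := third t ht3 Finset.inter_subset_right
  obtain ⟨w, hwr, hwa, hwb⟩ := third r hr3 (by rw [← esr]; exact Finset.inter_subset_right)
  rw [he] at z1
  simp only [Finset.coe_insert, Finset.coe_singleton, convexHull_pair] at z1
  obtain ⟨p, θ, hp, hθ, hpθ, hz⟩ := z1
  have ha : a ∈ s := by rw [← Finset.mem_coe, hxs]; simp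
  have hb : b ∈ s := by rw [← Finset.mem_coe, hxs]; simp
  have hθ0 : 0 < θ := by
    rcases hθ.lt_or_eq with h | h
    · exact h
    · exfalso; apply hzs; rw [← hz, ← h]; have : p = 1 := by linarith
      simpa [this] using ha
  have hθ1 : θ < 1 := by
    rcases hp.lt_or_eq with h | h
    · linarith
    · exfalso; apply hzs; rw [← hz, ← h]; have : θ = 1 := by linarith
      simpa [this] using hb
  have hz' : z = (1 - θ) • a + θ • b := by rw [← hz, show p = 1 - θ by linarith]
  have hpair : ∀ q q' : Finset Plane, q ∩ q' = s ∩ t → (q : Set Plane) ∩ q' = {a, b} := by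
    intro q q' h
    rw [← Finset.coe_inter, h, he]; simp
  have n1 := cross_mul_cross_neg hs ht hxs hyt (hpair _ _ rfl) hab hθ0 hθ1 hz'
  have n2 := cross_mul_cross_neg hs hr hxs hwr (hpair _ _ esr) hab hθ0 hθ1 hz'
  have n3 := cross_mul_cross_neg ht hr hyt hwr (hpair _ _ etr) hab hθ0 hθ1 hz'
  have nz : ∀ (q : Finset Plane) (v : Plane), q ∈ K.faces → (q : Set Plane) = {a, b, v} → v ≠ a →
      v ≠ b → cross (b - a) (v - z) ≠ 0 := by
    intro q v hq hqv hva hvb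
    have h1 : a ∈ q := by rw [← Finset.mem_coe, hqv]; simp
    have h2 : b ∈ q := by rw [← Finset.mem_coe, hqv]; simp
    have h3 : v ∈ q := by rw [← Finset.mem_coe, hqv]; simp
    have := cross_ne_zero_of_affineIndependent (K.indep hq) h1 h2 h3 hab hva.symm hvb.symm
    have e : v - z = (v - a) - θ • (b - a) := by rw [hz']; module
    rwa [e, cross_sub_right, cross_smul_right, cross_self, mul_zero, sub_zero]
  have m1 := nz s x hs hxs hxa hxb
  have m2 := nz t y ht hyt hya hyb
  have m3 := nz r w hr hwr hwa hwb
  -- Three third vertices lie on two sides of the line through the edge, so two of them are on the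
  -- same side.
  rcases lt_or_gt_of_ne m1 with h1 | h1 <;> rcases lt_or_gt_of_ne m2 with h2 | h2 <;>
    rcases lt_or_gt_of_ne m3 with h3 | h3 <;>
    first
      | exact n1 (mul_pos h1 h2)
      | exact n1 (mul_pos_of_neg_of_neg h1 h2)
      | exact n2 (mul_pos h1 h3)
      | exact n2 (mul_pos_of_neg_of_neg h1 h3)
      | exact n3 (mul_pos h2 h3)
      | exact n3 (mul_pos_of_neg_of_neg h2 h3)

end Complex

end Folding

/-! ### The two sides of the sheet off the fattened crease -/

namespace Folding

/-- One-sided estimates are proved for `ω₁` only and transferred to `ω₂` by this symmetry. -/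
theorem IsCreased.symm {ω ω₁ ω₂ : Set Plane} {b : ℝ → Plane} {α β : ℝ}
    (h : IsCreased ω ω₁ ω₂ b α β) : IsCreased ω ω₂ ω₁ b α β where
  lt := h.lt
  lipschitz := h.lipschitz
  lipschitz₁ := h.lipschitz₂
  lipschitz₂ := h.lipschitz₁
  curve := h.curve
  injOn := h.injOn
  inside := h.inside
  disjoint := h.disjoint.symm
  partition := by rw [h.partition, union_comm]

theorem CreaseMesh.IsAdmissible.symm {M : CreaseMesh} {ω ω₁ ω₂ : Set Plane} {b : ℝ → Plane}
    {α β : ℝ} (h : M.IsAdmissible ω ω₁ ω₂ b α β) : M.IsAdmissible ω ω₂ ω₁ b α β where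
  node_strictMono := h.node_strictMono
  node_zero := h.node_zero
  node_last := h.node_last
  finite := h.finite
  space_eq := h.space_eq
  segment_mem := h.segment_mem
  fat_triangle := h.fat_triangle
  crease_subset := h.crease_subset
  connected₁ := h.connected₂
  connected₂ := h.connected₁
  vertex_mem := fun i h0 h1 => (h.vertex_mem i h0 h1).symm

namespace CreaseMesh.IsAdmissible

variable {M : CreaseMesh} {ω ω₁ ω₂ : Set Plane} {b : ℝ → Plane} {α β : ℝ}

theorem fat_finite (h : M.IsAdmissible ω ω₁ ω₂ b α β) : M.fat.Finite :=
  h.finite.subset fun t ht => (h.fat_triangle t ht).1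

theorem isCompact_fatCrease (h : M.IsAdmissible ω ω₁ ω₂ b α β) : IsCompact M.fatCrease :=
  h.fat_finite.isCompact_biUnion fun t _ => isCompact_convexHull_finset t

theorem isClosed_fatCrease (h : M.IsAdmissible ω ω₁ ω₂ b α β) : IsClosed M.fatCrease :=
  h.isCompact_fatCrease.isClosed

theorem isOpen_diff (h : M.IsAdmissible ω ω₁ ω₂ b α β) {U : Set Plane} (hU : IsOpen U) :
    IsOpen (U \ M.fatCrease) :=
  hU.sdiff h.isClosed_fatCrease

theorem diff_eq_union (hω : IsCreased ω ω₁ ω₂ b α β) (h : M.IsAdmissible ω ω₁ ω₂ b α β) :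
    ω \ M.fatCrease = (ω₁ \ M.fatCrease) ∪ (ω₂ \ M.fatCrease) := by
  rw [← union_sdiff_distrib, ← hω.partition, sdiff_sdiff, union_eq_self_of_subset_left h.crease_subset]

theorem node_mem_Icc (h : M.IsAdmissible ω ω₁ ω₂ b α β) (i : Fin (M.n + 1)) :
    M.node i ∈ Icc α β := by
  rw [← h.node_zero, ← h.node_last]
  exact ⟨h.node_strictMono.monotone (Fin.zero_le i), h.node_strictMono.monotone (Fin.le_last i)⟩

/-- The crease is connected and contained in the union, and each triangle has a vertex on it. -/
theorem isPreconnected_fatCrease (hω : IsCreased ω ω₁ ω₂ b α β)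
    (h : M.IsAdmissible ω ω₁ ω₂ b α β) : IsPreconnected M.fatCrease := by
  have hγ : IsPreconnected (b '' Icc α β) := isPreconnected_Icc.image b hω.curve.1
  have hα : b α ∈ b '' Icc α β := ⟨α, left_mem_Icc.2 hω.lt.le, rfl⟩
  refine isPreconnected_of_forall (b α) fun y hy => ?_
  obtain ⟨t, ht, hyt⟩ := mem_iUnion₂.1 hy
  obtain ⟨-, -, i, hi, -⟩ := h.fat_triangle t ht
  have hbi : b (M.node i.castSucc) ∈ convexHull ℝ (t : Set Plane) := subset_convexHull ℝ _ hi
  refine ⟨b '' Icc α β ∪ convexHull ℝ (t : Set Plane), union_subset h.crease_subset ?_,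
    Or.inl hα, Or.inr hyt, ?_⟩
  · exact subset_biUnion_of_mem (u := fun t : Finset Plane => convexHull ℝ (t : Set Plane)) ht
  · exact hγ.union (b (M.node i.castSucc)) ⟨_, h.node_mem_Icc _, rfl⟩ hbi
      (convex_convexHull ℝ _).isPreconnected

/-- An open triangle that meets one side of the sheet off the fattened crease is contained
in this side. -/
theorem interior_subset_of_inter_nonempty (hω : IsCreased ω ω₁ ω₂ b α β)
    (h : M.IsAdmissible ω ω₁ ω₂ b α β) {t : Finset Plane} (ht : t ∈ M.mesh.faces)
    (ht3 : t.card = 3)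
    (hne : (interior (convexHull ℝ (t : Set Plane)) ∩ (ω₁ \ M.fatCrease)).Nonempty) :
    interior (convexHull ℝ (t : Set Plane)) ⊆ ω₁ \ M.fatCrease := by
  classical
  obtain ⟨x, hxt, hx⟩ := hne
  have htfat : t ∉ M.fat := fun htf => hx.2 (mem_iUnion₂.2 ⟨t, htf, interior_subset hxt⟩)
  have hsub : interior (convexHull ℝ (t : Set Plane)) ⊆ ω \ M.fatCrease := by
    intro y hy
    constructor
    · rw [← hω.lipschitz.interior_closure]
      refine interior_mono ?_ hy
      rw [← h.space_eq]
      exact M.mesh.convexHull_subset_space ht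
    · intro hyf
      obtain ⟨s, hs, hys⟩ := mem_iUnion₂.1 hyf
      obtain ⟨hsf, hs3, -⟩ := h.fat_triangle s hs
      have hst : s ≠ t := fun e => htfat (e ▸ hs)
      rw [← closure_interior_convexHull (M.mesh.indep hsf) hs3] at hys
      obtain ⟨w, hwt, hws⟩ := mem_closure_iff.1 hys _ isOpen_interior hy
      -- Different triangles meet in the hull of at most two vertices, which is a null set, so their
      -- interiors cannot overlap.
      have hpos : 0 < volume (interior (convexHull ℝ (t : Set Plane)) ∩
          interior (convexHull ℝ (s : Set Plane))) :=
        (isOpen_interior.inter isOpen_interior).measure_pos volume ⟨w, hwt, hws⟩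
      refine hpos.ne' (measure_mono_null ?_ (volume_convexHull_eq_zero_of_card_le_two
        (s := t ∩ s) ?_))
      · rw [Finset.coe_inter]
        exact (inter_subset_inter interior_subset interior_subset).trans
          (M.mesh.inter_subset_convexHull ht hsf)
      · by_contra hlt
        push Not at hlt
        have h1 : t ∩ s = t := Finset.eq_of_subset_of_card_le Finset.inter_subset_left (by omega)
        have h2 : t ∩ s = s := Finset.eq_of_subset_of_card_le Finset.inter_subset_right (by omega)
        exact hst (h2.symm.trans h1)
  rw [h.diff_eq_union hω] at hsub
  exact (convex_convexHull ℝ _).interior.isPreconnected.subset_left_of_subset_union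
    (h.isOpen_diff hω.lipschitz₁.isOpen) (h.isOpen_diff hω.lipschitz₂.isOpen)
    (hω.disjoint.mono sdiff_subset sdiff_subset) hsub ⟨x, hxt, hx⟩

/-- The triangles that make up one side of the sheet off the fattened crease. -/
theorem subset_iUnion_triangles (hω : IsCreased ω ω₁ ω₂ b α β)
    (h : M.IsAdmissible ω ω₁ ω₂ b α β) {x : Plane} (hx : x ∈ ω₁ \ M.fatCrease) :
    ∃ t ∈ M.mesh.faces, t.card = 3 ∧
      (interior (convexHull ℝ (t : Set Plane)) ∩ (ω₁ \ M.fatCrease)).Nonempty ∧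
      x ∈ convexHull ℝ (t : Set Plane) := by
  by_contra hcon
  push Not at hcon
  set 𝒯 : Set (Finset Plane) := {t | t ∈ M.mesh.faces ∧ t.card = 3 ∧
    (interior (convexHull ℝ (t : Set Plane)) ∩ (ω₁ \ M.fatCrease)).Nonempty} with h𝒯
  have hfin : 𝒯.Finite := h.finite.subset fun t ht => ht.1
  have hcl : IsClosed (⋃ t ∈ 𝒯, convexHull ℝ (t : Set Plane)) :=
    hfin.isClosed_biUnion fun t _ => (isCompact_convexHull_finset t).isClosed
  -- The uncovered part is open and lies in the hulls of faces with at most two vertices, which are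
  -- null sets.
  set O := (ω₁ \ M.fatCrease) \ ⋃ t ∈ 𝒯, convexHull ℝ (t : Set Plane) with hO
  have hOo : IsOpen O := (h.isOpen_diff hω.lipschitz₁.isOpen).sdiff hcl
  have hxO : x ∈ O := by
    refine ⟨hx, fun hxu => ?_⟩
    obtain ⟨t, ht, hxt⟩ := mem_iUnion₂.1 hxu
    exact hcon t ht.1 ht.2.1 ht.2.2 hxt
  have hpos := hOo.measure_pos volume ⟨x, hxO⟩
  have hω1 : ω₁ ⊆ ω := fun y hy => by
    have : y ∈ ω \ b '' Icc α β := by rw [hω.partition]; exact Or.inl hy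
    exact this.1
  refine hpos.ne' (measure_mono_null (t := ⋃ t ∈ {t | t ∈ M.mesh.faces ∧ t.card ≤ 2},
    convexHull ℝ (t : Set Plane)) ?_ ?_)
  · intro y hy
    have hyc : y ∈ M.mesh.space := by rw [h.space_eq]; exact subset_closure (hω1 hy.1.1)
    obtain ⟨t, ht, hyt⟩ := M.mesh.mem_space_iff.1 hyc
    refine mem_iUnion₂.2 ⟨t, ⟨ht, ?_⟩, hyt⟩
    by_contra hlt
    have ht3 : t.card = 3 := le_antisymm (card_le_three (M.mesh.indep ht)) (by omega)
    rw [← closure_interior_convexHull (M.mesh.indep ht) ht3] at hyt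
    obtain ⟨w, hwO, hwt⟩ := mem_closure_iff.1 hyt _ hOo hy
    exact hwO.2 (mem_iUnion₂.2 ⟨t, ⟨ht, ht3, ⟨w, hwt, hwO.1⟩⟩, interior_subset hwt⟩)
  · rw [measure_biUnion_null_iff (h.finite.subset fun t ht => ht.1).countable]
    exact fun t ht => volume_convexHull_eq_zero_of_card_le_two ht.2

/-- A function that is `1`-Lipschitz along segments is `1`-Lipschitz on each triangle. -/
theorem lipschitzOnWith_triangle (hω : IsCreased ω ω₁ ω₂ b α β)
    (h : M.IsAdmissible ω ω₁ ω₂ b α β) {f : Plane → ℝ} (hf : SegLip (ω₁ \ M.fatCrease) f)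
    {t : Finset Plane} (ht : t ∈ M.mesh.faces) (ht3 : t.card = 3)
    (hne : (interior (convexHull ℝ (t : Set Plane)) ∩ (ω₁ \ M.fatCrease)).Nonempty) :
    LipschitzOnWith 1 f (convexHull ℝ (t : Set Plane) ∩ (ω₁ \ M.fatCrease)) := by
  have hsub := h.interior_subset_of_inter_nonempty hω ht ht3 hne
  obtain ⟨a, ha, -⟩ := hne
  have hDo := h.isOpen_diff (U := ω₁) hω.lipschitz₁.isOpen
  have hcont := hf.continuousOn hDo
  refine LipschitzOnWith.of_dist_le_mul fun x hx y hy => ?_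
  rw [NNReal.coe_one, one_mul]
  have hconv := convex_convexHull ℝ (t : Set Plane)
  -- Both points are pushed towards the interior point `a`. The segment between the shifted points
  -- lies in the open triangle, and continuity of `f` gives the limit `τ → 0`.
  have key : ∀ z ∈ convexHull ℝ (t : Set Plane) ∩ (ω₁ \ M.fatCrease),
      Tendsto (fun τ : ℝ => (1 - τ) • z + τ • a) (𝓝[>] 0) (𝓝 z) ∧
      ∀ᶠ τ : ℝ in 𝓝[>] 0, (1 - τ) • z + τ • a ∈ interior (convexHull ℝ (t : Set Plane)) := by
    intro z hz
    constructor
    · have : Tendsto (fun τ : ℝ => (1 - τ) • z + τ • a) (𝓝 0) (𝓝 ((1 - (0 : ℝ)) • z + (0 : ℝ) • a)) :=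
        Continuous.tendsto (by fun_prop) 0
      simp only [sub_zero, one_smul, zero_smul, add_zero] at this
      exact this.mono_left nhdsWithin_le_nhds
    · filter_upwards [Ioc_mem_nhdsGT (zero_lt_one' ℝ)] with τ hτ
      exact hconv.combo_self_interior_mem_interior hz.1 ha (by linarith [hτ.2]) hτ.1 (by ring)
  obtain ⟨tx, ex⟩ := key x hx
  obtain ⟨ty, ey⟩ := key y hy
  have fx := (hcont.continuousAt (hDo.mem_nhds hx.2)).tendsto.comp tx
  have fy := (hcont.continuousAt (hDo.mem_nhds hy.2)).tendsto.comp ty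
  refine le_of_tendsto_of_tendsto (fx.dist fy) (tx.dist ty) ?_
  filter_upwards [ex, ey] with τ h1 h2
  simp only [Function.comp, dist_eq_norm]
  exact (hf.mono hsub).norm_sub_le_of_convex hconv.interior h1 h2

end CreaseMesh.IsAdmissible

/-! ### Limit values and the length of the boundary -/

/-- `s` is a limit value of `f` at `p` from within `D`. -/
def IsLimitValue (D : Set Plane) (f : Plane → ℝ) (p : Plane) (s : ℝ) : Prop :=
  ∀ ε > 0, p ∈ closure {x | x ∈ D ∧ |f x - s| < ε}

theorem isLimitValue_of_tendsto {D : Set Plane} {f : Plane → ℝ} {p : Plane} {s : ℝ}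
    (hp : p ∈ closure D) (hf : Tendsto f (𝓝[D] p) (𝓝 s)) : IsLimitValue D f p s := by
  intro ε hε
  have h1 : ∀ᶠ x in 𝓝[D] p, x ∈ D ∧ |f x - s| < ε := by
    filter_upwards [self_mem_nhdsWithin, hf (Metric.ball_mem_nhds s hε)] with x hx hx'
    exact ⟨hx, by simpa [Real.dist_eq] using hx'⟩
  rw [mem_closure_iff_clusterPt]
  have : (𝓝[D] p).NeBot := mem_closure_iff_nhdsWithin_neBot.1 hp
  exact this.mono (le_inf nhdsWithin_le_nhds (le_principal_iff.2 h1))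

-- The sum is the integral over `Z` of the number of triangles through a point. This number is at
-- most two except at finitely many vertices, which have no one-dimensional measure.
open Classical in
theorem sum_hausdorffMeasure_inter_le (K : Geometry.SimplicialComplex ℝ Plane)
    (T : Finset (Finset Plane)) (hT : ∀ t ∈ T, t ∈ K.faces ∧ t.card = 3) {Z : Set Plane} :
    ∑ t ∈ T, Measure.hausdorffMeasure 1 (convexHull ℝ (t : Set Plane) ∩ Z)
      ≤ 2 * Measure.hausdorffMeasure 1 Z := by
  set ν : Measure Plane := (Measure.hausdorffMeasure 1).restrict Z with hν
  have hmeas : ∀ t : Finset Plane, MeasurableSet (convexHull ℝ (t : Set Plane)) :=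
    fun t => (isCompact_convexHull_finset t).isClosed.measurableSet
  have h1 : ∀ t ∈ T, Measure.hausdorffMeasure 1 (convexHull ℝ (t : Set Plane) ∩ Z)
      = ∫⁻ x, (convexHull ℝ (t : Set Plane)).indicator 1 x ∂ν := by
    intro t _
    rw [lintegral_indicator_one (hmeas t), hν, Measure.restrict_apply (hmeas t)]
  rw [Finset.sum_congr rfl h1, ← lintegral_finsetSum]
  · have : 2 * Measure.hausdorffMeasure 1 Z = ∫⁻ _, 2 ∂ν := by simp [hν]
    rw [this]
    refine lintegral_mono_ae ?_
    set V : Set Plane := ⋃ t ∈ T, (t : Set Plane) with hV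
    have hVf : V.Finite := T.finite_toSet.biUnion fun t _ => t.finite_toSet
    have hV0 : ν V = 0 := by
      have : NullSingletonClass (Measure.hausdorffMeasure 1 : Measure Plane) :=
        Measure.nullSingletonClass_hausdorff Plane one_pos
      refine le_antisymm ((Measure.restrict_apply_le _ _).trans ?_) bot_le
      exact (@Set.Finite.measure_zero _ _ V hVf _ this).le
    filter_upwards [measure_eq_zero_iff_ae_notMem.1 hV0] with z hz
    have hz' : ∀ t ∈ T, z ∉ t := fun t ht hzt => hz (mem_iUnion₂.2 ⟨t, ht, hzt⟩)
    have h2 : ∑ t ∈ T, (convexHull ℝ (t : Set Plane)).indicator (1 : Plane → ℝ≥0∞) z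
        = ((T.filter fun t : Finset Plane => z ∈ convexHull ℝ (t : Set Plane)).card : ℝ≥0∞) := by
      rw [Finset.card_filter]
      push_cast
      refine Finset.sum_congr rfl fun t _ => ?_
      simp [indicator_apply]
    rw [h2]
    have h3 : (T.filter fun t : Finset Plane => z ∈ convexHull ℝ (t : Set Plane)).card ≤ 2 := by
      by_contra hlt
      push Not at hlt
      obtain ⟨r, hr, s, hs, t, ht, hrs, hrt, hst⟩ := Finset.two_lt_card.1 hlt
      simp only [Finset.mem_filter] at hr hs ht
      exact not_mem_three_triangles (hT r hr.1).1 (hT s hs.1).1 (hT t ht.1).1 (hT r hr.1).2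
        (hT s hs.1).2 (hT t ht.1).2 hrs hrt hst (hz' r hr.1) (hz' s hs.1) hr.2 hs.2 ht.2
    exact_mod_cast h3
  · exact fun t _ => measurable_one.indicator (hmeas t)

/-- The limit values, at the points of a connected set `K`, of a function on one side of the sheet
differ at most by twice the length of the boundary of the domain from which the limit is taken. -/
theorem CreaseMesh.IsAdmissible.abs_limitValue_sub_le {M : CreaseMesh} {ω ω₁ ω₂ : Set Plane}
    {b : ℝ → Plane} {α β : ℝ} (hω : IsCreased ω ω₁ ω₂ b α β) (h : M.IsAdmissible ω ω₁ ω₂ b α β)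
    {f : Plane → ℝ} (hf : SegLip (ω₁ \ M.fatCrease) f) {D K : Set Plane} (hD : IsOpen D)
    (hDc : IsPreconnected D) (hDsub : D ⊆ ω₁ \ M.fatCrease) (hK : IsPreconnected K)
    (hKD : Disjoint K D) {p q : Plane} (hp : p ∈ K) (hq : q ∈ K) {s s' : ℝ}
    (hs : IsLimitValue D f p s) (hs' : IsLimitValue D f q s') :
    ENNReal.ofReal |s - s'| ≤ 2 * Measure.hausdorffMeasure 1 (frontier D) := by
  classical
  wlog hlt : s < s' generalizing s s' p q
  · rcases (not_lt.1 hlt).lt_or_eq with h1 | h1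
    · rw [abs_sub_comm]; exact this hq hp hs' hs h1
    · simp [h1]
  set T : Finset (Finset Plane) := h.finite.toFinset.filter fun t => t.card = 3 ∧
    (interior (convexHull ℝ (t : Set Plane)) ∩ (ω₁ \ M.fatCrease)).Nonempty with hTdef
  have hT : ∀ t ∈ T, t ∈ M.mesh.faces ∧ t.card = 3 ∧
    (interior (convexHull ℝ (t : Set Plane)) ∩ (ω₁ \ M.fatCrease)).Nonempty := by
    intro t ht
    simpa [hTdef] using ht
  have hext : ∀ t ∈ T, ∃ g : Plane → ℝ, LipschitzWith 1 g ∧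
      EqOn f g (convexHull ℝ (t : Set Plane) ∩ (ω₁ \ M.fatCrease)) := fun t ht =>
    (h.lipschitzOnWith_triangle hω hf (hT t ht).1 (hT t ht).2.1 (hT t ht).2.2).extend_real
  choose! g hgL hgE using hext
  -- The boundary values are collected triangle by triangle, from the Lipschitz extensions, because
  -- `f` itself need not extend continuously to the boundary of `D`.
  set S : Set ℝ := ⋃ t ∈ T, g t '' (convexHull ℝ (t : Set Plane) ∩ frontier D) with hS
  have hSc : IsCompact S := T.finite_toSet.isCompact_biUnion fun t ht =>
    ((isCompact_convexHull_finset t).inter_right isClosed_frontier).image (hgL t ht).continuous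
  have hSv : volume S ≤ 2 * Measure.hausdorffMeasure 1 (frontier D) := by
    refine (measure_biUnion_finset_le _ _).trans (le_trans (Finset.sum_le_sum fun t ht => ?_)
      (sum_hausdorffMeasure_inter_le M.mesh T fun t ht => ⟨(hT t ht).1, (hT t ht).2.1⟩))
    have := (hgL t ht).hausdorffMeasure_image_le zero_le_one
      (convexHull ℝ (t : Set Plane) ∩ frontier D)
    rw [hausdorffMeasure_real] at this
    simpa using this
  by_contra hcon
  push Not at hcon
  have hvol : volume S < volume (Ioo s s') := by
    refine hSv.trans_lt (hcon.trans_le ?_)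
    rw [Real.volume_Ioo, abs_sub_comm, abs_of_pos (sub_pos.2 hlt)]
  -- A value between the limit values that is avoided on the boundary. By compactness of `S` a whole
  -- interval around it is avoided, so the points of `D` with values in this interval stay away from
  -- the boundary and form a closed set.
  obtain ⟨σ, hσ, hσS⟩ : ∃ σ ∈ Ioo s s', σ ∉ S := by
    by_contra hall
    push Not at hall
    exact absurd (measure_mono (μ := volume) hall) (not_le.2 hvol)
  obtain ⟨ε, hε, hball⟩ := Metric.isOpen_iff.1 (isOpen_Ioo.inter hSc.isClosed.isOpen_compl) σ
    ⟨hσ, hσS⟩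
  set a := σ - ε / 2 with ha
  set c := σ + ε / 2 with hc
  have hac : Icc a c ⊆ Ioo s s' ∩ Sᶜ := by
    intro y hy
    apply hball
    rw [Metric.mem_ball, Real.dist_eq, abs_lt]
    constructor <;> linarith [hy.1, hy.2]
  have hsa : s < a := (hac (left_mem_Icc.2 (by linarith))).1.1
  have hcs : c < s' := (hac (right_mem_Icc.2 (by linarith))).1.2
  have hcl : IsClosed {x | x ∈ D ∧ f x ∈ Icc a c} := by
    have heq : {x | x ∈ D ∧ f x ∈ Icc a c} =
        closure D ∩ ⋃ t ∈ T, (convexHull ℝ (t : Set Plane) ∩ g t ⁻¹' Icc a c) := by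
      ext x
      constructor
      · rintro ⟨hxD, hxf⟩
        obtain ⟨t, ht, ht3, hne, hxt⟩ := h.subset_iUnion_triangles hω (hDsub hxD)
        have htT : t ∈ T := by simp [hTdef, ht, ht3, hne]
        refine ⟨subset_closure hxD, mem_iUnion₂.2 ⟨t, htT, hxt, ?_⟩⟩
        rw [mem_preimage, ← hgE t htT ⟨hxt, hDsub hxD⟩]
        exact hxf
      · rintro ⟨hxD, hxu⟩
        obtain ⟨t, htT, hxt, hxg⟩ := mem_iUnion₂.1 hxu
        have hxD' : x ∈ D := by
          by_contra hxn
          have : x ∈ frontier D := by rw [hD.frontier_eq]; exact ⟨hxD, hxn⟩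
          exact (hac hxg).2 (mem_iUnion₂.2 ⟨t, htT, x, ⟨hxt, this⟩, rfl⟩)
        refine ⟨hxD', ?_⟩
        rw [hgE t htT ⟨hxt, hDsub hxD'⟩]
        exact hxg
    rw [heq]
    refine isClosed_closure.inter (T.finite_toSet.isClosed_biUnion fun t ht => ?_)
    exact (isCompact_convexHull_finset t).isClosed.inter
      (isClosed_Icc.preimage (hgL t ht).continuous)
  refine not_separated_near_preconnected hD hDc hK hKD
    ((hf.continuousOn (h.isOpen_diff hω.lipschitz₁.isOpen)).mono hDsub) (by linarith : a < c) hcl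
    hp hq ?_ ?_
  · refine closure_mono ?_ (hs (a - s) (by linarith))
    rintro x ⟨hx, hxa⟩
    exact ⟨hx, by linarith [(abs_lt.1 hxa).2]⟩
  · refine closure_mono ?_ (hs' (s' - c) (by linarith))
    rintro x ⟨hx, hxa⟩
    exact ⟨hx, by linarith [(abs_lt.1 hxa).1]⟩

end Folding

namespace Folding

/-! ### Unit speed curves -/

section Curve

variable {b : ℝ → Plane} {α β : ℝ}

/-- Right derivatives exist also at break points, where the piece that starts there is used. They
suffice for the mean value inequality. -/
theorem IsPiecewiseC1UnitSpeed.exists_hasDerivWithinAt (h : IsPiecewiseC1UnitSpeed b α β) {s : ℝ}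
    (hs : s ∈ Ico α β) : ∃ d : Plane, HasDerivWithinAt b d (Ici s) s ∧ ‖d‖ ≤ 1 := by
  classical
  obtain ⟨-, n, t, ht, h0, hn, hj⟩ := h
  set A : Finset (Fin (n + 1)) := Finset.univ.filter fun j => t j ≤ s with hA
  have hAne : A.Nonempty := ⟨0, by simp [hA, h0, hs.1]⟩
  obtain ⟨j, hjA, hmax⟩ := A.exists_max_image id hAne
  have hjs : t j ≤ s := by simpa [hA] using hjA
  have hjl : j ≠ Fin.last n := by
    rintro rfl
    rw [hn] at hjs
    exact absurd hs.2 (not_lt.2 hjs)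
  obtain ⟨k, rfl⟩ := Fin.exists_castSucc_eq.2 hjl
  have hks : s < t k.succ := by
    by_contra hle
    have : k.succ ∈ A := by simpa [hA] using hle
    have := hmax _ this
    simp only [id] at this
    exact absurd this (not_le.2 Fin.castSucc_lt_succ)
  obtain ⟨hC, hu⟩ := hj k
  have hmem : s ∈ Icc (t k.castSucc) (t k.succ) := ⟨hjs, hks.le⟩
  refine ⟨_, ((hC.differentiableOn one_ne_zero s hmem).hasDerivWithinAt).mono_of_mem_nhdsWithin ?_,
    (hu s hmem).le⟩
  exact mem_of_superset (Icc_mem_nhdsGE hks) (Icc_subset_Icc_left hjs)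

theorem IsPiecewiseC1UnitSpeed.norm_sub_le (h : IsPiecewiseC1UnitSpeed b α β) {s t : ℝ}
    (hs : α ≤ s) (hst : s ≤ t) (ht : t ≤ β) : ‖b t - b s‖ ≤ t - s := by
  have key := fun (x : ℝ) (hx : x ∈ Ico s t) => h.exists_hasDerivWithinAt (s := x)
    ⟨hs.trans hx.1, hx.2.trans_le ht⟩
  choose! d hd hd1 using key
  have := norm_image_sub_le_of_norm_deriv_right_le_segment (f := b) (f' := d) (C := 1) (a := s)
    (b := t) (h.1.mono (Icc_subset_Icc hs ht)) hd hd1 t (right_mem_Icc.2 hst)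
  simpa using this

theorem IsPiecewiseC1UnitSpeed.lipschitzOnWith (h : IsPiecewiseC1UnitSpeed b α β) :
    LipschitzOnWith 1 b (Icc α β) := by
  refine LipschitzOnWith.of_dist_le_mul fun x hx y hy => ?_
  rw [NNReal.coe_one, one_mul]
  rcases le_total x y with hxy | hxy
  · rw [dist_comm, dist_eq_norm, Real.dist_eq, abs_sub_comm, abs_of_nonneg (by linarith)]
    exact h.norm_sub_le hx.1 hxy hy.2
  · rw [dist_eq_norm, Real.dist_eq, abs_of_nonneg (by linarith)]
    exact h.norm_sub_le hy.1 hxy hx.2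

theorem IsPiecewiseC1UnitSpeed.exists_finite_hasDerivAt (h : IsPiecewiseC1UnitSpeed b α β) :
    ∃ B : Set ℝ, B.Finite ∧ ∀ s ∈ Ioo α β, s ∉ B → ∃ d : Plane, HasDerivAt b d s ∧ ‖d‖ = 1 := by
  classical
  obtain ⟨-, n, t, ht, h0, hn, hj⟩ := h
  refine ⟨range t, finite_range t, fun s hs hsB => ?_⟩
  set A : Finset (Fin (n + 1)) := Finset.univ.filter fun j => t j ≤ s with hA
  have hAne : A.Nonempty := ⟨0, by simp [hA, h0, hs.1.le]⟩
  obtain ⟨j, hjA, hmax⟩ := A.exists_max_image id hAne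
  have hjs : t j ≤ s := by simpa [hA] using hjA
  have hjl : j ≠ Fin.last n := by
    rintro rfl
    rw [hn] at hjs
    exact absurd hs.2 (not_lt.2 hjs)
  obtain ⟨k, rfl⟩ := Fin.exists_castSucc_eq.2 hjl
  have hks : s < t k.succ := by
    by_contra hle
    have : k.succ ∈ A := by simpa [hA] using hle
    have := hmax _ this
    simp only [id] at this
    exact absurd this (not_le.2 Fin.castSucc_lt_succ)
  have hjs' : t k.castSucc < s := lt_of_le_of_ne hjs fun e => hsB ⟨_, e⟩
  obtain ⟨hC, hu⟩ := hj k
  have hmem : s ∈ Icc (t k.castSucc) (t k.succ) := ⟨hjs, hks.le⟩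
  exact ⟨_, ((hC.differentiableOn one_ne_zero s hmem).hasDerivWithinAt).hasDerivAt
    (Icc_mem_nhds hjs' hks), hu s hmem⟩

/-- A Lipschitz image of an interval has finite one-dimensional, hence vanishing two-dimensional
Hausdorff measure, and the latter is a Haar measure of the plane. -/
theorem IsCreased.volume_crease {ω ω₁ ω₂ : Set Plane} (h : IsCreased ω ω₁ ω₂ b α β) :
    volume (b '' Icc α β) = 0 := by
  have h1 : Measure.hausdorffMeasure 1 (b '' Icc α β) < ∞ := by
    refine (h.curve.lipschitzOnWith.hausdorffMeasure_image_le zero_le_one).trans_lt ?_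
    rw [hausdorffMeasure_real]; simp
  have h2 : Measure.hausdorffMeasure 2 (b '' Icc α β) = 0 := by
    rcases Measure.hausdorffMeasure_zero_or_top (one_lt_two) (b '' Icc α β) with h | h
    · exact h
    · exact absurd h h1.ne
  have : Measure.IsAddHaarMeasure (Measure.hausdorffMeasure 2 : Measure Plane) := by
    have := isAddHaarMeasure_hausdorffMeasure (E := Plane)
    simpa using this
  exact Measure.absolutelyContinuous_isAddHaarMeasure volume (Measure.hausdorffMeasure 2) h2

theorem IsCreased.isCompact_crease {ω ω₁ ω₂ : Set Plane} (h : IsCreased ω ω₁ ω₂ b α β) :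
    IsCompact (b '' Icc α β) := isCompact_Icc.image_of_continuousOn h.curve.1

theorem IsCreased.subset₁ {ω ω₁ ω₂ : Set Plane} (h : IsCreased ω ω₁ ω₂ b α β) : ω₁ ⊆ ω :=
  fun y hy => (show y ∈ ω \ b '' Icc α β by rw [h.partition]; exact Or.inl hy).1

theorem IsCreased.disjoint_crease₁ {ω ω₁ ω₂ : Set Plane} (h : IsCreased ω ω₁ ω₂ b α β) {y : Plane}
    (hy : y ∈ ω₁) : y ∉ b '' Icc α β :=
  (show y ∈ ω \ b '' Icc α β by rw [h.partition]; exact Or.inl hy).2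

end Curve

/-! ### First exit points of segments -/

/-- Follow a segment until it leaves an open set. A function that is `1`-Lipschitz along segments
has a limit along the way. -/
theorem SegLip.exists_first_exit {D : Set Plane} (hD : IsOpen D) {f : Plane → ℝ}
    (hf : SegLip D f) {x y : Plane} (hx : x ∈ D) (hy : y ∉ D) :
    ∃ τ : ℝ, 0 < τ ∧ τ ≤ 1 ∧ AffineMap.lineMap x y τ ∉ D ∧
      (∀ θ ∈ Ico 0 τ, AffineMap.lineMap x y θ ∈ D) ∧
      ∃ s : ℝ, |f x - s| ≤ ‖x - y‖ ∧
        ∀ D' : Set Plane, (∀ θ ∈ Ico 0 τ, AffineMap.lineMap x y θ ∈ D') →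
          IsLimitValue D' f (AffineMap.lineMap x y τ) s := by
  set l : ℝ → Plane := fun θ => AffineMap.lineMap x y θ with hl
  have hlc : Continuous l := AffineMap.lineMap_continuous
  set A : Set ℝ := Icc 0 1 ∩ l ⁻¹' Dᶜ with hA
  have hAc : IsCompact A := isCompact_Icc.inter_right (hD.isClosed_compl.preimage hlc)
  have hAne : A.Nonempty := ⟨1, ⟨by simp, by simpa [hl] using hy⟩⟩
  obtain ⟨τ, hτA, hτmin⟩ := hAc.exists_isLeast hAne
  have hbef : ∀ θ ∈ Ico 0 τ, l θ ∈ D := by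
    intro θ hθ
    by_contra hn
    exact absurd (hτmin ⟨⟨hθ.1, hθ.2.le.trans hτA.1.2⟩, hn⟩) (not_le.2 hθ.2)
  have hτ0 : 0 < τ := by
    rcases hτA.1.1.lt_or_eq with h | h
    · exact h
    · exfalso; apply hτA.2; rw [← h]; simpa [hl] using hx
  -- Before the exit, `f` is Lipschitz in the parameter of the segment, so the extension to the real
  -- line supplies the limit `g τ`.
  have hlip : LipschitzOnWith (‖x - y‖₊) (f ∘ l) (Ico 0 τ) := by
    refine LipschitzOnWith.of_dist_le_mul fun a ha c hc => ?_
    have hseg : segment ℝ (l a) (l c) ⊆ D := by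
      intro w hw
      rw [segment_eq_image_lineMap] at hw
      obtain ⟨r, hr, rfl⟩ := hw
      have : AffineMap.lineMap (l a) (l c) r = l (AffineMap.lineMap a c r) := by
        simp only [hl, AffineMap.lineMap_apply, vsub_eq_sub, vadd_eq_add, smul_eq_mul]
        module
      rw [this]
      exact hbef _ ((convex_Ico 0 τ).lineMap_mem ha hc hr)
    have := hf _ _ hseg
    rw [← dist_eq_norm] at this
    refine this.trans ?_
    have e : l a - l c = (a - c) • (y - x) := by
      simp only [hl, AffineMap.lineMap_apply, vsub_eq_sub, vadd_eq_add]; module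
    rw [e, norm_smul, coe_nnnorm, norm_sub_rev y x, mul_comm, Real.dist_eq, Real.norm_eq_abs]
  obtain ⟨g, hgL, hgE⟩ := hlip.extend_real
  refine ⟨τ, hτ0, hτA.1.2, hτA.2, hbef, g τ, ?_, ?_⟩
  · have e0 : f x = g 0 := by
      rw [← hgE ⟨le_rfl, hτ0⟩]; simp [hl]
    have := hgL.dist_le_mul 0 τ
    rw [Real.dist_eq, Real.dist_eq, zero_sub, abs_neg, abs_of_pos hτ0] at this
    rw [e0]
    refine this.trans ?_
    rw [coe_nnnorm]
    have h1 := norm_nonneg (x - y)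
    have h2 := hτA.1.2
    nlinarith
  -- The freedom in `D'` allows the limit to be read as one from a connected component that contains
  -- the path.
  · intro D' hD' ε hε
    have hT : Tendsto l (𝓝[<] τ) (𝓝 (l τ)) := (hlc.tendsto τ).mono_left nhdsWithin_le_nhds
    have hev : ∀ᶠ θ in 𝓝[<] τ, l θ ∈ {w | w ∈ D' ∧ |f w - g τ| < ε} := by
      have h1 : ∀ᶠ θ in 𝓝[<] τ, |g θ - g τ| < ε := by
        have := (hgL.continuous.tendsto τ).mono_left (nhdsWithin_le_nhds (s := Iio τ))
        filter_upwards [this (Metric.ball_mem_nhds _ hε)] with θ hθ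
        simpa [Real.dist_eq] using hθ
      filter_upwards [h1, Ico_mem_nhdsLT hτ0] with θ h2 h3
      refine ⟨hD' θ h3, ?_⟩
      have := hgE h3
      simp only [Function.comp] at this
      rwa [this]
    exact mem_closure_of_tendsto hT hev

/-! ### The length of the boundary of the fattened crease -/

/-- The interpolation points are distinct from their successors. -/
def CreaseMesh.Nondegenerate (M : CreaseMesh) (b : ℝ → Plane) : Prop :=
  ∀ i : Fin M.n, b (M.node i.castSucc) ≠ b (M.node i.succ)

/-- Every triangle contains a ball whose radius is `κ` times its diameter. -/
def CreaseMesh.IsRegular (M : CreaseMesh) (κ : ℝ) : Prop :=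
  ∀ t ∈ M.mesh.faces, t.card = 3 →
    ∃ x, Metric.closedBall x (κ * Metric.diam (t : Set Plane)) ⊆ convexHull ℝ (t : Set Plane)

/-- The parameter intervals are disjoint and lie in `[A, B]`, so their Lebesgue measures can be
added. -/
theorem sum_increments_le {n : ℕ} {s : Fin (n + 1) → ℝ} (hs : StrictMono s) (I : Finset (Fin n))
    {A B : ℝ} (hAB : A ≤ B) (hI : ∀ i ∈ I, A ≤ s i.castSucc ∧ s i.succ ≤ B) :
    ∑ i ∈ I, (s i.succ - s i.castSucc) ≤ B - A := by
  have hpos : ∀ i : Fin n, 0 ≤ s i.succ - s i.castSucc := fun i =>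
    sub_nonneg.2 (hs.monotone Fin.castSucc_lt_succ.le)
  have hdisj : (I : Set (Fin n)).PairwiseDisjoint fun i => Ioo (s i.castSucc) (s i.succ) := by
    have key : ∀ i j : Fin n, i < j → Disjoint (Ioo (s i.castSucc) (s i.succ))
        (Ioo (s j.castSucc) (s j.succ)) := by
      intro i j hij
      rw [Set.disjoint_left]
      intro x hx hx'
      have : s i.succ ≤ s j.castSucc := hs.monotone (by
        rw [Fin.le_def]; simp; exact hij)
      linarith [hx.2, hx'.1]
    intro i _ j _ hij
    rcases lt_or_gt_of_ne hij with h | h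
    · exact key i j h
    · exact (key j i h).symm
  have h1 := measure_biUnion_finset (μ := volume) hdisj (fun i _ => measurableSet_Ioo)
  have h2 : volume (⋃ i ∈ I, Ioo (s i.castSucc) (s i.succ)) ≤ volume (Icc A B) := by
    refine measure_mono (iUnion₂_subset fun i hi x hx => ⟨?_, ?_⟩)
    · exact (hI i hi).1.trans hx.1.le
    · exact hx.2.le.trans (hI i hi).2
  rw [h1] at h2
  simp only [Real.volume_Ioo, Real.volume_Icc] at h2
  rw [← ENNReal.ofReal_sum_of_nonneg fun i _ => hpos i] at h2
  exact (ENNReal.ofReal_le_ofReal_iff (sub_nonneg.2 hAB)).1 h2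

namespace CreaseMesh.IsAdmissible

variable {M : CreaseMesh} {ω ω₁ ω₂ : Set Plane} {b : ℝ → Plane} {α β κ : ℝ}

open Classical in
/-- The diameters of those triangles of the fattened crease that are attached to the part of the
crease between two parameters `A ≤ B` sum up to at most `(B - A) / κ`. -/
theorem sum_diam_le (hω : IsCreased ω ω₁ ω₂ b α β) (h : M.IsAdmissible ω ω₁ ω₂ b α β)
    (hκ : 0 < κ) (hreg : M.IsRegular κ) (hnd : M.Nondegenerate b) (T : Finset (Finset Plane))
    (hT : ∀ t ∈ T, t ∈ M.fat) {A B : ℝ} (hAB : A ≤ B)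
    (hTI : ∀ t ∈ T, ∀ i : Fin M.n, b (M.node i.castSucc) ∈ t → b (M.node i.succ) ∈ t →
      A ≤ M.node i.castSucc ∧ M.node i.succ ≤ B) :
    ∑ t ∈ T, Metric.diam (t : Set Plane) ≤ (B - A) / κ := by
  have hidx := fun (t : Finset Plane) (ht : t ∈ T) => (h.fat_triangle t (hT t ht)).2.2
  by_cases hn : M.n = 0
  · have : T = ∅ := by
      by_contra hne
      obtain ⟨t, ht⟩ := Finset.nonempty_iff_ne_empty.2 hne
      obtain ⟨i, -⟩ := hidx t ht
      exact (hn ▸ i).elim0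
    rw [this]
    simp only [Finset.sum_empty]
    exact div_nonneg (sub_nonneg.2 hAB) hκ.le
  have : Nonempty (Fin M.n) := ⟨⟨0, Nat.pos_of_ne_zero hn⟩⟩
  choose! k hk1 hk2 using hidx
  set δ : Fin M.n → ℝ := fun i => M.node i.succ - M.node i.castSucc with hδ
  have hδ0 : ∀ i, 0 ≤ δ i := fun i =>
    sub_nonneg.2 (h.node_strictMono.monotone Fin.castSucc_lt_succ.le)
  -- The chord estimate bounds `2 * κ` times the diameter by the length of the crease edge, and unit
  -- speed bounds this by the parameter increment.
  have hd : ∀ t ∈ T, Metric.diam (t : Set Plane) ≤ δ (k t) / (2 * κ) := by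
    intro t ht
    obtain ⟨htf, ht3, -⟩ := h.fat_triangle t (hT t ht)
    obtain ⟨x, hx⟩ := hreg t htf ht3
    have h1 := two_mul_le_norm_edge (M.mesh.indep htf) ht3 (hk1 t ht) (hk2 t ht) (hnd _)
      (mul_nonneg hκ.le Metric.diam_nonneg) hx
    have h2 := hω.curve.norm_sub_le (h.node_mem_Icc (k t).castSucc).1
      (h.node_strictMono.monotone Fin.castSucc_lt_succ.le) (h.node_mem_Icc (k t).succ).2
    rw [le_div_iff₀ (by positivity)]
    simp only [hδ]
    linarith
  -- The midpoint of a crease edge is not a vertex of the triangles with this edge, so at most two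
  -- triangles contain it.
  have hcard : ∀ i, (T.filter fun t => k t = i).card ≤ 2 := by
    intro i
    by_contra hlt
    push Not at hlt
    obtain ⟨r, hr, s, hs, t, ht, hrs, hrt, hst⟩ := Finset.two_lt_card.1 hlt
    simp only [Finset.mem_filter] at hr hs ht
    set a := b (M.node i.castSucc) with ha
    set c := b (M.node i.succ) with hc
    have hac : a ≠ c := hnd i
    have mem : ∀ t, t ∈ T ∧ k t = i → a ∈ t ∧ c ∈ t := fun t ht => by
      refine ⟨?_, ?_⟩
      · have := hk1 t ht.1; rwa [ht.2] at this
      · have := hk2 t ht.1; rwa [ht.2] at this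
    have hz : ∀ t, t ∈ T ∧ k t = i → midpoint ℝ a c ∈ convexHull ℝ (t : Set Plane) := fun t ht =>
      (convex_convexHull ℝ _).midpoint_mem (subset_convexHull ℝ _ (mem t ht).1)
        (subset_convexHull ℝ _ (mem t ht).2)
    have hnz : ∀ t, t ∈ T ∧ k t = i → midpoint ℝ a c ∉ t := by
      intro t ht hmt
      refine cross_ne_zero_of_affineIndependent
        (M.mesh.indep (h.fat_triangle t (hT t ht.1)).1) (mem t ht).1 (mem t ht).2 hmt hac ?_ ?_ ?_
      · intro e; exact hac (by simpa [eq_comm] using e)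
      · intro e; exact hac (by simpa [eq_comm] using e)
      · have : midpoint ℝ a c - a = (2⁻¹ : ℝ) • (c - a) := by
          rw [midpoint_eq_smul_add]; simp only [invOf_eq_inv]; module
        rw [this, cross_smul_right, cross_self, mul_zero]
    have hf : ∀ t, t ∈ T ∧ k t = i → t ∈ M.mesh.faces ∧ t.card = 3 := fun t ht =>
      ⟨(h.fat_triangle t (hT t ht.1)).1, (h.fat_triangle t (hT t ht.1)).2.1⟩
    exact not_mem_three_triangles (hf r hr).1 (hf s hs).1 (hf t ht).1 (hf r hr).2 (hf s hs).2
      (hf t ht).2 hrs hrt hst (hnz r hr) (hnz s hs) (hz r hr) (hz s hs) (hz t ht)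
  calc ∑ t ∈ T, Metric.diam (t : Set Plane) ≤ ∑ t ∈ T, δ (k t) / (2 * κ) := Finset.sum_le_sum hd
    _ = ∑ i ∈ T.image k, ∑ t ∈ T.filter (fun t => k t = i), δ (k t) / (2 * κ) := by
        rw [Finset.sum_fiberwise_of_maps_to fun t ht => Finset.mem_image_of_mem k ht]
    _ ≤ ∑ i ∈ T.image k, δ i / κ := by
        refine Finset.sum_le_sum fun i _ => ?_
        calc ∑ t ∈ T.filter (fun t => k t = i), δ (k t) / (2 * κ)
            = ∑ t ∈ T.filter (fun t => k t = i), δ i / (2 * κ) :=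
              Finset.sum_congr rfl fun t ht => by rw [(Finset.mem_filter.1 ht).2]
          _ = (T.filter (fun t => k t = i)).card * (δ i / (2 * κ)) := by
              rw [Finset.sum_const, nsmul_eq_mul]
          _ ≤ 2 * (δ i / (2 * κ)) := by
              have := hδ0 i
              gcongr
              exact_mod_cast hcard i
          _ = δ i / κ := by field_simp
    _ = (∑ i ∈ T.image k, δ i) / κ := by rw [Finset.sum_div]
    _ ≤ (B - A) / κ := by
        gcongr
        refine sum_increments_le h.node_strictMono _ hAB fun i hi => ?_
        obtain ⟨t, ht, rfl⟩ := Finset.mem_image.1 hi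
        exact hTI t ht _ (hk1 t ht) (hk2 t ht)

/-- Boundary points of one side of the sheet on the fattened crease lie on edges of its triangles. -/
theorem exists_edge_of_mem_closure (hω : IsCreased ω ω₁ ω₂ b α β)
    (h : M.IsAdmissible ω ω₁ ω₂ b α β) {z : Plane} (hz : z ∈ closure (ω₁ \ M.fatCrease))
    {t : Finset Plane} (ht : t ∈ M.fat) (hzt : z ∈ convexHull ℝ (t : Set Plane)) :
    ∃ x ∈ t, ∃ y ∈ t, z ∈ segment ℝ x y := by
  classical
  set 𝒯 : Set (Finset Plane) := {t | t ∈ M.mesh.faces ∧ t.card = 3 ∧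
    (interior (convexHull ℝ (t : Set Plane)) ∩ (ω₁ \ M.fatCrease)).Nonempty} with h𝒯
  have hfin : 𝒯.Finite := h.finite.subset fun t ht => ht.1
  have hcl : IsClosed (⋃ t ∈ 𝒯, convexHull ℝ (t : Set Plane)) :=
    hfin.isClosed_biUnion fun t _ => (isCompact_convexHull_finset t).isClosed
  have hsub : ω₁ \ M.fatCrease ⊆ ⋃ t ∈ 𝒯, convexHull ℝ (t : Set Plane) := by
    intro x hx
    obtain ⟨t, h1, h2, h3, h4⟩ := h.subset_iUnion_triangles hω hx
    exact mem_iUnion₂.2 ⟨t, ⟨h1, h2, h3⟩, h4⟩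
  obtain ⟨s, ⟨hs, hs3, w, hw, hw'⟩, hzs⟩ := mem_iUnion₂.1 (hcl.closure_subset_iff.2 hsub hz)
  -- `s` has interior points off the fattened crease, so it is a different triangle and shares at
  -- most an edge with `t`.
  have hst : s ≠ t := by
    rintro rfl
    exact hw'.2 (mem_iUnion₂.2 ⟨s, ht, interior_subset hw⟩)
  obtain ⟨htf, ht3, -⟩ := h.fat_triangle t ht
  have hzi := M.mesh.inter_subset_convexHull hs htf ⟨hzs, hzt⟩
  rw [← Finset.coe_inter] at hzi
  have hc : (s ∩ t).card ≤ 2 := by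
    by_contra hlt
    push Not at hlt
    have h1 : s ∩ t = s := Finset.eq_of_subset_of_card_le Finset.inter_subset_left (by omega)
    have h2 : s ∩ t = t := Finset.eq_of_subset_of_card_le Finset.inter_subset_right (by omega)
    exact hst (h1.symm.trans h2)
  have h3 : (s ∩ t).card = 0 ∨ (s ∩ t).card = 1 ∨ (s ∩ t).card = 2 := by omega
  rcases h3 with h' | h' | h'
  · rw [Finset.card_eq_zero.1 h'] at hzi; simp at hzi
  · obtain ⟨x, hx⟩ := Finset.card_eq_one.1 h'
    have hxt : x ∈ t := (Finset.mem_inter.1 (by rw [hx]; simp : x ∈ s ∩ t)).2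
    rw [hx] at hzi
    simp only [Finset.coe_singleton, convexHull_singleton, mem_singleton_iff] at hzi
    exact ⟨x, hxt, x, hxt, by simp [hzi]⟩
  · obtain ⟨x, y, -, hxy⟩ := Finset.card_eq_two.1 h'
    have hxt : x ∈ t := (Finset.mem_inter.1 (by rw [hxy]; simp : x ∈ s ∩ t)).2
    have hyt : y ∈ t := (Finset.mem_inter.1 (by rw [hxy]; simp : y ∈ s ∩ t)).2
    rw [hxy] at hzi
    simp only [Finset.coe_insert, Finset.coe_singleton, convexHull_pair] at hzi
    exact ⟨x, hxt, y, hyt, hzi⟩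

/-- On the fattened crease the boundary runs along edges of triangles. The crude factor `9` counts
all ordered pairs of vertices of a triangle, and `A`, `B` localise the bound to an arc of the
crease. -/
theorem hausdorffMeasure_frontier_le (hω : IsCreased ω ω₁ ω₂ b α β)
    (h : M.IsAdmissible ω ω₁ ω₂ b α β) (hκ : 0 < κ) (hreg : M.IsRegular κ)
    (hnd : M.Nondegenerate b) {D N : Set Plane} (hD : D ⊆ ω₁ \ M.fatCrease)
    (hN : frontier D ⊆ N ∪ M.fatCrease) {A B : ℝ} (hAB : A ≤ B)
    (hI : ∀ t ∈ M.fat, (convexHull ℝ (t : Set Plane) ∩ frontier D).Nonempty →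
      ∀ i : Fin M.n, b (M.node i.castSucc) ∈ t → b (M.node i.succ) ∈ t →
      A ≤ M.node i.castSucc ∧ M.node i.succ ≤ B) :
    Measure.hausdorffMeasure 1 (frontier D) ≤
      Measure.hausdorffMeasure 1 N + ENNReal.ofReal (9 * ((B - A) / κ)) := by
  classical
  set T : Finset (Finset Plane) := h.fat_finite.toFinset.filter fun t : Finset Plane =>
    (convexHull ℝ (t : Set Plane) ∩ frontier D).Nonempty with hTdef
  have hT : ∀ t ∈ T, t ∈ M.fat ∧ (convexHull ℝ (t : Set Plane) ∩ frontier D).Nonempty := by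
    intro t ht; simpa [hTdef] using ht
  have hsub : frontier D ⊆ N ∪ ⋃ t ∈ T, ⋃ x ∈ t, ⋃ y ∈ t, segment ℝ x y := by
    intro z hz
    rcases hN hz with hzN | hzf
    · exact Or.inl hzN
    · right
      obtain ⟨t, ht, hzt⟩ := mem_iUnion₂.1 hzf
      obtain ⟨x, hx, y, hy, hxy⟩ := h.exists_edge_of_mem_closure hω
        (closure_mono hD (frontier_subset_closure hz)) ht hzt
      have htT : t ∈ T := by
        simp only [hTdef, Finset.mem_filter, Set.Finite.mem_toFinset]
        exact ⟨ht, z, hzt, hz⟩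
      exact mem_iUnion₂.2 ⟨t, htT, mem_iUnion₂.2 ⟨x, hx, mem_iUnion₂.2 ⟨y, hy, hxy⟩⟩⟩
  refine (measure_mono hsub).trans ((measure_union_le _ _).trans (add_le_add le_rfl ?_))
  have hedge : ∀ t ∈ T, Measure.hausdorffMeasure 1 (⋃ x ∈ t, ⋃ y ∈ t, segment ℝ x y)
      ≤ ENNReal.ofReal (9 * Metric.diam (t : Set Plane)) := by
    intro t ht
    have ht3 := (h.fat_triangle t (hT t ht).1).2.1
    refine (measure_biUnion_finset_le _ _).trans ?_
    calc ∑ x ∈ t, Measure.hausdorffMeasure 1 (⋃ y ∈ t, segment ℝ x y)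
        ≤ ∑ x ∈ t, ∑ y ∈ t, ENNReal.ofReal (Metric.diam (t : Set Plane)) := by
          refine Finset.sum_le_sum fun x hx => (measure_biUnion_finset_le _ _).trans
            (Finset.sum_le_sum fun y hy => ?_)
          rw [hausdorffMeasure_segment, edist_dist]
          exact ENNReal.ofReal_le_ofReal
            (Metric.dist_le_diam_of_mem t.finite_toSet.isBounded hx hy)
      _ = ENNReal.ofReal (9 * Metric.diam (t : Set Plane)) := by
          simp only [Finset.sum_const, ht3, smul_smul]
          rw [ENNReal.ofReal_mul (by norm_num), nsmul_eq_mul]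
          norm_num
  calc Measure.hausdorffMeasure 1 (⋃ t ∈ T, ⋃ x ∈ t, ⋃ y ∈ t, segment ℝ x y)
      ≤ ∑ t ∈ T, ENNReal.ofReal (9 * Metric.diam (t : Set Plane)) :=
        (measure_biUnion_finset_le _ _).trans (Finset.sum_le_sum hedge)
    _ = ENNReal.ofReal (9 * ∑ t ∈ T, Metric.diam (t : Set Plane)) := by
        rw [← ENNReal.ofReal_sum_of_nonneg fun t _ => by positivity, Finset.mul_sum]
    _ ≤ _ := by
        refine ENNReal.ofReal_le_ofReal ?_
        gcongr
        exact h.sum_diam_le hω hκ hreg hnd T (fun t ht => (hT t ht).1) hAB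
          fun t ht => hI t (hT t ht).1 (hT t ht).2

/-- A point of `ω` off the fattened crease that is not in `ω₁` has a neighbourhood in `ω₂`, which
cannot meet `ω₁`. -/
theorem frontier_diff_inter_subset (hω : IsCreased ω ω₁ ω₂ b α β)
    (h : M.IsAdmissible ω ω₁ ω₂ b α β) {z : Plane} (hz : z ∈ closure (ω₁ \ M.fatCrease))
    (hz' : z ∉ ω₁ \ M.fatCrease) (hzω : z ∈ ω) : z ∈ M.fatCrease := by
  by_contra hzf
  have : z ∈ ω \ M.fatCrease := ⟨hzω, hzf⟩
  rw [h.diff_eq_union hω] at this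
  rcases this with h1 | h1
  · exact hz' h1
  · obtain ⟨w, hw1, hw2⟩ := mem_closure_iff.1 hz _ (h.isOpen_diff hω.lipschitz₂.isOpen) h1
    exact hω.disjoint.le_bot ⟨hw2.1, hw1.1⟩

end CreaseMesh.IsAdmissible

/-! ### Uniform oscillation bounds -/

/-- A uniform bound for the oscillation of functions that are `1`-Lipschitz along segments
on one side of the sheet off the fattened crease. -/
theorem IsCreased.exists_oscillation_bound {ω ω₁ ω₂ : Set Plane} {b : ℝ → Plane} {α β : ℝ}
    (hω : IsCreased ω ω₁ ω₂ b α β) {κ : ℝ} (hκ : 0 < κ) :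
    ∃ C : ℝ, ∀ M : CreaseMesh, M.IsAdmissible ω ω₁ ω₂ b α β → M.IsRegular κ →
      M.Nondegenerate b → ∀ f : Plane → ℝ, SegLip (ω₁ \ M.fatCrease) f → ∀ p ∈ M.fatCrease,
      ∀ s, IsLimitValue (ω₁ \ M.fatCrease) f p s → ∀ x ∈ ω₁ \ M.fatCrease, |f x - s| ≤ C := by
  classical
  obtain ⟨C₀, hC₀⟩ := hω.lipschitz.exists_bound
  -- Twice a bound for the length of the boundary of `ω₁ \ M.fatCrease`, valid for all admissible
  -- meshes.
  set E : ℝ≥0∞ := 2 * (Measure.hausdorffMeasure 1 (frontier ω)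
    + ENNReal.ofReal (9 * ((β - α) / κ))) with hE
  have hEtop : E ≠ ∞ := ENNReal.mul_ne_top (by norm_num)
    (ENNReal.add_ne_top.2 ⟨hω.lipschitz.hausdorffMeasure_frontier_lt_top.ne, ENNReal.ofReal_ne_top⟩)
  refine ⟨C₀ + E.toReal, fun M h hreg hnd f hf p hp s hs x hx => ?_⟩
  set D := ω₁ \ M.fatCrease with hD
  have hDo : IsOpen D := h.isOpen_diff hω.lipschitz₁.isOpen
  have hlink : ∀ q ∈ M.fatCrease, ∀ s', IsLimitValue D f q s' → |s' - s| ≤ E.toReal := by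
    intro q hq s' hs'
    have h1 := h.abs_limitValue_sub_le hω hf hDo h.connected₁.isPreconnected Subset.rfl
      (h.isPreconnected_fatCrease hω) disjoint_sdiff_self_right hq hp hs' hs
    have h2 := h.hausdorffMeasure_frontier_le hω hκ hreg hnd (D := D) (N := frontier ω) Subset.rfl
      (fun z hz => by
        rw [hDo.frontier_eq] at hz
        by_cases hzω : z ∈ ω
        · exact Or.inr (h.frontier_diff_inter_subset hω hz.1 hz.2 hzω)
        · left
          rw [hω.lipschitz.isOpen.frontier_eq]
          exact ⟨closure_mono (sdiff_subset.trans hω.subset₁) hz.1, hzω⟩) hω.lt.le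
      (fun t _ _ i _ _ => ⟨(h.node_mem_Icc _).1, (h.node_mem_Icc _).2⟩)
    have h3 : ENNReal.ofReal |s' - s| ≤ E := h1.trans (by rw [hE]; gcongr)
    rwa [ENNReal.ofReal_le_iff_le_toReal hEtop] at h3
  -- The excess of `|f - s|` over `E`, continued by zero. A segment in `ω` that leaves `D` does so
  -- on the fattened crease, where the limit value of `f` is within `E` of `s`. So `F` is
  -- `1`-Lipschitz along segments of the fixed domain `ω`.
  set F : Plane → ℝ := fun y => if y ∈ D then max (|f y - s| - E.toReal) 0 else 0 with hF
  have hF0 : ∀ y, 0 ≤ F y := by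
    intro y
    simp only [hF]
    split_ifs
    · exact le_max_right _ _
    · exact le_rfl
  have half : ∀ y z, segment ℝ y z ⊆ ω → F y - F z ≤ ‖y - z‖ := by
    intro y z hyz
    by_cases hyD : y ∈ D
    · have hFy : F y = max (|f y - s| - E.toReal) 0 := by simp [hF, hyD]
      by_cases hseg : segment ℝ y z ⊆ D
      · have hzD : z ∈ D := hseg (right_mem_segment ℝ y z)
        have hFz : F z = max (|f z - s| - E.toReal) 0 := by simp [hF, hzD]
        have h1 := hf y z hseg
        rw [Real.norm_eq_abs] at h1
        rw [hFy, hFz]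
        have h2 : |f y - s| ≤ |f z - s| + |f y - f z| := by
          have := abs_add_le (f z - s) (f y - f z)
          simpa using this
        have h3 := norm_nonneg (y - z)
        rw [sub_le_iff_le_add]
        refine max_le ?_ ?_
        · have := le_max_left (|f z - s| - E.toReal) 0
          linarith
        · have := le_max_right (|f z - s| - E.toReal) 0
          linarith
      · obtain ⟨z', hz's, hz'D⟩ := not_subset.1 hseg
        obtain ⟨τ, hτ0, hτ1, hn, hin, s', hs', hlim⟩ := hf.exists_first_exit hDo hyD hz'D
        have hz'y : ‖y - z'‖ ≤ ‖y - z‖ := by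
          rw [segment_eq_image'] at hz's
          obtain ⟨θ, hθ, rfl⟩ := hz's
          rw [show y - (y + θ • (z - y)) = θ • (y - z) by module, norm_smul,
            Real.norm_of_nonneg hθ.1]
          have := norm_nonneg (y - z)
          nlinarith [hθ.2]
        set q := AffineMap.lineMap y z' τ with hq
        have hqseg : q ∈ segment ℝ y z' := by
          rw [segment_eq_image_lineMap]; exact ⟨τ, ⟨hτ0.le, hτ1⟩, rfl⟩
        have hqω : q ∈ ω := hyz ((convex_segment y z).segment_subset (left_mem_segment ℝ y z) hz's
          hqseg)
        have hlim' := hlim D hin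
        have hqc : q ∈ closure D := closure_mono (fun w hw => hw.1) (hlim' 1 one_pos)
        have hqf := h.frontier_diff_inter_subset hω hqc hn hqω
        have h4 := hlink q hqf s' hlim'
        have h5 : |f y - s| ≤ |f y - s'| + |s' - s| := abs_sub_le _ _ _
        have h6 := hF0 z
        have h7 : F y ≤ ‖y - z‖ := by
          rw [hFy]
          exact max_le (by linarith) (norm_nonneg _)
        linarith
    · have : F y = 0 := by simp [hF, hyD]
      have := hF0 z
      have := norm_nonneg (y - z)
      linarith
  have hFL : SegLip ω F := by
    intro y z hyz
    rw [Real.norm_eq_abs, abs_le]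
    have h1 := half y z hyz
    have h2 := half z y (by rwa [segment_symm])
    rw [norm_sub_rev] at h2
    constructor <;> linarith
  have hmid : b ((α + β) / 2) ∈ ω := hω.inside ⟨_, ⟨by linarith [hω.lt], by linarith [hω.lt]⟩, rfl⟩
  have hmidf : b ((α + β) / 2) ∈ M.fatCrease :=
    h.crease_subset ⟨_, ⟨by linarith [hω.lt], by linarith [hω.lt]⟩, rfl⟩
  have h1 := hC₀ F hFL x (hω.subset₁ hx.1) _ hmid
  have h2 : F (b ((α + β) / 2)) = 0 := by simp [hF, hD, hmidf]
  have h3 : F x = max (|f x - s| - E.toReal) 0 := by simp only [hF, hx, if_true]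
  rw [h2, sub_zero] at h1
  have h4 := (le_abs_self _).trans h1
  rw [h3] at h4
  linarith [le_max_left (|f x - s| - E.toReal) 0]

end Folding

namespace Folding

/-! ### The neighbourhood of a crease point -/

/-- Near a parameter at which a unit speed curve is differentiable and which is determined by its
image, the curve is bi-Lipschitz. -/
theorem exists_param_bound {b : ℝ → Plane} {α β s₀ : ℝ} (hc : ContinuousOn b (Icc α β)) {d : Plane}
    (hd : HasDerivAt b d s₀) (hd1 : ‖d‖ = 1) (hinj : ∀ s ∈ Icc α β, b s = b s₀ → s = s₀) :
    ∃ η > 0, ∀ s ∈ Icc α β, ‖b s - b s₀‖ < η → |s - s₀| ≤ 2 * ‖b s - b s₀‖ := by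
  have h1 := hd.isLittleO.def (show (0 : ℝ) < 1 / 2 by norm_num)
  obtain ⟨ε, hε, hball⟩ := Metric.eventually_nhds_iff.1 h1
  have hnear : ∀ s, |s - s₀| < ε → |s - s₀| ≤ 2 * ‖b s - b s₀‖ := by
    intro s hs
    have := hball (y := s) (by rwa [Real.dist_eq])
    rw [Real.norm_eq_abs] at this
    have h2 : ‖(s - s₀) • d‖ = |s - s₀| := by rw [norm_smul, hd1, mul_one, Real.norm_eq_abs]
    have h3 : ‖(s - s₀) • d‖ ≤ ‖b s - b s₀‖ + ‖b s - b s₀ - (s - s₀) • d‖ := by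
      have := norm_sub_le (b s - b s₀) (b s - b s₀ - (s - s₀) • d)
      rwa [sub_sub_cancel] at this
    linarith
  -- The parameters away from `s₀`. By compactness their images keep a positive distance from `b
  -- s₀`.
  set A : Set ℝ := Icc α β ∩ {s | ε ≤ |s - s₀|} with hA
  have hAc : IsCompact A :=
    isCompact_Icc.inter_right (isClosed_le continuous_const (by fun_prop))
  rcases A.eq_empty_or_nonempty with hAe | hAne
  · refine ⟨1, one_pos, fun s hs _ => hnear s ?_⟩
    by_contra hn
    have : s ∈ A := ⟨hs, not_lt.1 hn⟩
    rw [hAe] at this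
    exact this
  · obtain ⟨s₁, hs₁, hmin⟩ := hAc.exists_isMinOn hAne
      ((hc.mono inter_subset_left).sub continuousOn_const).norm
    have hpos : 0 < ‖b s₁ - b s₀‖ := by
      rw [norm_pos_iff, sub_ne_zero]
      intro e
      have h5 := hinj s₁ hs₁.1 e
      have h6 : ε ≤ |s₁ - s₀| := hs₁.2
      rw [h5, sub_self, abs_zero] at h6
      linarith
    refine ⟨_, hpos, fun s hs hlt => hnear s ?_⟩
    by_contra hn
    exact absurd (hmin (show s ∈ A from ⟨hs, not_lt.1 hn⟩)) (not_le.2 hlt)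

/-- The point with coordinates `(t, σ)` in the chart `R` centred at `p`. -/
noncomputable def chartPoint (p : Plane) (R : Plane ≃ₗᵢ[ℝ] Plane) (t σ : ℝ) : Plane :=
  p + R.symm (t • EuclideanSpace.single 0 1 + σ • EuclideanSpace.single 1 1)

section ChartPoint

variable {p : Plane} {R : Plane ≃ₗᵢ[ℝ] Plane}

theorem chartPoint_zero (t σ : ℝ) : R (chartPoint p R t σ - p) 0 = t := by
  rw [chartPoint, add_sub_cancel_left, LinearIsometryEquiv.apply_symm_apply]; simp

theorem chartPoint_one (t σ : ℝ) : R (chartPoint p R t σ - p) 1 = σ := by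
  rw [chartPoint, add_sub_cancel_left, LinearIsometryEquiv.apply_symm_apply]; simp

theorem chartPoint_coord (y : Plane) : chartPoint p R (R (y - p) 0) (R (y - p) 1) = y := by
  have : (R (y - p) 0 • EuclideanSpace.single 0 (1 : ℝ)
      + R (y - p) 1 • EuclideanSpace.single 1 (1 : ℝ) : Plane) = R (y - p) := by
    ext i; fin_cases i <;> simp
  rw [chartPoint, this, LinearIsometryEquiv.symm_apply_apply]; abel

theorem dist_chartPoint_le (t σ t' σ' : ℝ) :
    dist (chartPoint p R t σ) (chartPoint p R t' σ') ≤ |t - t'| + |σ - σ'| := by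
  rw [chartPoint, chartPoint, dist_add_left, LinearIsometryEquiv.dist_map, dist_eq_norm]
  have : t • EuclideanSpace.single 0 (1 : ℝ) + σ • EuclideanSpace.single 1 (1 : ℝ)
        - (t' • EuclideanSpace.single 0 (1 : ℝ) + σ' • EuclideanSpace.single 1 (1 : ℝ))
        = ((t - t') • EuclideanSpace.single 0 (1 : ℝ)
          + (σ - σ') • EuclideanSpace.single 1 (1 : ℝ) : Plane) := by module
  rw [this]
  refine (norm_add_le _ _).trans ?_
  simp [norm_smul]

theorem chartPoint_lineMap (t σ t' σ' θ : ℝ) :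
    AffineMap.lineMap (chartPoint p R t σ) (chartPoint p R t' σ') θ
      = chartPoint p R (t + θ * (t' - t)) (σ + θ * (σ' - σ)) := by
  simp only [chartPoint, AffineMap.lineMap_apply, vsub_eq_sub, vadd_eq_add, map_add, map_smul]
  module

theorem chartPoint_origin : chartPoint p R 0 0 = p := by simp [chartPoint]

theorem abs_chart_coord_sub_le (x y : Plane) (i : Fin 2) :
    |R (x - p) i - R (y - p) i| ≤ dist x y := by
  have := chart_coord_sub_le R (x - p) (y - p) i
  rwa [sub_sub_sub_cancel_right, ← dist_eq_norm] at this

theorem dist_le_of_coord {y : Plane} {A B : ℝ} (h0 : |R (y - p) 0| ≤ A) (h1 : |R (y - p) 1| ≤ B) :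
    dist y p ≤ A + B := by
  have := dist_chartPoint_le (p := p) (R := R) (R (y - p) 0) (R (y - p) 1) 0 0
  rw [chartPoint_coord, chartPoint_origin, sub_zero, sub_zero] at this
  linarith

end ChartPoint

/-- The open box with half sides `A` and `B` in the chart `R` centred at `p`. -/
def chartBox (p : Plane) (R : Plane ≃ₗᵢ[ℝ] Plane) (A B : ℝ) : Set Plane :=
  {y | |R (y - p) 0| < A ∧ |R (y - p) 1| < B}

theorem continuous_abs_chart_coord (p : Plane) (R : Plane ≃ₗᵢ[ℝ] Plane) (i : Fin 2) :
    Continuous fun y : Plane => |R (y - p) i| := by fun_prop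

theorem isOpen_chartBox (p : Plane) (R : Plane ≃ₗᵢ[ℝ] Plane) (A B : ℝ) :
    IsOpen (chartBox p R A B) :=
  (isOpen_lt (continuous_abs_chart_coord p R 0) continuous_const).and
    (isOpen_lt (continuous_abs_chart_coord p R 1) continuous_const)

theorem closure_chartBox_subset (p : Plane) (R : Plane ≃ₗᵢ[ℝ] Plane) (A B : ℝ) :
    closure (chartBox p R A B) ⊆ {y | |R (y - p) 0| ≤ A ∧ |R (y - p) 1| ≤ B} := by
  refine closure_minimal (fun y hy => ⟨hy.1.le, hy.2.le⟩) ?_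
  exact (isClosed_le (continuous_abs_chart_coord p R 0) continuous_const).inter
    (isClosed_le (continuous_abs_chart_coord p R 1) continuous_const)

/-- A box around a point of the crease, in a chart of one side of the sheet, together with a mesh
that is fine compared with the box. -/
structure LocalBox (M : CreaseMesh) (ω ω₁ ω₂ : Set Plane) (b : ℝ → Plane) (α β : ℝ) (p : Plane)
    (R : Plane ≃ₗᵢ[ℝ] Plane) (L : ℝ≥0) (g : ℝ → ℝ) (δ h r : ℝ) : Prop where
  creased : IsCreased ω ω₁ ω₂ b α β
  adm : M.IsAdmissible ω ω₁ ω₂ b α β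
  lip : LipschitzWith L g
  origin : g 0 = 0
  chart : ∀ y ∈ Metric.ball p r, y ∈ ω₁ ↔ g (R (y - p) 0) < R (y - p) 1
  inside : Metric.ball p r ⊆ ω
  pos : 0 < δ
  radius : (L + 5) * δ ≤ r
  size_pos : 0 < h
  size_le : (L + 1) * h ≤ δ / 8
  fine : ∀ t ∈ M.fat, Metric.diam (t : Set Plane) < h

namespace LocalBox

variable {M : CreaseMesh} {ω ω₁ ω₂ : Set Plane} {b : ℝ → Plane} {α β : ℝ} {p : Plane}
    {R : Plane ≃ₗᵢ[ℝ] Plane} {L : ℝ≥0} {g : ℝ → ℝ} {δ h r : ℝ}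

theorem size_le' (H : LocalBox M ω ω₁ ω₂ b α β p R L g δ h r) : h ≤ δ / 8 := by
  have := H.size_le
  have h1 : 0 ≤ (L : ℝ) * h := mul_nonneg L.2 H.size_pos.le
  linarith

theorem abs_g_le (H : LocalBox M ω ω₁ ω₂ b α β p R L g δ h r) (t : ℝ) : |g t| ≤ L * |t| := by
  have := H.lip.dist_le_mul t 0
  rwa [Real.dist_eq, Real.dist_eq, H.origin, sub_zero, sub_zero] at this

/-- Here the constant in `radius` is used: points of the box are within `(L + 4) * δ` of `p`, and `h
≤ δ / 8`. -/
theorem mem_ball_of_dist_lt (H : LocalBox M ω ω₁ ω₂ b α β p R L g δ h r) {y z : Plane}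
    (h0 : |R (y - p) 0| ≤ δ) (h1 : |R (y - p) 1| ≤ (L + 3) * δ) (hz : dist y z < h) :
    z ∈ Metric.ball p r := by
  have h2 := dist_le_of_coord h0 h1
  have h3 := dist_triangle_left z p y
  rw [Metric.mem_ball]
  have := H.radius
  have := H.size_le'
  have := H.pos
  linarith

theorem mem_ball_of_mem (H : LocalBox M ω ω₁ ω₂ b α β p R L g δ h r) {y : Plane}
    (h0 : |R (y - p) 0| ≤ δ) (h1 : |R (y - p) 1| ≤ (L + 3) * δ) :
    y ∈ Metric.ball p r :=
  H.mem_ball_of_dist_lt h0 h1 (z := y) (by simpa using H.size_pos)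

/-- Points of the fattened crease are close to vertices of the polygonal crease, which are below
the graph. -/
theorem exists_node (H : LocalBox M ω ω₁ ω₂ b α β p R L g δ h r) {y : Plane}
    (h0 : |R (y - p) 0| ≤ δ) (h1 : |R (y - p) 1| ≤ (L + 3) * δ) {t : Finset Plane} (ht : t ∈ M.fat)
    (hy : y ∈ convexHull ℝ (t : Set Plane)) :
    ∃ c : Plane, c ∈ t ∧ dist y c < h ∧ R (c - p) 1 ≤ g (R (c - p) 0) := by
  obtain ⟨-, -, i, hi, -⟩ := H.adm.fat_triangle t ht
  have hd : dist y (b (M.node i.castSucc)) < h := by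
    refine lt_of_le_of_lt ?_ (H.fine t ht)
    rw [← convexHull_diam]
    exact Metric.dist_le_diam_of_mem (isCompact_convexHull_finset t).isBounded hy
      (subset_convexHull ℝ _ hi)
  refine ⟨_, hi, hd, ?_⟩
  by_contra hlt
  push Not at hlt
  exact H.creased.disjoint_crease₁
    ((H.chart _ (H.mem_ball_of_dist_lt h0 h1 hd)).2 hlt) ⟨_, H.adm.node_mem_Icc _, rfl⟩

/-- The top part of the box does not meet the fattened crease. -/
theorem top_subset (H : LocalBox M ω ω₁ ω₂ b α β p R L g δ h r) {y : Plane}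
    (hy : y ∈ chartBox p R δ ((L + 3) * δ)) (hy1 : (L + 1) * δ < R (y - p) 1) :
    y ∈ ω₁ \ M.fatCrease := by
  have hL : (0 : ℝ) ≤ L := L.2
  have hg := (abs_le.1 (H.abs_g_le (R (y - p) 0))).2
  have h2 : (L : ℝ) * |R (y - p) 0| ≤ L * δ := mul_le_mul_of_nonneg_left hy.1.le hL
  have hδ := H.pos
  refine ⟨(H.chart y (H.mem_ball_of_mem hy.1.le hy.2.le)).2 (by linarith), fun hf => ?_⟩
  obtain ⟨t, ht, hyt⟩ := mem_iUnion₂.1 hf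
  -- The vertex `c` is not above the graph, so `y` has height at most `L * (δ + h) + h`, which is
  -- less than `(L + 1) * δ`.
  obtain ⟨c, -, hd, hc⟩ := H.exists_node hy.1.le hy.2.le ht hyt
  have e0 := abs_chart_coord_sub_le (p := p) (R := R) y c 0
  have e1 := abs_chart_coord_sub_le (p := p) (R := R) y c 1
  have hgc := (abs_le.1 (H.abs_g_le (R (c - p) 0))).2
  have h3 : |R (c - p) 0| ≤ δ + h := by
    have := abs_sub_abs_le_abs_sub (R (c - p) 0) (R (y - p) 0)
    rw [abs_sub_comm] at this
    have := hy.1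
    linarith
  have h4 : (L : ℝ) * |R (c - p) 0| ≤ L * (δ + h) := mul_le_mul_of_nonneg_left h3 hL
  have h5 := (abs_le.1 e1).2
  have := H.size_le
  nlinarith

/-- The part of one side of the sheet in the box that is connected to the top of the box. -/
noncomputable def topComponent (M : CreaseMesh) (ω₁ : Set Plane) (p : Plane)
    (R : Plane ≃ₗᵢ[ℝ] Plane) (L : ℝ≥0) (δ : ℝ) : Set Plane :=
  connectedComponentIn ((ω₁ \ M.fatCrease) ∩ chartBox p R δ ((L + 3) * δ))
    (chartPoint p R 0 ((L + 2) * δ))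

theorem isOpen_side (H : LocalBox M ω ω₁ ω₂ b α β p R L g δ h r) : IsOpen (ω₁ \ M.fatCrease) :=
  H.adm.isOpen_diff H.creased.lipschitz₁.isOpen

theorem isOpen_topComponent (H : LocalBox M ω ω₁ ω₂ b α β p R L g δ h r) :
    IsOpen (topComponent M ω₁ p R L δ) :=
  (H.isOpen_side.inter (isOpen_chartBox _ _ _ _)).connectedComponentIn

theorem topComponent_subset :
    topComponent M ω₁ p R L δ ⊆ (ω₁ \ M.fatCrease) ∩ chartBox p R δ ((L + 3) * δ) :=
  connectedComponentIn_subset _ _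

theorem chartPoint_mem_box {t σ : ℝ} (ht : |t| < δ)
    (hσ : |σ| < (L + 3) * δ) : chartPoint p R t σ ∈ chartBox p R δ ((L + 3) * δ) := by
  constructor
  · rw [chartPoint_zero]; exact ht
  · rw [chartPoint_one]; exact hσ

theorem subset_topComponent {A : Set Plane}
    (hA : IsPreconnected A) (hsub : A ⊆ (ω₁ \ M.fatCrease) ∩ chartBox p R δ ((L + 3) * δ))
    (hne : (A ∩ topComponent M ω₁ p R L δ).Nonempty) : A ⊆ topComponent M ω₁ p R L δ := by
  obtain ⟨y, hyA, hyT⟩ := hne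
  rw [topComponent, connectedComponentIn_eq hyT]
  exact hA.subset_connectedComponentIn hyA hsub

theorem top_mem_topComponent (H : LocalBox M ω ω₁ ω₂ b α β p R L g δ h r) {y : Plane}
    (hy : y ∈ chartBox p R δ ((L + 3) * δ)) (hy1 : (L + 1) * δ < R (y - p) 1) :
    y ∈ topComponent M ω₁ p R L δ := by
  have hδ := H.pos
  have hL : (0 : ℝ) ≤ L := L.2
  set A : Set Plane := {y | y ∈ chartBox p R δ ((L + 3) * δ) ∧ (L + 1) * δ < R (y - p) 1} with hA
  have hx : chartPoint p R 0 ((L + 2) * δ) ∈ A := by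
    refine ⟨chartPoint_mem_box (by simpa using hδ) ?_, ?_⟩
    · rw [abs_of_nonneg (by positivity)]; nlinarith
    · rw [chartPoint_one]; nlinarith
  have hconv : Convex ℝ A := by
    intro u hu v hv c d hc hd hcd
    have e : ∀ i, R (c • u + d • v - p) i = c * R (u - p) i + d * R (v - p) i := by
      intro i
      have : c • u + d • v - p = c • (u - p) + d • (v - p) := by
        have : p = (c + d) • p := by rw [hcd, one_smul]
        nth_rw 1 [this]; module
      rw [this]; simp
    have hlt : ∀ {B : ℝ} {a a' : ℝ}, a < B → a' < B → c * a + d * a' < B := by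
      intro B a a' h1 h2
      have := (convex_Iio B) (mem_Iio.2 h1) (mem_Iio.2 h2) hc hd hcd
      simpa using this
    have habs : ∀ {B : ℝ} {a a' : ℝ}, |a| < B → |a'| < B → |c * a + d * a'| < B := by
      intro B a a' h1 h2
      rw [abs_lt] at *
      refine ⟨?_, hlt h1.2 h2.2⟩
      have := hlt (neg_lt.1 h1.1) (neg_lt.1 h2.1)
      linarith
    refine ⟨⟨?_, ?_⟩, ?_⟩
    · rw [e]; exact habs hu.1.1 hv.1.1
    · rw [e]; exact habs hu.1.2 hv.1.2
    · rw [e]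
      have := (convex_Ioi ((L + 1) * δ)) (mem_Ioi.2 hu.2) (mem_Ioi.2 hv.2) hc hd hcd
      simpa using this
  have hAsub : A ⊆ (ω₁ \ M.fatCrease) ∩ chartBox p R δ ((L + 3) * δ) :=
    fun w hw => ⟨H.top_subset hw.1 hw.2, hw.1⟩
  exact hconv.isPreconnected.subset_connectedComponentIn hx hAsub ⟨hy, hy1⟩

/-- Adding a point of the closure keeps a connected set connected, so components are relatively
closed. -/
theorem mem_component_of_mem_closure {x₀ z : Plane}
    (hz : z ∈ closure (connectedComponentIn
      ((ω₁ \ M.fatCrease) ∩ chartBox p R δ ((L + 3) * δ)) x₀))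
    (hzD : z ∈ (ω₁ \ M.fatCrease) ∩ chartBox p R δ ((L + 3) * δ)) :
    z ∈ connectedComponentIn ((ω₁ \ M.fatCrease) ∩ chartBox p R δ ((L + 3) * δ)) x₀ := by
  set S := (ω₁ \ M.fatCrease) ∩ chartBox p R δ ((L + 3) * δ)
  have hne : (connectedComponentIn S x₀).Nonempty := by
    rw [← closure_nonempty_iff]; exact ⟨z, hz⟩
  have hx₀ : x₀ ∈ S := connectedComponentIn_nonempty_iff.1 hne
  have hpre : IsPreconnected (insert z (connectedComponentIn S x₀)) :=
    isPreconnected_connectedComponentIn.subset_closure (subset_insert _ _)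
      (insert_subset hz subset_closure)
  exact hpre.subset_connectedComponentIn (mem_insert_of_mem _ (mem_connectedComponentIn hx₀))
    (insert_subset hzD (connectedComponentIn_subset _ _)) (mem_insert _ _)

/-- Go down from the top of the box until the fattened crease is met. -/
theorem exists_descent (H : LocalBox M ω ω₁ ω₂ b α β p R L g δ h r) {f : Plane → ℝ}
    (hf : SegLip (ω₁ \ M.fatCrease) f) {t : ℝ} (ht : |t| < δ) :
    ∃ q : ℝ, g t ≤ q ∧ q ≤ (L + 2) * δ ∧ chartPoint p R t q ∈ M.fatCrease ∧
      (∀ σ, q < σ → σ < (L + 3) * δ → chartPoint p R t σ ∈ topComponent M ω₁ p R L δ) ∧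
      ∃ s, |f (chartPoint p R t ((L + 2) * δ)) - s| ≤ (2 * L + 2) * δ ∧
        IsLimitValue (topComponent M ω₁ p R L δ) f (chartPoint p R t q) s := by
  have hδ := H.pos
  have hL : (0 : ℝ) ≤ L := L.2
  have hgt := abs_le.1 (H.abs_g_le t)
  have hLt : (L : ℝ) * |t| ≤ L * δ := mul_le_mul_of_nonneg_left ht.le hL
  set Y := chartPoint p R t ((L + 2) * δ) with hY
  -- The end point of the descent is on the graph and not in `ω₁`, which guarantees an exit.
  set Z := chartPoint p R t (g t) with hZ
  have hYbox : Y ∈ chartBox p R δ ((L + 3) * δ) :=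
    chartPoint_mem_box ht (by rw [abs_of_nonneg (by positivity)]; nlinarith)
  have hY1 : (L + 1) * δ < R (Y - p) 1 := by rw [hY, chartPoint_one]; nlinarith
  have hYD := H.top_subset hYbox hY1
  have hYT := H.top_mem_topComponent hYbox hY1
  have hZb : Z ∈ Metric.ball p r := by
    refine H.mem_ball_of_mem ?_ ?_
    · rw [hZ, chartPoint_zero]; exact ht.le
    · rw [hZ, chartPoint_one, abs_le]; constructor <;> nlinarith
  have hZ1 : Z ∉ ω₁ := by
    rw [H.chart Z hZb, hZ, chartPoint_zero, chartPoint_one]; exact lt_irrefl _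
  obtain ⟨τ, hτ0, hτ1, hn, hin, s, hs, hlim⟩ :=
    hf.exists_first_exit H.isOpen_side hYD (fun h => hZ1 h.1 : Z ∉ ω₁ \ M.fatCrease)
  have hline : ∀ θ, AffineMap.lineMap Y Z θ
      = chartPoint p R t ((L + 2) * δ + θ * (g t - (L + 2) * δ)) := by
    intro θ
    rw [hY, hZ, chartPoint_lineMap, sub_self, mul_zero, add_zero]
  set q := (L + 2) * δ + τ * (g t - (L + 2) * δ) with hq
  have hneg : g t - (L + 2) * δ < 0 := by nlinarith
  have hgq : g t ≤ q := by nlinarith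
  have hq2 : q ≤ (L + 2) * δ := by nlinarith
  have hbox : ∀ σ, g t ≤ σ → σ < (L + 3) * δ →
      chartPoint p R t σ ∈ chartBox p R δ ((L + 3) * δ) := fun σ h1 h2 =>
    chartPoint_mem_box ht (abs_lt.2 ⟨by nlinarith, h2⟩)
  have hpath : ∀ θ ∈ Ico 0 τ, AffineMap.lineMap Y Z θ ∈ topComponent M ω₁ p R L δ := by
    have hpre : IsPreconnected ((fun θ => AffineMap.lineMap Y Z θ : ℝ → Plane) '' Ico 0 τ) :=
      isPreconnected_Ico.image _ (AffineMap.lineMap_continuous (R := ℝ)).continuousOn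
    have hsub : (fun θ => AffineMap.lineMap Y Z θ : ℝ → Plane) '' Ico 0 τ ⊆
        (ω₁ \ M.fatCrease) ∩ chartBox p R δ ((L + 3) * δ) := by
      rintro _ ⟨θ, hθ, rfl⟩
      refine ⟨hin θ hθ, ?_⟩
      simp only [hline]
      apply hbox
      · nlinarith [hθ.1, hθ.2]
      · nlinarith [hθ.1, hθ.2]
    have := subset_topComponent hpre hsub ⟨Y, ⟨0, ⟨le_rfl, hτ0⟩, by simp⟩, hYT⟩
    exact fun θ hθ => this ⟨θ, hθ, rfl⟩
  have hqlim := hlim _ hpath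
  rw [hline] at hqlim hn
  have hqbox := hbox q hgq (by nlinarith)
  have hqω : chartPoint p R t q ∈ ω := H.inside (H.mem_ball_of_mem hqbox.1.le hqbox.2.le)
  refine ⟨q, hgq, hq2, ?_, ?_, s, ?_, hqlim⟩
  · refine H.adm.frontier_diff_inter_subset H.creased ?_ hn hqω
    refine closure_mono ?_ (hqlim 1 one_pos)
    exact fun w hw => (topComponent_subset hw.1).1
  · intro σ h1 h2
    by_cases hσ : (L + 1) * δ < σ
    · exact H.top_mem_topComponent (hbox σ (hgq.trans h1.le) h2) (by rwa [chartPoint_one])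
    · have hσ' : σ = (L + 2) * δ + ((σ - (L + 2) * δ) / (g t - (L + 2) * δ))
          * (g t - (L + 2) * δ) := by
        rw [div_mul_cancel₀ _ hneg.ne]; ring
      have := hpath ((σ - (L + 2) * δ) / (g t - (L + 2) * δ)) ⟨?_, ?_⟩
      · rwa [hline, ← hσ'] at this
      · exact div_nonneg_of_nonpos (by nlinarith) hneg.le
      · rw [div_lt_iff_of_neg hneg]; linarith
  · refine hs.trans ?_
    rw [← dist_eq_norm, hY, hZ]
    refine (dist_chartPoint_le _ _ _ _).trans ?_
    rw [sub_self, abs_zero, zero_add, abs_of_pos (by linarith)]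
    nlinarith

/-- A connected part of one side of the sheet in the box that is not connected to the top
cannot pass below a point of the top component. -/
theorem not_crossing (H : LocalBox M ω ω₁ ω₂ b α β p R L g δ h r) {P : Set Plane}
    (hP : IsPreconnected P) (hPsub : P ⊆ (ω₁ \ M.fatCrease) ∩ chartBox p R δ ((L + 3) * δ))
    (hPT : Disjoint P (topComponent M ω₁ p R L δ)) {t : ℝ} (ht : |t| < δ) {y y' : Plane}
    (hy : y ∈ P) (hy' : y' ∈ P) (h1 : R (y - p) 0 < t - h) (h2 : t + h < R (y' - p) 0) :
    False := by
  have hδ := H.pos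
  have hL : (0 : ℝ) ≤ L := L.2
  -- Only the geometric part of the descent matters here, so a constant function serves.
  obtain ⟨q, hgq, hq2, hqf, hup, -⟩ := H.exists_descent (f := fun _ => 0)
    (fun _ _ _ => by simp) ht
  have hgt := abs_le.1 (H.abs_g_le t)
  have hLt : (L : ℝ) * |t| ≤ L * δ := mul_le_mul_of_nonneg_left ht.le hL
  -- A barrier is formed by the vertical line above the exit point `(t, q)`, the segment from there
  -- to the crease vertex `c`, and the vertical line below `c`. In the box these parts lie in the
  -- top component, in the fattened crease, and on or below the graph, where `P` has no points.
  obtain ⟨T, hT, hqT⟩ := mem_iUnion₂.1 hqf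
  obtain ⟨c, hcT, hqc, hcg⟩ := H.exists_node (y := chartPoint p R t q)
    (by rw [chartPoint_zero]; exact ht.le)
    (by rw [chartPoint_one, abs_le]; constructor <;> nlinarith) hT hqT
  have e0 := abs_chart_coord_sub_le (p := p) (R := R) (chartPoint p R t q) c 0
  rw [chartPoint_zero] at e0
  set c0 := R (c - p) 0 with hc0
  set c1 := R (c - p) 1 with hc1
  have hcc : chartPoint p R c0 c1 = c := chartPoint_coord c
  -- The segment may rise from the exit point to `c`, but at most with slope `L`. In the slanted
  -- height `R (w - p) 1 + a * R (w - p) 0` the vertex is lower by `Δ ≥ |c0 - t|`, so this height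
  -- can parametrise the segment.
  set a : ℝ := if t ≤ c0 then -(L + 1) else L + 1 with ha
  have hat : a * (t - c0) = (L + 1) * |c0 - t| := by
    simp only [ha]
    split_ifs with hle
    · rw [abs_of_nonneg (by linarith)]; ring
    · rw [abs_of_neg (by linarith)]; ring
  set Δ : ℝ := q - c1 + (L + 1) * |c0 - t| with hΔ
  have hΔge : |c0 - t| ≤ Δ := by
    have := H.lip.dist_le_mul c0 t
    rw [Real.dist_eq, Real.dist_eq] at this
    have := le_abs_self (g c0 - g t)
    nlinarith
  have hΔ0 : 0 ≤ Δ := (abs_nonneg _).trans hΔge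
  set k : Plane → ℝ := fun w =>
    max 0 (min 1 ((q + a * t - (R (w - p) 1 + a * R (w - p) 0)) / Δ)) with hk
  -- The barrier is the zero set of `ψ`. The signs at `y` and `y'` differ because `k` has values in
  -- `[0, 1]` and `|c0 - t| ≤ h`.
  set ψ : Plane → ℝ := fun w => R (w - p) 0 - t - (c0 - t) * k w with hψ
  have hψc : Continuous ψ := by
    simp only [hψ, hk]
    fun_prop
  have hk01 : ∀ w, 0 ≤ k w ∧ k w ≤ 1 := fun w =>
    ⟨le_max_left _ _, max_le zero_le_one (min_le_left _ _)⟩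
  have hdiff : ∀ w, |(c0 - t) * k w| ≤ h := by
    intro w
    rw [abs_mul, abs_of_nonneg (hk01 w).1]
    rw [abs_sub_comm] at e0
    have := (hk01 w).2
    have := (hk01 w).1
    nlinarith [abs_nonneg (c0 - t)]
  have hψy : ψ y < 0 := by
    have := (abs_le.1 (hdiff y)).1
    simp only [hψ]; linarith
  have hψy' : 0 < ψ y' := by
    have := (abs_le.1 (hdiff y')).2
    simp only [hψ]; linarith
  obtain ⟨w, hw, hw0⟩ := hP.intermediate_value hy hy' hψc.continuousOn
    (show (0 : ℝ) ∈ Icc (ψ y) (ψ y') from ⟨hψy.le, hψy'.le⟩)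
  have hwS := hPsub hw
  have hwT : w ∉ topComponent M ω₁ p R L δ := fun h => hPT.le_bot ⟨hw, h⟩
  set w0 := R (w - p) 0 with hw0def
  set w1 := R (w - p) 1 with hw1def
  have hww : chartPoint p R w0 w1 = w := chartPoint_coord w
  have habove : g w0 < w1 :=
    (H.chart w (H.mem_ball_of_mem hwS.2.1.le hwS.2.2.le)).1 hwS.1.1
  have hnotup : w0 = t → ¬ q < w1 := by
    intro e hlt
    apply hwT
    rw [← hww, e]
    exact hup w1 hlt (abs_lt.1 hwS.2.2).2
  have hwψ : w0 - t = (c0 - t) * k w := by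
    simp only [hψ] at hw0; linarith
  rcases hΔ0.lt_or_eq with hpos | hzero
  · set ρ := (q + a * t - (w1 + a * w0)) / Δ with hρ
    have hkw : k w = max 0 (min 1 ρ) := rfl
    have hρΔ : ρ * Δ = q + a * t - (w1 + a * w0) := by rw [hρ, div_mul_cancel₀ _ hpos.ne']
    rcases le_or_gt ρ 0 with hr0 | hr0
    · have : k w = 0 := by rw [hkw]; exact max_eq_left ((min_le_right _ _).trans hr0)
      rw [this, mul_zero] at hwψ
      have hwt : w0 = t := by linarith
      rw [hwt] at hρΔ
      have hle : q ≤ w1 := by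
        have := mul_nonpos_of_nonpos_of_nonneg hr0 hΔ0
        linarith
      rcases hle.lt_or_eq with hlt | heq
      · exact hnotup hwt hlt
      · apply hwS.1.2
        rw [← hww, hwt, ← heq]; exact hqf
    · rcases le_or_gt 1 ρ with hr1 | hr1
      · have : k w = 1 := by rw [hkw, min_eq_left hr1]; norm_num
        rw [this, mul_one] at hwψ
        have hwc : w0 = c0 := by linarith
        rw [hwc] at hρΔ habove
        have h1 : Δ ≤ ρ * Δ := le_mul_of_one_le_left hΔ0 hr1
        have h2 : a * t - a * c0 = (L + 1) * |c0 - t| := by rw [← hat]; ring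
        linarith
      · have : k w = ρ := by rw [hkw, min_eq_right hr1.le]; exact max_eq_right hr0.le
        rw [this] at hwψ
        have hw0' : w0 = t + ρ * (c0 - t) := by linarith
        have hw1' : w1 = q + ρ * (c1 - q) := by
          rw [hw0', hΔ] at hρΔ
          linear_combination hρΔ + ρ * hat
        apply hwS.1.2
        refine mem_iUnion₂.2 ⟨T, hT, ?_⟩
        have hseg : w ∈ segment ℝ (chartPoint p R t q) c := by
          rw [segment_eq_image_lineMap]
          refine ⟨ρ, ⟨hr0.le, hr1.le⟩, ?_⟩
          rw [← hcc, chartPoint_lineMap, ← hw0', ← hw1', hww]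
        exact (convex_convexHull ℝ _).segment_subset hqT (subset_convexHull ℝ _ hcT) hseg
  -- In the degenerate case `c` is the exit point itself, so this point is not above the graph. The
  -- division by `Δ = 0` in `k` is harmless since it is multiplied by `c0 - t = 0`.
  · have hct : c0 = t := by
      have : |c0 - t| ≤ 0 := hΔge.trans hzero.symm.le
      linarith [abs_nonpos_iff.1 this]
    have hqc1 : q = c1 := by
      rw [hΔ, hct, sub_self, abs_zero, mul_zero, add_zero] at hzero
      linarith
    rw [hct, sub_self, zero_mul] at hwψ
    have hwt : w0 = t := by linarith
    refine hnotup hwt ?_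
    rw [hwt] at habove
    rw [hct] at hcg
    linarith

/-- Near the centre of the box, the side of the sheet belongs to the top component. -/
theorem mem_topComponent (H : LocalBox M ω ω₁ ω₂ b α β p R L g δ h r) {y : Plane}
    (hy : y ∈ ω₁ \ M.fatCrease) (hyb : y ∈ chartBox p R δ ((L + 3) * δ))
    (hy0 : |R (y - p) 0| < δ / 4) : y ∈ topComponent M ω₁ p R L δ := by
  have hδ := H.pos
  have hL : (0 : ℝ) ≤ L := L.2
  have hh := H.size_le'
  set S := (ω₁ \ M.fatCrease) ∩ chartBox p R δ ((L + 3) * δ) with hS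
  have hSo : IsOpen S := H.isOpen_side.inter (isOpen_chartBox _ _ _ _)
  set P := connectedComponentIn S y with hP
  have hyP : y ∈ P := mem_connectedComponentIn ⟨hy, hyb⟩
  have hPpre : IsPreconnected P := isPreconnected_connectedComponentIn
  have hPS : P ⊆ S := connectedComponentIn_subset _ _
  by_cases hne : (P ∩ topComponent M ω₁ p R L δ).Nonempty
  · exact subset_topComponent hPpre hPS hne hyP
  exfalso
  have hdisj : Disjoint P (topComponent M ω₁ p R L δ) :=
    disjoint_iff_inter_eq_empty.2 (not_nonempty_iff_eq_empty.1 hne)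
  have hyabs := abs_lt.1 hy0
  -- A component that misses the top cannot pass the barriers at `-(δ / 2)` and `δ / 2` by more than
  -- `h`, nor enter the top part, so its closure stays in the open box. It is then open and closed
  -- in the connected set `ω₁ \ M.fatCrease`, hence all of it, although it misses the top.
  have hP0 : ∀ w ∈ P, |R (w - p) 0| ≤ δ / 2 + h := by
    intro w hw
    rw [abs_le]
    constructor
    · by_contra hlt
      push Not at hlt
      exact H.not_crossing hPpre hPS hdisj (t := -(δ / 2))
        (by rw [abs_neg, abs_of_pos (by linarith)]; linarith) hw hyP (by linarith) (by linarith)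
    · by_contra hlt
      push Not at hlt
      exact H.not_crossing hPpre hPS hdisj (t := δ / 2)
        (by rw [abs_of_pos (by linarith)]; linarith) hyP hw (by linarith) (by linarith)
  have hP1 : ∀ w ∈ P, |R (w - p) 1| ≤ (L + 1) * δ := by
    intro w hw
    have hwS := hPS hw
    rw [abs_le]
    constructor
    · have h1 := (H.chart w (H.mem_ball_of_mem hwS.2.1.le hwS.2.2.le)).1 hwS.1.1
      have h2 := (abs_le.1 (H.abs_g_le (R (w - p) 0))).1
      have h3 : (L : ℝ) * |R (w - p) 0| ≤ L * δ := mul_le_mul_of_nonneg_left hwS.2.1.le hL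
      nlinarith
    · by_contra hlt
      push Not at hlt
      exact hdisj.le_bot ⟨hw, H.top_mem_topComponent hwS.2 hlt⟩
  have hcl : closure P ⊆ chartBox p R δ ((L + 3) * δ) := by
    have h1 : IsClosed {w : Plane | |R (w - p) 0| ≤ δ / 2 + h ∧ |R (w - p) 1| ≤ (L + 1) * δ} :=
      (isClosed_le (continuous_abs_chart_coord p R 0) continuous_const).inter
        (isClosed_le (continuous_abs_chart_coord p R 1) continuous_const)
    intro w hw
    obtain ⟨h2, h3⟩ := closure_minimal
      (show P ⊆ {w | |R (w - p) 0| ≤ δ / 2 + h ∧ |R (w - p) 1| ≤ (L + 1) * δ} from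
        fun w hw => ⟨hP0 w hw, hP1 w hw⟩) h1 hw
    exact ⟨by linarith, by nlinarith⟩
  have hall : ω₁ \ M.fatCrease ⊆ P := by
    refine H.adm.connected₁.isPreconnected.subset_of_closure_inter_subset
      hSo.connectedComponentIn ⟨y, hy, hyP⟩ ?_
    rintro w ⟨hw, hwD⟩
    exact mem_component_of_mem_closure hw ⟨hwD, hcl hw⟩
  have hx : chartPoint p R 0 ((L + 2) * δ) ∈ topComponent M ω₁ p R L δ := by
    refine H.top_mem_topComponent (chartPoint_mem_box (by simpa using hδ) ?_) ?_
    · rw [abs_of_nonneg (by positivity)]; nlinarith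
    · rw [chartPoint_one]; nlinarith
  exact hdisj.le_bot ⟨hall (topComponent_subset hx).1, hx⟩

/-- The limit values of a function at points of the fattened crease near the centre of the box are
close to its value at the top of the box. -/
theorem abs_sub_limitValue_le (H : LocalBox M ω ω₁ ω₂ b α β p R L g δ h r) {κ : ℝ} (hκ : 0 < κ)
    (hreg : M.IsRegular κ) (hnd : M.Nondegenerate b) {s₀ η : ℝ}
    (hη : ∀ s ∈ Icc α β, ‖b s - p‖ < η → |s - s₀| ≤ 2 * ‖b s - p‖) (hδη : (L + 5) * δ < η)
    {f : Plane → ℝ} (hf : SegLip (ω₁ \ M.fatCrease) f) {c : Plane} (hc : c ∈ M.fatCrease)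
    (hcp : dist c p < h) {s : ℝ} (hs : IsLimitValue (ω₁ \ M.fatCrease) f c s) :
    |f (chartPoint p R 0 ((L + 2) * δ)) - s| ≤
      ((2 * L + 2) + 2 * (4 * (L + 4) + 36 * (L + 5) / κ)) * δ := by
  have hδ := H.pos
  have hL : (0 : ℝ) ≤ L := L.2
  have hh := H.size_le'
  have hh0 := H.size_pos
  set D := topComponent M ω₁ p R L δ with hD
  have hDo : IsOpen D := H.isOpen_topComponent
  have hDpre : IsPreconnected D := isPreconnected_connectedComponentIn
  have hDsub : D ⊆ ω₁ \ M.fatCrease := fun w hw => (topComponent_subset hw).1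
  have hDbox : D ⊆ chartBox p R δ ((L + 3) * δ) := fun w hw => (topComponent_subset hw).2
  obtain ⟨q, -, -, hqf, -, s', hs', hlim⟩ := H.exists_descent hf (t := 0) (by simpa using hδ)
  -- Near the centre all points of the side belong to the top component, so the limit value is also
  -- one from within `D`.
  have hs2 : IsLimitValue D f c s := by
    intro ε hε
    have hcb : c ∈ Metric.ball p (δ / 4) := by
      rw [Metric.mem_ball]; linarith
    have := mem_closure_iff_nhds.1 (hs ε hε)
    rw [mem_closure_iff_nhds]
    intro O hO
    obtain ⟨w, ⟨hwO, hwb⟩, hwD, hwf⟩ := this (O ∩ Metric.ball p (δ / 4))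
      (inter_mem hO (Metric.isOpen_ball.mem_nhds hcb))
    refine ⟨w, hwO, ?_, hwf⟩
    have k0 := abs_chart_coord_sub_le (p := p) (R := R) w p 0
    have k1 := abs_chart_coord_sub_le (p := p) (R := R) w p 1
    simp only [sub_self, map_zero, PiLp.zero_apply, sub_zero] at k0 k1
    have hwb' := Metric.mem_ball.1 hwb
    exact H.mem_topComponent hwD ⟨by linarith, by nlinarith⟩ (by linarith)
  have hlink := H.adm.abs_limitValue_sub_le H.creased hf hDo hDpre hDsub
    (H.adm.isPreconnected_fatCrease H.creased)
    (disjoint_sdiff_self_right.mono_right hDsub) hqf hc hlim hs2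
  -- The four sides of the box; the rest of the boundary of `D` is on the fattened crease.
  set N : Set Plane := segment ℝ (chartPoint p R δ (-((L + 3) * δ))) (chartPoint p R δ ((L + 3) * δ))
    ∪ segment ℝ (chartPoint p R (-δ) (-((L + 3) * δ))) (chartPoint p R (-δ) ((L + 3) * δ))
    ∪ segment ℝ (chartPoint p R (-δ) ((L + 3) * δ)) (chartPoint p R δ ((L + 3) * δ))
    ∪ segment ℝ (chartPoint p R (-δ) (-((L + 3) * δ))) (chartPoint p R δ (-((L + 3) * δ))) with hN
  have hΛ : 0 < (L + 3) * δ := by positivity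
  have hvert : ∀ t σ, |σ| ≤ (L + 3) * δ → chartPoint p R t σ ∈
      segment ℝ (chartPoint p R t (-((L + 3) * δ))) (chartPoint p R t ((L + 3) * δ)) := by
    intro t σ hσ
    obtain ⟨h1, h2⟩ := abs_le.1 hσ
    rw [segment_eq_image_lineMap]
    refine ⟨(σ + (L + 3) * δ) / (2 * ((L + 3) * δ)), ⟨?_, ?_⟩, ?_⟩
    · exact div_nonneg (by linarith) (by linarith)
    · rw [div_le_one (by linarith)]; linarith
    · rw [chartPoint_lineMap]
      congr 1
      · ring
      · field_simp; ring
  have hhor : ∀ t σ, |t| ≤ δ → chartPoint p R t σ ∈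
      segment ℝ (chartPoint p R (-δ) σ) (chartPoint p R δ σ) := by
    intro t σ hσ
    obtain ⟨h1, h2⟩ := abs_le.1 hσ
    rw [segment_eq_image_lineMap]
    refine ⟨(t + δ) / (2 * δ), ⟨?_, ?_⟩, ?_⟩
    · exact div_nonneg (by linarith) (by linarith)
    · rw [div_le_one (by linarith)]; linarith
    · rw [chartPoint_lineMap]
      congr 1
      · field_simp; ring
      · ring
  have hfr : frontier D ⊆ N ∪ M.fatCrease := by
    intro z hz
    rw [hDo.frontier_eq] at hz
    obtain ⟨hz0, hz1⟩ := closure_chartBox_subset _ _ _ _ (closure_mono hDbox hz.1)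
    rcases hz0.lt_or_eq with h0 | h0
    · rcases hz1.lt_or_eq with h1 | h1
      · right
        have hzω : z ∈ ω := H.inside (H.mem_ball_of_mem hz0 hz1)
        refine H.adm.frontier_diff_inter_subset H.creased (closure_mono hDsub hz.1) ?_ hzω
        intro hzD
        exact hz.2 (mem_component_of_mem_closure hz.1 ⟨hzD, h0, h1⟩)
      · left
        rw [← chartPoint_coord (p := p) (R := R) z]
        rcases abs_choice (R (z - p) 1) with e | e
        · have : R (z - p) 1 = (L + 3) * δ := by rw [← h1, e]
          rw [this]; exact Or.inl (Or.inr (hhor _ _ hz0))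
        · have : R (z - p) 1 = -((L + 3) * δ) := by rw [← h1, e, neg_neg]
          rw [this]; exact Or.inr (hhor _ _ hz0)
    · left
      rw [← chartPoint_coord (p := p) (R := R) z]
      rcases abs_choice (R (z - p) 0) with e | e
      · have : R (z - p) 0 = δ := by rw [← h0, e]
        rw [this]; exact Or.inl (Or.inl (Or.inl (hvert _ _ hz1)))
      · have : R (z - p) 0 = -δ := by rw [← h0, e, neg_neg]
        rw [this]; exact Or.inl (Or.inl (Or.inr (hvert _ _ hz1)))
  have hseg : ∀ t σ t' σ' B, |t - t'| + |σ - σ'| ≤ B → Measure.hausdorffMeasure 1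
      (segment ℝ (chartPoint p R t σ) (chartPoint p R t' σ')) ≤ ENNReal.ofReal B := by
    intro t σ t' σ' B hB
    rw [hausdorffMeasure_segment, edist_dist]
    exact ENNReal.ofReal_le_ofReal ((dist_chartPoint_le _ _ _ _).trans hB)
  have hNm : Measure.hausdorffMeasure 1 N ≤ ENNReal.ofReal (4 * (L + 4) * δ) := by
    have hv : ∀ t, Measure.hausdorffMeasure 1 (segment ℝ (chartPoint p R t (-((L + 3) * δ)))
        (chartPoint p R t ((L + 3) * δ))) ≤ ENNReal.ofReal (2 * ((L + 3) * δ)) := fun t => by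
      refine hseg _ _ _ _ _ ?_
      rw [sub_self, abs_zero, zero_add, abs_of_neg (by linarith)]; linarith
    have hw : ∀ σ, Measure.hausdorffMeasure 1 (segment ℝ (chartPoint p R (-δ) σ)
        (chartPoint p R δ σ)) ≤ ENNReal.ofReal (2 * δ) := fun t => by
      refine hseg _ _ _ _ _ ?_
      rw [sub_self, abs_zero, add_zero, abs_of_neg (by linarith)]; linarith
    calc Measure.hausdorffMeasure 1 N ≤ ENNReal.ofReal (2 * ((L + 3) * δ))
          + ENNReal.ofReal (2 * ((L + 3) * δ)) + ENNReal.ofReal (2 * δ) + ENNReal.ofReal (2 * δ) := by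
          refine (measure_union_le _ _).trans (add_le_add ?_ (hw _))
          refine (measure_union_le _ _).trans (add_le_add ?_ (hw _))
          exact (measure_union_le _ _).trans (add_le_add (hv _) (hv _))
      _ = ENNReal.ofReal (4 * (L + 4) * δ) := by
          rw [← ENNReal.ofReal_add (by positivity) (by positivity),
            ← ENNReal.ofReal_add (by positivity) (by positivity),
            ← ENNReal.ofReal_add (by positivity) (by positivity)]
          congr 1; ring
  have hmeas := H.adm.hausdorffMeasure_frontier_le H.creased hκ hreg hnd hDsub hfr
    (A := s₀ - 2 * ((L + 5) * δ)) (B := s₀ + 2 * ((L + 5) * δ)) (by nlinarith) (by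
      intro t ht hne i hi hi'
      obtain ⟨z, hzt, hz⟩ := hne
      obtain ⟨hz0, hz1⟩ := closure_chartBox_subset _ _ _ _
        (closure_mono hDbox (frontier_subset_closure hz))
      -- A triangle that touches the boundary of `D` has its crease vertices within `(L + 5) * δ` of
      -- `p`, hence their parameters within twice this distance of `s₀`.
      have key : ∀ j, b (M.node j) ∈ t → |M.node j - s₀| ≤ 2 * ((L + 5) * δ) := by
        intro j hj
        have hd : dist z (b (M.node j)) < h := by
          refine lt_of_le_of_lt ?_ (H.fine t ht)
          rw [← convexHull_diam]
          exact Metric.dist_le_diam_of_mem (isCompact_convexHull_finset t).isBounded hzt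
            (subset_convexHull ℝ _ hj)
        have h2 := dist_le_of_coord hz0 hz1
        have h3 := dist_triangle_left (b (M.node j)) p z
        have h4 : ‖b (M.node j) - p‖ ≤ (L + 5) * δ := by
          rw [← dist_eq_norm]; linarith
        have h5 := hη _ (H.adm.node_mem_Icc j) (h4.trans_lt hδη)
        linarith
      have k1 := abs_le.1 (key _ hi)
      have k2 := abs_le.1 (key _ hi')
      constructor <;> linarith)
  have hfin : ENNReal.ofReal |s' - s| ≤
      ENNReal.ofReal (2 * (4 * (L + 4) + 36 * (L + 5) / κ) * δ) := by
    refine hlink.trans ?_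
    calc 2 * Measure.hausdorffMeasure 1 (frontier D)
        ≤ 2 * (ENNReal.ofReal (4 * (L + 4) * δ) + ENNReal.ofReal (9 *
          ((s₀ + 2 * ((L + 5) * δ) - (s₀ - 2 * ((L + 5) * δ))) / κ))) := by
          gcongr
          exact hmeas.trans (add_le_add hNm le_rfl)
      _ = ENNReal.ofReal (2 * (4 * (L + 4) + 36 * (L + 5) / κ) * δ) := by
          have e1 : s₀ + 2 * ((L + 5) * δ) - (s₀ - 2 * ((L + 5) * δ)) = 4 * ((L + 5) * δ) := by ring
          rw [e1, ← ENNReal.ofReal_add (by positivity) (by positivity),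
            show (2 : ℝ≥0∞) = ENNReal.ofReal 2 by simp, ← ENNReal.ofReal_mul (by norm_num)]
          congr 1; ring
  rw [ENNReal.ofReal_le_ofReal_iff (by positivity)] at hfin
  have := abs_sub_le (f (chartPoint p R 0 ((L + 2) * δ))) s' s
  linarith

end LocalBox

end Folding

namespace Folding

/-! ### Sequences of meshes -/

section Mesh

variable {ω ω₁ ω₂ : Set Plane} {b : ℝ → Plane} {α β : ℝ}

/-- Points of a triangle of the fattened crease are close to both of its crease vertices. -/
theorem CreaseMesh.dist_lt_of_mem {M : CreaseMesh} {h : ℝ}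
    (hfine : ∀ t ∈ M.fat, Metric.diam (t : Set Plane) < h) {t : Finset Plane} (ht : t ∈ M.fat)
    {y c : Plane} (hy : y ∈ convexHull ℝ (t : Set Plane)) (hc : c ∈ t) : dist y c < h := by
  refine lt_of_le_of_lt ?_ (hfine t ht)
  rw [← convexHull_diam]
  exact Metric.dist_le_diam_of_mem (isCompact_convexHull_finset t).isBounded hy
    (subset_convexHull ℝ _ hc)

theorem CreaseMesh.IsAdmissible.exists_near_node {M : CreaseMesh}
    (hM : M.IsAdmissible ω ω₁ ω₂ b α β) {h : ℝ}
    (hfine : ∀ t ∈ M.fat, Metric.diam (t : Set Plane) < h) {y : Plane} (hy : y ∈ M.fatCrease) :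
    ∃ i : Fin M.n, dist y (b (M.node i.castSucc)) < h := by
  obtain ⟨t, ht, hyt⟩ := mem_iUnion₂.1 hy
  obtain ⟨-, -, i, hi, -⟩ := hM.fat_triangle t ht
  exact ⟨i, CreaseMesh.dist_lt_of_mem hfine ht hyt hi⟩

variable {M : ℕ → CreaseMesh}

theorem VanishingMeshSize.eventually_fat (hs : VanishingMeshSize M)
    (hM : ∀ m, (M m).IsAdmissible ω ω₁ ω₂ b α β) {h : ℝ} (hh : 0 < h) :
    ∀ᶠ m in atTop, ∀ t ∈ (M m).fat, Metric.diam (t : Set Plane) < h := by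
  filter_upwards [hs h hh] with m hm t ht
  exact hm t ((hM m).fat_triangle t ht).1

/-- Consecutive nodes have the same image only if the crease closes up there, at parameters `s` and
`β`. All nodes before the last are then at most `s`, and the middle of the arc from `s` to `β` is
far from every crease vertex, which a fine mesh forbids. Degenerate crease edges would give no
control of diameters. -/
theorem IsCreased.eventually_nondegenerate (hω : IsCreased ω ω₁ ω₂ b α β)
    (hM : ∀ m, (M m).IsAdmissible ω ω₁ ω₂ b α β) (hs : VanishingMeshSize M) :
    ∀ᶠ m in atTop, (M m).Nondegenerate b := by
  have hdeg : ∀ m (i : Fin (M m).n), b ((M m).node i.castSucc) = b ((M m).node i.succ) →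
      (M m).node i.castSucc ∈ Ico α β ∧ (M m).node i.succ = β := by
    intro m i hi
    have hlt := (hM m).node_strictMono (Fin.castSucc_lt_succ (i := i))
    have h1 := (hM m).node_mem_Icc i.castSucc
    have h2 := (hM m).node_mem_Icc i.succ
    have h3 : (M m).node i.castSucc ∈ Ico α β := ⟨h1.1, hlt.trans_le h2.2⟩
    refine ⟨h3, ?_⟩
    by_contra hne
    exact hlt.ne (hω.injOn h3 ⟨h2.1, lt_of_le_of_ne h2.2 hne⟩ hi)
  by_cases hex : ∃ s ∈ Ico α β, b s = b β
  swap
  · refine Eventually.of_forall fun m i hi => hex ?_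
    obtain ⟨h1, h2⟩ := hdeg m i hi
    exact ⟨_, h1, by rw [hi, h2]⟩
  obtain ⟨s, hsI, hsb⟩ := hex
  set z := b ((s + β) / 2) with hz
  have hmid : (s + β) / 2 ∈ Ico α β := ⟨by linarith [hsI.1, hsI.2], by linarith [hsI.2]⟩
  have hcomp : IsCompact (b '' Icc α s) :=
    isCompact_Icc.image_of_continuousOn (hω.curve.1.mono (Icc_subset_Icc_right hsI.2.le))
  have hzn : z ∉ b '' Icc α s := by
    rintro ⟨t, ht, e⟩
    have := hω.injOn ⟨ht.1, ht.2.trans_lt hsI.2⟩ hmid e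
    linarith [ht.2, hsI.2]
  obtain ⟨h, hh, hball⟩ := Metric.isOpen_iff.1 hcomp.isClosed.isOpen_compl z hzn
  filter_upwards [hs.eventually_fat hM hh] with m hm i hi
  obtain ⟨h1, h2⟩ := hdeg m i hi
  have hsi : (M m).node i.castSucc = s := hω.injOn h1 hsI (by rw [hi, h2, hsb])
  obtain ⟨j, hj⟩ := (hM m).exists_near_node hm
    ((hM m).crease_subset ⟨_, ⟨hmid.1, hmid.2.le⟩, rfl⟩)
  refine hball (show b ((M m).node j.castSucc) ∈ Metric.ball z h by
    rw [Metric.mem_ball, dist_comm]; exact hj) ⟨_, ⟨((hM m).node_mem_Icc _).1, ?_⟩, rfl⟩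
  rw [← hsi]
  refine (hM m).node_strictMono.monotone ?_
  have hlast : i.succ = Fin.last _ :=
    (hM m).node_strictMono.injective (h2.trans (hM m).node_last.symm)
  have h3 : j.castSucc < i.succ := by rw [hlast]; exact Fin.castSucc_lt_last j
  exact Fin.le_castSucc_iff.2 h3

/-- Near each point of the crease there are interior vertices of the polygonal crease. -/
theorem IsCreased.eventually_exists_vertex
    (hM : ∀ m, (M m).IsAdmissible ω ω₁ ω₂ b α β) (hs : VanishingMeshSize M) {p : Plane}
    (hp : p ∈ b '' Icc α β) (hpα : p ≠ b α) {h : ℝ} (hh : 0 < h) :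
    ∀ᶠ m in atTop, ∃ i : Fin ((M m).n + 1), i ≠ 0 ∧ i ≠ Fin.last _ ∧
      dist (b ((M m).node i)) p < h := by
  -- The second bound keeps the vertex away from `b α`. It is not the last node because it is the
  -- left node of a crease segment.
  filter_upwards [hs.eventually_fat hM (lt_min hh (dist_pos.2 hpα))] with m hm
  obtain ⟨i, hi⟩ := (hM m).exists_near_node hm ((hM m).crease_subset hp)
  refine ⟨i.castSucc, ?_, (Fin.castSucc_lt_last i).ne, ?_⟩
  · intro e
    rw [e, (hM m).node_zero] at hi
    exact absurd (hi.trans_le (min_le_right _ _)) (lt_irrefl _)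
  · rw [dist_comm]; exact hi.trans_le (min_le_left _ _)

/-- Compact sets away from the crease do not meet the fattened crease of fine meshes. -/
theorem IsCreased.eventually_disjoint_fatCrease (hω : IsCreased ω ω₁ ω₂ b α β)
    (hM : ∀ m, (M m).IsAdmissible ω ω₁ ω₂ b α β) (hs : VanishingMeshSize M) {K : Set Plane}
    (hK : IsCompact K) (hd : Disjoint K (b '' Icc α β)) :
    ∀ᶠ m in atTop, Disjoint K (M m).fatCrease := by
  obtain ⟨h, hh, hdis⟩ := hd.exists_thickenings hK hω.isCompact_crease.isClosed
  filter_upwards [hs.eventually_fat hM hh] with m hm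
  rw [Set.disjoint_left]
  intro y hyK hyf
  obtain ⟨i, hi⟩ := (hM m).exists_near_node hm hyf
  exact hdis.le_bot ⟨Metric.self_subset_thickening hh K hyK,
    Metric.mem_thickening_iff.2 ⟨_, ⟨_, (hM m).node_mem_Icc _, rfl⟩, hi⟩⟩

theorem IsCreased.subset₂ (h : IsCreased ω ω₁ ω₂ b α β) : ω₂ ⊆ ω := h.symm.subset₁

/-- `f` is `1`-Lipschitz along segments off the fattened crease and has limits in the vertices
of the polygonal crease. -/
structure IsPinned (M : CreaseMesh) (ω : Set Plane) (b : ℝ → Plane) (f : Plane → ℝ) : Prop where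
  segLip : SegLip (ω \ M.fatCrease) f
  limit : ∀ i, ∃ s : ℝ, Tendsto f (𝓝[ω \ M.fatCrease] (b (M.node i))) (𝓝 s)

/-- The interior vertices are the link between the two sides: each is in both closures, so the same
limit is seen from either side. -/
theorem IsPinned.isLimitValue {M : CreaseMesh} (hω : IsCreased ω ω₁ ω₂ b α β)
    (hM : M.IsAdmissible ω ω₁ ω₂ b α β) {f : Plane → ℝ} (hf : IsPinned M ω b f)
    {i : Fin (M.n + 1)} (h0 : i ≠ 0) (h1 : i ≠ Fin.last _) :
    ∃ s, IsLimitValue (ω₁ \ M.fatCrease) f (b (M.node i)) s ∧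
      IsLimitValue (ω₂ \ M.fatCrease) f (b (M.node i)) s := by
  obtain ⟨s, hs⟩ := hf.limit i
  obtain ⟨h2, h3⟩ := hM.vertex_mem i h0 h1
  exact ⟨s, isLimitValue_of_tendsto h2
      (hs.mono_left (nhdsWithin_mono _ (sdiff_subset_sdiff_left hω.subset₁))),
    isLimitValue_of_tendsto h3
      (hs.mono_left (nhdsWithin_mono _ (sdiff_subset_sdiff_left hω.subset₂)))⟩

/-- Pinned functions have uniformly bounded oscillation. -/
theorem IsCreased.eventually_oscillation_le (hω : IsCreased ω ω₁ ω₂ b α β)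
    (hM : ∀ m, (M m).IsAdmissible ω ω₁ ω₂ b α β) (hs : VanishingMeshSize M)
    (hreg : ShapeRegular M) :
    ∃ C : ℝ, ∀ᶠ m in atTop, ∀ f, IsPinned (M m) ω b f →
      ∀ x ∈ ω \ (M m).fatCrease, ∀ y ∈ ω \ (M m).fatCrease, |f x - f y| ≤ C := by
  obtain ⟨κ, hκ, hr⟩ := hreg
  obtain ⟨C₁, hC₁⟩ := hω.exists_oscillation_bound hκ
  obtain ⟨C₂, hC₂⟩ := hω.symm.exists_oscillation_bound hκ
  -- The midpoint is only an example of a crease point different from `b α`; it yields an interior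
  -- vertex, where both sides have a common limit value.
  have hmid : (α + β) / 2 ∈ Ioo α β := ⟨by linarith [hω.lt], by linarith [hω.lt]⟩
  refine ⟨2 * max C₁ C₂, ?_⟩
  filter_upwards [hω.eventually_nondegenerate hM hs,
    IsCreased.eventually_exists_vertex hM hs ⟨_, Ioo_subset_Icc_self hmid, rfl⟩
      (fun e => hmid.1.ne' (hω.injOn ⟨hmid.1.le, hmid.2⟩ ⟨le_rfl, hω.lt⟩ e)) one_pos]
    with m hnd hv f hf
  obtain ⟨i, hi0, hi1, -⟩ := hv
  obtain ⟨s, hs1, hs2⟩ := hf.isLimitValue hω (hM m) hi0 hi1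
  have hfat : b ((M m).node i) ∈ (M m).fatCrease :=
    (hM m).crease_subset ⟨_, (hM m).node_mem_Icc i, rfl⟩
  have key : ∀ x ∈ ω \ (M m).fatCrease, |f x - s| ≤ max C₁ C₂ := by
    intro x hx
    rw [(hM m).diff_eq_union hω] at hx
    rcases hx with hx | hx
    · exact (hC₁ _ (hM m) (hr m) hnd f (hf.segLip.mono (sdiff_subset_sdiff_left hω.subset₁)) _ hfat s
        hs1 x hx).trans (le_max_left _ _)
    · exact (hC₂ _ (hM m).symm (hr m) hnd f (hf.segLip.mono (sdiff_subset_sdiff_left hω.subset₂)) _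
        hfat s hs2 x hx).trans (le_max_right _ _)
  intro x hx y hy
  have h1 := key x hx
  have h2 := key y hy
  rw [abs_sub_comm] at h2
  linarith [abs_sub_le (f x) s (f y)]

/-- A point of the crease where the two sides of the sheet meet and the crease is regular. -/
structure IsNicePoint (ω ω₁ ω₂ : Set Plane) (b : ℝ → Plane) (α β : ℝ) (p : Plane) : Prop where
  mem : p ∈ ω
  mem_frontier₁ : p ∈ frontier ω₁
  mem_frontier₂ : p ∈ frontier ω₂
  ne : p ≠ b α
  param : ∃ s₀ ∈ Icc α β, b s₀ = p ∧ (∀ s ∈ Icc α β, b s = b s₀ → s = s₀) ∧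
    ∃ d, HasDerivAt b d s₀ ∧ ‖d‖ = 1

theorem IsNicePoint.symm {p : Plane} (h : IsNicePoint ω ω₁ ω₂ b α β p) :
    IsNicePoint ω ω₂ ω₁ b α β p := ⟨h.1, h.3, h.2, h.4, h.5⟩

/-- One-sided estimate near a nice point. -/
theorem IsNicePoint.exists_near (hω : IsCreased ω ω₁ ω₂ b α β) {p : Plane}
    (hp : IsNicePoint ω ω₁ ω₂ b α β p) {κ : ℝ} (hκ : 0 < κ) {ε : ℝ} (hε : 0 < ε) :
    ∃ x ∈ ω₁, dist x p < ε ∧ ∃ h > 0, ∀ M : CreaseMesh, M.IsAdmissible ω ω₁ ω₂ b α β →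
      M.IsRegular κ → M.Nondegenerate b → (∀ t ∈ M.fat, Metric.diam (t : Set Plane) < h) →
      x ∈ ω₁ \ M.fatCrease ∧ ∀ f : Plane → ℝ, SegLip (ω₁ \ M.fatCrease) f → ∀ c ∈ M.fatCrease,
        dist c p < h → ∀ s, IsLimitValue (ω₁ \ M.fatCrease) f c s → |f x - s| ≤ ε := by
  obtain ⟨s₀, hs₀, hb, hinj, d, hd, hd1⟩ := hp.param
  obtain ⟨R, r₀, L, g, hr₀, hg, hch⟩ := hω.lipschitz₁.graph p hp.mem_frontier₁
  obtain ⟨r₁, hr₁, hball⟩ := Metric.isOpen_iff.1 hω.lipschitz.isOpen p hp.mem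
  obtain ⟨η, hη, hpar⟩ := exists_param_bound hω.curve.1 hd hd1 hinj
  rw [hb] at hpar
  have hL : (0 : ℝ) ≤ L := L.2
  have hg0 : g 0 = 0 := by
    have := hω.lipschitz₁.isOpen
    have := IsLipschitzDomain.frontier_chart this hg hch (Metric.mem_ball_self hr₀) hp.mem_frontier₁
    simpa using this
  set r := min r₀ r₁ with hr
  have hrpos : 0 < r := lt_min hr₀ hr₁
  set C := (2 * (L : ℝ) + 2) + 2 * (4 * (L + 4) + 36 * (L + 5) / κ) with hC
  have hCpos : 0 < C := by positivity
  -- In this order: the box fits into the chart and into `ω`, the parameter bound applies, the error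
  -- `C * δ` is at most `ε`, and `x` is within `ε` of `p`.
  set δ := min (min (r / (L + 5)) (η / (2 * (L + 5)))) (min (ε / C) (ε / (2 * (L + 5)))) with hδ
  have hδpos : 0 < δ := by
    refine lt_min (lt_min ?_ ?_) (lt_min ?_ ?_) <;> positivity
  have hδr : (L + 5) * δ ≤ r := by
    have : δ ≤ r / (L + 5) := (min_le_left _ _).trans (min_le_left _ _)
    rw [le_div_iff₀ (by positivity)] at this; linarith
  have hδη : (L + 5) * δ < η := by
    have : δ ≤ η / (2 * (L + 5)) := (min_le_left _ _).trans (min_le_right _ _)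
    rw [le_div_iff₀ (by positivity)] at this; linarith
  have hδC : C * δ ≤ ε := by
    have : δ ≤ ε / C := (min_le_right _ _).trans (min_le_left _ _)
    rw [le_div_iff₀ hCpos] at this; linarith
  have hδε : (L + 5) * δ < ε := by
    have : δ ≤ ε / (2 * (L + 5)) := (min_le_right _ _).trans (min_le_right _ _)
    rw [le_div_iff₀ (by positivity)] at this; linarith
  set h := δ / (8 * (L + 1)) with hh
  have hhpos : 0 < h := by positivity
  have hhle : (L + 1) * h ≤ δ / 8 := by
    rw [hh]; apply le_of_eq; field_simp
  set x := chartPoint p R 0 ((L + 2) * δ) with hx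
  have hxp : dist x p ≤ (L + 2) * δ := by
    have := dist_chartPoint_le (p := p) (R := R) 0 ((L + 2) * δ) 0 0
    rw [chartPoint_origin, sub_zero, sub_zero, abs_zero, zero_add,
      abs_of_nonneg (by positivity)] at this
    exact this
  have hxω : x ∈ ω₁ := by
    rw [hch x, hx, chartPoint_zero, chartPoint_one, hg0]
    · positivity
    · rw [Metric.mem_ball]
      refine hxp.trans_lt (lt_of_lt_of_le ?_ (min_le_left r₀ r₁))
      nlinarith
  -- The point `x` and the size `h` are fixed before the mesh, so they serve all fine meshes.
  refine ⟨x, hxω, by nlinarith, h, hhpos, fun M hM hreg hnd hfine => ?_⟩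
  have H : LocalBox M ω ω₁ ω₂ b α β p R L g δ h r :=
    { creased := hω
      adm := hM
      lip := hg
      origin := hg0
      chart := fun y hy => hch y (Metric.ball_subset_ball (min_le_left _ _) hy)
      inside := fun y hy => hball (Metric.ball_subset_ball (min_le_right _ _) hy)
      pos := hδpos
      radius := hδr
      size_pos := hhpos
      size_le := hhle
      fine := hfine }
  refine ⟨H.top_subset (LocalBox.chartPoint_mem_box (by simpa using hδpos) ?_) ?_,
    fun f hf c hc hcp s hs => (H.abs_sub_limitValue_le hκ hreg hnd hpar hδη hf hc hcp hs).trans hδC⟩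
  · rw [abs_of_nonneg (by positivity)]; nlinarith
  · rw [chartPoint_one]; nlinarith

/-- At a nice point, pinned functions on the two sides of fine meshes have nearly equal values. -/
theorem IsNicePoint.eventually_near (hω : IsCreased ω ω₁ ω₂ b α β)
    (hM : ∀ m, (M m).IsAdmissible ω ω₁ ω₂ b α β) (hs : VanishingMeshSize M)
    (hreg : ShapeRegular M) {p : Plane} (hp : IsNicePoint ω ω₁ ω₂ b α β p) {ε : ℝ} (hε : 0 < ε) :
    ∃ x ∈ ω₁, ∃ y ∈ ω₂, dist x p < ε ∧ dist y p < ε ∧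
      ∀ᶠ m in atTop, ∀ f, IsPinned (M m) ω b f → |f x - f y| ≤ 2 * ε := by
  obtain ⟨κ, hκ, hr⟩ := hreg
  obtain ⟨x, hx, hxp, h, hh, hest⟩ := hp.exists_near hω hκ hε
  obtain ⟨y, hy, hyp, h', hh', hest'⟩ := hp.symm.exists_near hω.symm hκ hε
  refine ⟨x, hx, y, hy, hxp, hyp, ?_⟩
  obtain ⟨s₀, hs₀, hb, -⟩ := hp.param
  filter_upwards [hω.eventually_nondegenerate hM hs, hs.eventually_fat hM hh,
    hs.eventually_fat hM hh', IsCreased.eventually_exists_vertex hM hs ⟨s₀, hs₀, hb⟩ hp.ne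
      (lt_min hh hh')] with m hnd hf1 hf2 hv f hf
  obtain ⟨i, hi0, hi1, hi⟩ := hv
  obtain ⟨s, hs1, hs2⟩ := hf.isLimitValue hω (hM m) hi0 hi1
  have hfat : b ((M m).node i) ∈ (M m).fatCrease :=
    (hM m).crease_subset ⟨_, (hM m).node_mem_Icc i, rfl⟩
  have h1 := (hest _ (hM m) (hr m) hnd hf1).2 f
    (hf.segLip.mono (sdiff_subset_sdiff_left hω.subset₁)) _ hfat
    (hi.trans_le (min_le_left _ _)) s hs1
  have h2 := (hest' _ (hM m).symm (hr m) hnd hf2).2 f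
    (hf.segLip.mono (sdiff_subset_sdiff_left hω.subset₂)) _ hfat
    (hi.trans_le (min_le_right _ _)) s hs2
  rw [abs_sub_comm] at h2
  linarith [abs_sub_le (f x) s (f y)]

/-- Nice points are dense in the interface of the two sides. -/
theorem IsCreased.exists_nicePoint (hω : IsCreased ω ω₁ ω₂ b α β) {p : Plane} (hp : p ∈ ω)
    (hp1 : p ∈ closure ω₁) (hp2 : p ∈ closure ω₂) {ε : ℝ} (hε : 0 < ε) :
    ∃ q, dist q p < ε ∧ IsNicePoint ω ω₁ ω₂ b α β q := by
  have ho1 := hω.lipschitz₁.isOpen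
  have ho2 := hω.lipschitz₂.isOpen
  have hpf : p ∈ frontier ω₁ := by
    rw [ho1.frontier_eq]
    refine ⟨hp1, fun h => ?_⟩
    obtain ⟨z, hz1, hz2⟩ := mem_closure_iff.1 hp2 _ ho1 h
    exact hω.disjoint.le_bot ⟨hz1, hz2⟩
  obtain ⟨R, r₀, L, g, hr₀, hg, hch⟩ := hω.lipschitz₁.graph p hpf
  obtain ⟨r₁, hr₁, hball⟩ := Metric.isOpen_iff.1 hω.lipschitz.isOpen p hp
  have hg0 : g 0 = 0 := by
    have := IsLipschitzDomain.frontier_chart ho1 hg hch (Metric.mem_ball_self hr₀) hpf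
    simpa using this
  obtain ⟨B, hB, hder⟩ := hω.curve.exists_finite_hasDerivAt
  set r := min (min r₀ r₁) ε with hr
  have hrpos : 0 < r := lt_min (lt_min hr₀ hr₁) hε
  -- Near `p` the boundary of `ω₁` contains a graph through `p`. Only finitely many of its points
  -- are images of break points or end points of the crease.
  set q : ℝ → Plane := fun t => chartPoint p R t (g t) with hq
  have hqc : Continuous fun t => q t := by
    have := hg.continuous
    simp only [hq, chartPoint]
    fun_prop
  have hq0 : q 0 = p := by simp only [hq, hg0, chartPoint_origin]
  have hqinj : Function.Injective q := by
    intro t t' e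
    have := congrArg (fun z => R (z - p) 0) e
    simpa only [hq, chartPoint_zero] using this
  have hnear : ∀ᶠ t in 𝓝[≠] (0 : ℝ), q t ∈ Metric.ball p r :=
    (hqc.tendsto 0).eventually (by rw [hq0]; exact Metric.ball_mem_nhds p hrpos)
      |>.filter_mono nhdsWithin_le_nhds
  have hbad : (q ⁻¹' (b '' B ∪ {b α, b β})).Finite :=
    ((hB.image b).union (toFinite _)).preimage hqinj.injOn
  have hgood : ∀ᶠ t in 𝓝[≠] (0 : ℝ), t ∉ q ⁻¹' (b '' B ∪ {b α, b β}) := by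
    have h2 : (q ⁻¹' (b '' B ∪ {b α, b β}) \ {0}).Finite := hbad.sdiff
    have h3 : ∀ᶠ t in 𝓝 (0 : ℝ), t ∉ q ⁻¹' (b '' B ∪ {b α, b β}) \ {0} :=
      h2.isClosed.isOpen_compl.mem_nhds (by simp)
    rw [eventually_nhdsWithin_iff]
    filter_upwards [h3] with t ht ht0 hmem
    exact ht ⟨hmem, ht0⟩
  obtain ⟨t, htball, htgood⟩ := (hnear.and hgood).exists
  set z := q t with hz
  have hz0 : z ∈ Metric.ball p r₀ :=
    Metric.ball_subset_ball ((min_le_left _ _).trans (min_le_left _ _)) htball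
  have hzω : z ∈ ω :=
    hball (Metric.ball_subset_ball ((min_le_left _ _).trans (min_le_right _ _)) htball)
  have hzc0 : R (z - p) 0 = t := chartPoint_zero _ _
  have hzc1 : R (z - p) 1 = g t := chartPoint_one _ _
  have hz1 : z ∉ ω₁ := by rw [hch z hz0, hzc0, hzc1]; exact lt_irrefl _
  have hvert : ∀ O, IsOpen O → z ∈ O → ∃ σ > 0, ∀ τ, |τ| < σ → chartPoint p R t (g t + τ) ∈ O := by
    intro O hO hzO
    obtain ⟨σ, hσ, hb⟩ := Metric.isOpen_iff.1 hO z hzO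
    refine ⟨σ, hσ, fun τ hτ => hb ?_⟩
    rw [Metric.mem_ball]
    refine (dist_chartPoint_le _ _ _ _).trans_lt ?_
    rwa [sub_self, abs_zero, zero_add, add_sub_cancel_left]
  have hzcl1 : z ∈ closure ω₁ := by
    rw [mem_closure_iff]
    intro O hO hzO
    obtain ⟨σ, hσ, hmem⟩ := hvert (O ∩ Metric.ball p r₀) (hO.inter Metric.isOpen_ball) ⟨hzO, hz0⟩
    have := hmem (σ / 2) (by rw [abs_of_pos (by linarith)]; linarith)
    refine ⟨_, this.1, (hch _ this.2).2 ?_⟩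
    rw [chartPoint_zero, chartPoint_one]; linarith
  have hzcl2 : z ∈ closure ω₂ := by
    rw [mem_closure_iff]
    intro O hO hzO
    -- Below the graph there are no points of `ω₁`, and the null set `b '' Icc α β` cannot fill a
    -- nonempty open set, so `ω₂` must be present.
    set O' := (O ∩ Metric.ball p r₀ ∩ ω) ∩ {w | R (w - p) 1 < g (R (w - p) 0)} with hO'
    have hO'o : IsOpen O' := by
      refine ((hO.inter Metric.isOpen_ball).inter hω.lipschitz.isOpen).inter
        (isOpen_lt ?_ (hg.continuous.comp ?_)) <;> fun_prop
    obtain ⟨σ, hσ, hmem⟩ := hvert (O ∩ Metric.ball p r₀ ∩ ω)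
      ((hO.inter Metric.isOpen_ball).inter hω.lipschitz.isOpen) ⟨⟨hzO, hz0⟩, hzω⟩
    have hne : O'.Nonempty := by
      refine ⟨_, hmem (-(σ / 2)) (by rw [abs_neg, abs_of_pos (by linarith)]; linarith), ?_⟩
      rw [Set.mem_ofPred_eq, chartPoint_zero, chartPoint_one]; linarith
    have hpos : 0 < volume O' := hO'o.measure_pos volume hne
    have hnsub : ¬ O' ⊆ b '' Icc α β := fun hsub =>
      hpos.ne' (measure_mono_null hsub hω.volume_crease)
    obtain ⟨w, hw, hwγ⟩ := not_subset.1 hnsub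
    refine ⟨w, hw.1.1.1, ?_⟩
    have : w ∈ ω₁ ∪ ω₂ := by rw [← hω.partition]; exact ⟨hw.1.2, hwγ⟩
    rcases this with h | h
    · exact absurd ((hch w hw.1.1.2).1 h) (not_lt.2 (le_of_lt hw.2))
    · exact h
  have hz2 : z ∉ ω₂ := by
    intro h
    obtain ⟨w, hw2, hw1⟩ := mem_closure_iff.1 hzcl1 _ ho2 h
    exact hω.disjoint.le_bot ⟨hw1, hw2⟩
  have hzγ : z ∈ b '' Icc α β := by
    by_contra hn
    have : z ∈ ω₁ ∪ ω₂ := by rw [← hω.partition]; exact ⟨hzω, hn⟩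
    exact this.elim hz1 hz2
  obtain ⟨s, hsI, hsz⟩ := hzγ
  have hzα : z ≠ b α := fun e => htgood (Or.inr (Or.inl e))
  have hzβ : z ≠ b β := fun e => htgood (Or.inr (Or.inr e))
  have hsα : s ≠ α := fun e => hzα (by rw [← hsz, e])
  have hsβ : s ≠ β := fun e => hzβ (by rw [← hsz, e])
  have hsIoo : s ∈ Ioo α β := ⟨lt_of_le_of_ne hsI.1 hsα.symm, lt_of_le_of_ne hsI.2 hsβ⟩
  refine ⟨z, lt_of_lt_of_le htball (min_le_right _ _), hzω, ?_, ?_, hzα, s, hsI, hsz, ?_, ?_⟩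
  · rw [ho1.frontier_eq]; exact ⟨hzcl1, hz1⟩
  · rw [ho2.frontier_eq]; exact ⟨hzcl2, hz2⟩
  · intro s' hs' e
    have hne : s' ≠ β := fun e' => hzβ (by rw [← hsz, ← e, e'])
    exact hω.injOn ⟨hs'.1, lt_of_le_of_ne hs'.2 hne⟩ ⟨hsI.1, hsIoo.2⟩ e
  · exact hder s hsIoo fun hsB => htgood (Or.inl ⟨s, hsB, hsz⟩)

end Mesh

end Folding

namespace Folding

/-! ### Weak derivatives -/

section Weak

variable {U W : Set Plane} {i : Fin 2} {f f' g g' : Plane → Space}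

theorem locallyIntegrableOn_congr (h : f =ᵐ[volume.restrict U] f')
    (hf : LocallyIntegrableOn f U volume) : LocallyIntegrableOn f' U volume := by
  intro x hx
  obtain ⟨s, hs, hfs⟩ := hf x hx
  refine ⟨s ∩ U, inter_mem hs self_mem_nhdsWithin, ?_⟩
  have h1 : IntegrableOn f (s ∩ U) volume := hfs.mono_set inter_subset_left
  exact h1.congr (ae_restrict_of_ae_restrict_of_subset inter_subset_right h)

theorem HasWeakPartial.congr (h : HasWeakPartial U i f g) (hf : f =ᵐ[volume.restrict U] f')
    (hg : g =ᵐ[volume.restrict U] g') : HasWeakPartial U i f' g' := by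
  refine ⟨locallyIntegrableOn_congr hf h.1, locallyIntegrableOn_congr hg h.2.1,
    fun φ h1 h2 h3 => ?_⟩
  have e1 : ∫ x in U, (fderiv ℝ φ x (EuclideanSpace.single i 1)) • f' x
      = ∫ x in U, (fderiv ℝ φ x (EuclideanSpace.single i 1)) • f x := by
    refine integral_congr_ae ?_
    filter_upwards [hf] with x hx
    rw [hx]
  have e2 : ∫ x in U, φ x • g' x = ∫ x in U, φ x • g x := by
    refine integral_congr_ae ?_
    filter_upwards [hg] with x hx
    rw [hx]
  rw [e1, e2, h.2.2 φ h1 h2 h3]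

theorem fderiv_eq_zero_of_notMem_tsupport {φ : Plane → ℝ} {x : Plane} (hx : x ∉ tsupport φ) :
    fderiv ℝ φ x = 0 := by
  by_contra hne
  exact hx (support_fderiv_subset ℝ hne)

theorem setIntegral_eq_of_tsupport_subset (hU : MeasurableSet U) (hWU : W ⊆ U)
    {F : Plane → Space} (hF : ∀ x ∉ W, F x = 0) : ∫ x in U, F x = ∫ x in W, F x :=
  setIntegral_eq_of_subset_of_forall_sdiff_eq_zero hU hWU fun x hx => hF x hx.2

theorem HasWeakPartial.mono (h : HasWeakPartial U i f g) (hU : IsOpen U) (hWU : W ⊆ U) :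
    HasWeakPartial W i f g := by
  refine ⟨h.1.mono_set hWU, h.2.1.mono_set hWU, fun φ h1 h2 h3 => ?_⟩
  have := h.2.2 φ h1 h2 (h3.trans hWU)
  rw [setIntegral_eq_of_tsupport_subset hU.measurableSet hWU (fun x hx => ?_),
    setIntegral_eq_of_tsupport_subset hU.measurableSet hWU (fun x hx => ?_)] at this
  · exact this
  · rw [image_eq_zero_of_notMem_tsupport fun h => hx (h3 h), zero_smul]
  · rw [fderiv_eq_zero_of_notMem_tsupport fun h => hx (h3 h)]; simp

theorem integrable_smul_of_locallyIntegrableOn {K : Set Plane} (hK : IsCompact K) (hKU : K ⊆ U)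
    {ψ : Plane → ℝ} (hψ : Continuous ψ) (h0 : ∀ x ∉ K, ψ x = 0)
    (hf : LocallyIntegrableOn f U volume) : Integrable (fun x => ψ x • f x) volume := by
  have h5 : IntegrableOn (fun x => ψ x • f x) K volume :=
    ((hf.mono_set hKU).integrableOn_isCompact hK).continuousOn_smul hψ.continuousOn hK
  refine (integrableOn_iff_integrable_of_support_subset fun x hx => ?_).1 h5
  by_contra hn
  exact hx (by simp only [h0 x hn, zero_smul])

/-- Weak derivatives are unique up to null sets. -/
theorem HasWeakPartial.unique (hU : IsOpen U) (h : HasWeakPartial U i f g)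
    (h' : HasWeakPartial U i f g') : g =ᵐ[volume.restrict U] g' := by
  have key : ∀ᵐ x ∂(volume : Measure Plane), x ∈ U → (g - g') x = 0 := by
    refine hU.ae_eq_zero_of_integral_contDiff_smul_eq_zero (h.2.1.sub h'.2.1) ?_
    intro φ h1 h2 h3
    have hintg : ∀ G : Plane → Space, LocallyIntegrableOn G U volume →
        Integrable (fun x => φ x • G x) (volume.restrict U) := fun G hG =>
      (integrable_smul_of_locallyIntegrableOn h2 h3 h1.continuous
        (fun x hx => image_eq_zero_of_notMem_tsupport hx) hG).integrableOn
    have e : ∫ x, φ x • (g - g') x = ∫ x in U, φ x • (g - g') x := by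
      rw [← setIntegral_univ]
      exact setIntegral_eq_of_tsupport_subset MeasurableSet.univ (subset_univ _) fun x hx => by
        rw [image_eq_zero_of_notMem_tsupport fun h => hx (h3 h), zero_smul]
    rw [e]
    simp only [Pi.sub_apply, smul_sub]
    rw [integral_sub (hintg g h.2.1) (hintg g' h'.2.1)]
    have e1 := h.2.2 φ h1 h2 h3
    have e2 := h'.2.2 φ h1 h2 h3
    rw [e1, neg_inj] at e2
    rw [e2, sub_self]
  rw [EventuallyEq, ae_restrict_iff' hU.measurableSet]
  filter_upwards [key] with x hx hxU
  exact sub_eq_zero.1 (hx hxU)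

theorem IsWeakHessian.unique {v : Plane → Space} {H H' : Fin 2 → Fin 2 → Plane → Space}
    (hU : IsOpen U) (h : IsWeakHessian U v H) (h' : IsWeakHessian U v H') (j k : Fin 2) :
    H j k =ᵐ[volume.restrict U] H' j k := by
  obtain ⟨G, hG, hH⟩ := h
  obtain ⟨G', hG', hH'⟩ := h'
  have e := (hG' j).unique hU (hG j)
  exact (hH j k).unique hU ((hH' j k).congr e (EventuallyEq.refl _ _))

/-- Weak Hessians agree almost everywhere, so any of them computes the infimum. -/
theorem bendingEnergy_eq {v : Plane → Space} {H : Fin 2 → Fin 2 → Plane → Space}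
    (hU : IsOpen U) (h : IsWeakHessian U v H) :
    bendingEnergy U v = 2⁻¹ * ∫⁻ x in U, ∑ j, ∑ k, ‖H j k x‖ₑ ^ 2 := by
  refine le_antisymm (iInf₂_le H h) (le_iInf₂ fun H' h' => le_of_eq ?_)
  congr 1
  refine lintegral_congr_ae ?_
  have hall : ∀ᵐ x ∂(volume.restrict U), ∀ j k, H j k x = H' j k x :=
    ae_all_iff.2 fun j => ae_all_iff.2 fun k => h.unique hU h' j k
  filter_upwards [hall] with x hx
  simp only [hx]

theorem IsWeakHessian.congr {v v' : Plane → Space} {H : Fin 2 → Fin 2 → Plane → Space}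
    (h : IsWeakHessian U v H) (hv : v =ᵐ[volume.restrict U] v') : IsWeakHessian U v' H := by
  obtain ⟨G, hG, hH⟩ := h
  exact ⟨G, fun j => (hG j).congr hv (EventuallyEq.refl _ _), hH⟩

theorem IsWeakHessian.mono {v : Plane → Space} {H : Fin 2 → Fin 2 → Plane → Space}
    (h : IsWeakHessian U v H) (hU : IsOpen U) (hWU : W ⊆ U) : IsWeakHessian W v H := by
  obtain ⟨G, hG, hH⟩ := h
  exact ⟨G, fun j => (hG j).mono hU hWU, fun j k => (hH j k).mono hU hWU⟩

theorem integral_fderiv_apply_eq_zero {φ : Plane → ℝ} (h1 : ContDiff ℝ (⊤ : ℕ∞) φ)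
    (h2 : HasCompactSupport φ) (e : Plane) : ∫ x, fderiv ℝ φ x e = 0 := by
  have hc : Continuous fun x => fderiv ℝ φ x e :=
    (h1.continuous_fderiv (by simp)).clm_apply continuous_const
  have hi : Integrable (fun x => fderiv ℝ φ x e) volume :=
    hc.integrable_of_hasCompactSupport (h2.fderiv_apply ℝ e)
  have := integral_mul_fderiv_eq_neg_fderiv_mul_of_integrable (μ := (volume : Measure Plane))
    (f := fun _ => (1 : ℝ)) (g := φ) (v := e) (by simp) (by simpa using hi)
    (by simpa using h1.continuous.integrable_of_hasCompactSupport h2) (by simp)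
    (fun x _ => (h1.differentiable (by simp)).differentiableAt)
  simpa using this

/-- The constant drops out because derivatives of test functions have integral zero. -/
theorem HasWeakPartial.sub_const (h : HasWeakPartial U i f g) (a : Space) :
    HasWeakPartial U i (fun x => f x - a) g := by
  refine ⟨h.1.sub (locallyIntegrableOn_const a), h.2.1, fun φ h1 h2 h3 => ?_⟩
  rw [← h.2.2 φ h1 h2 h3]
  have hc : Continuous fun x => fderiv ℝ φ x (EuclideanSpace.single i 1) :=
    (h1.continuous_fderiv (by simp)).clm_apply continuous_const
  have hcs := h2.fderiv_apply ℝ (EuclideanSpace.single i (1 : ℝ))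
  have hsup : ∀ x ∉ tsupport φ, fderiv ℝ φ x (EuclideanSpace.single i 1) = 0 := fun x hx => by
    rw [fderiv_eq_zero_of_notMem_tsupport hx]; rfl
  have hi1 : Integrable (fun x => fderiv ℝ φ x (EuclideanSpace.single i 1) • f x)
      (volume.restrict U) :=
    (integrable_smul_of_locallyIntegrableOn h2 h3 hc hsup h.1).integrableOn
  have hi2 : Integrable (fun x => fderiv ℝ φ x (EuclideanSpace.single i 1) • a)
      (volume.restrict U) :=
    ((hc.integrable_of_hasCompactSupport hcs).smul_const a).integrableOn
  simp only [smul_sub]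
  rw [integral_sub hi1 hi2, sub_eq_self, integral_smul_const]
  have e : ∫ x in U, fderiv ℝ φ x (EuclideanSpace.single i 1) = 0 := by
    rw [setIntegral_eq_integral_of_forall_compl_eq_zero fun x hx => hsup x fun h => hx (h3 h)]
    exact integral_fderiv_apply_eq_zero h1 h2 _
  rw [e, zero_smul]

theorem IsWeakHessian.sub_const {v : Plane → Space} {H : Fin 2 → Fin 2 → Plane → Space}
    (h : IsWeakHessian U v H) (a : Space) :
    IsWeakHessian U (fun x => v x - a) H := by
  obtain ⟨G, hG, hH⟩ := h
  exact ⟨G, fun j => (hG j).sub_const a, hH⟩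

/-- Orthonormal columns of the Jacobian. -/
theorem jacobian_eq_one_iff {G : Fin 2 → Plane → Space} {x : Plane} :
    (jacobian G x)ᵀ * jacobian G x = 1 ↔ ∀ j k, inner ℝ (G j x) (G k x) = if j = k then 1 else 0 := by
  rw [← Matrix.ext_iff]
  refine forall_congr' fun j => forall_congr' fun k => ?_
  rw [Matrix.one_apply, Matrix.mul_apply]
  simp only [jacobian, Matrix.transpose_apply, Matrix.of_apply, PiLp.inner_apply,
    RCLike.inner_apply, conj_trivial, mul_comm]

end Weak

end Folding

namespace Folding

/-! ### Mollification -/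

/-- A sequence of bump functions with supports shrinking to the origin. -/
noncomputable def bump (n : ℕ) : ContDiffBump (0 : Plane) where
  rIn := 1 / (2 * (n + 1))
  rOut := 1 / (n + 1)
  rIn_pos := by positivity
  rIn_lt_rOut := by
    apply one_div_lt_one_div_of_lt <;> [positivity; skip]
    have : (0 : ℝ) ≤ n := n.cast_nonneg
    linarith

/-- The mollification of `F` at scale `1 / (n + 1)`. -/
noncomputable def mollify (n : ℕ) (F : Plane → Space) : Plane → Space :=
  convolution ((bump n).normed volume) F (ContinuousLinearMap.lsmul ℝ ℝ) volume

theorem tendsto_bump_rOut : Tendsto (fun n => (bump n).rOut) atTop (𝓝 0) :=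
  tendsto_one_div_add_atTop_nhds_zero_nat

section Mollify

variable {F G : Plane → Space} {U : Set Plane}

theorem mollify_apply (n : ℕ) (F : Plane → Space) (x : Plane) :
    mollify n F x = ∫ y, (bump n).normed volume (x - y) • F y := by
  rw [mollify, convolution_eq_swap]; rfl

theorem mollify_apply' (n : ℕ) (F : Plane → Space) (x : Plane) :
    mollify n F x = ∫ t, (bump n).normed volume t • F (x - t) := rfl

theorem contDiff_mollify (n : ℕ) (hF : LocallyIntegrable F volume) :
    ContDiff ℝ (⊤ : ℕ∞) (mollify n F) :=
  (bump n).hasCompactSupport_normed.contDiff_convolution_left _ (bump n).contDiff_normed hF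

theorem ae_tendsto_mollify (hF : LocallyIntegrable F volume) :
    ∀ᵐ x ∂(volume : Measure Plane), Tendsto (fun n => mollify n F x) atTop (𝓝 (F x)) := by
  refine ContDiffBump.ae_convolution_tendsto_right_of_locallyIntegrable (K := 2)
    tendsto_bump_rOut (Eventually.of_forall fun n => ?_) hF
  simp only [bump]
  apply le_of_eq
  field_simp

theorem bump_integrable (n : ℕ) (hF : LocallyIntegrable F volume) (x : Plane) :
    Integrable (fun t => (bump n).normed volume t • F (x - t)) volume :=
  (bump n).hasCompactSupport_normed.convolutionExists_left (ContinuousLinearMap.lsmul ℝ ℝ)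
    (bump n).continuous_normed hF x

theorem bump_eq_zero (n : ℕ) {t : Plane} (ht : t ∉ Metric.closedBall 0 (bump n).rOut) :
    (bump n).normed volume t = 0 := by
  rw [← (bump n).tsupport_normed_eq (μ := volume)] at ht
  exact image_eq_zero_of_notMem_tsupport ht

/-- The kernel is a probability density supported in a ball, so only an essential bound on this ball
is needed. -/
theorem norm_mollify_le {n : ℕ} {x : Plane} {C : ℝ}
    (hC : ∀ᵐ y ∂(volume : Measure Plane), y ∈ Metric.closedBall x (bump n).rOut → ‖F y‖ ≤ C) :
    ‖mollify n F x‖ ≤ C := by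
  have hintg : Integrable (fun y => (bump n).normed volume (x - y)) volume :=
    ((bump n).integrable_normed).comp_sub_left x
  have h1 : ∫ y, (bump n).normed volume (x - y) = 1 := by
    rw [integral_sub_left_eq_self ((bump n).normed volume) volume x]
    exact (bump n).integral_normed
  rw [mollify_apply]
  calc ‖∫ y, (bump n).normed volume (x - y) • F y‖
      ≤ ∫ y, (bump n).normed volume (x - y) * C := by
        refine norm_integral_le_of_norm_le (hintg.mul_const C) ?_
        filter_upwards [hC] with y hy
        rw [norm_smul, Real.norm_of_nonneg ((bump n).nonneg_normed _)]
        by_cases h : x - y ∈ Metric.closedBall (0 : Plane) (bump n).rOut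
        · refine mul_le_mul_of_nonneg_left (hy ?_) ((bump n).nonneg_normed _)
          rw [mem_closedBall_zero_iff] at h
          rwa [Metric.mem_closedBall, dist_comm, dist_eq_norm]
        · rw [bump_eq_zero n h, zero_mul, zero_mul]
    _ = C := by rw [integral_mul_const, h1, one_mul]

theorem norm_mollify_sub_le {n : ℕ} {x y : Plane} (hF : LocallyIntegrable F volume) {C : ℝ}
    (hC : ∀ t ∈ Metric.closedBall 0 (bump n).rOut, ‖F (x - t) - F (y - t)‖ ≤ C) :
    ‖mollify n F x - mollify n F y‖ ≤ C := by
  rw [mollify_apply', mollify_apply', ← integral_sub (bump_integrable n hF x) (bump_integrable n hF y)]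
  calc ‖∫ t, ((bump n).normed volume t • F (x - t) - (bump n).normed volume t • F (y - t))‖
      ≤ ∫ t, (bump n).normed volume t * C := by
        refine norm_integral_le_of_norm_le ((bump n).integrable_normed.mul_const C)
          (Eventually.of_forall fun t => ?_)
        rw [← smul_sub, norm_smul, Real.norm_of_nonneg ((bump n).nonneg_normed _)]
        by_cases h : t ∈ Metric.closedBall (0 : Plane) (bump n).rOut
        · exact mul_le_mul_of_nonneg_left (hC t h) ((bump n).nonneg_normed _)
        · rw [bump_eq_zero n h, zero_mul, zero_mul]
    _ = C := by rw [integral_mul_const, (bump n).integral_normed, one_mul]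

theorem mollify_indicator (hU : IsOpen U) (n : ℕ) (F : Plane → Space) (x : Plane) :
    mollify n (U.indicator F) x = ∫ y in U, (bump n).normed volume (x - y) • F y := by
  rw [mollify_apply, ← integral_indicator hU.measurableSet]
  congr 1
  ext1 y
  by_cases hy : y ∈ U <;> simp [hy]

/-- Mollification commutes with weak derivatives away from the boundary. -/
theorem fderiv_mollify {i : Fin 2} (hU : IsOpen U) (hF : IntegrableOn F U volume)
    (hG : HasWeakPartial U i F G) {n : ℕ} {x : Plane}
    (hx : Metric.closedBall x (bump n).rOut ⊆ U) :
    fderiv ℝ (mollify n (U.indicator F)) x (EuclideanSpace.single i 1)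
      = mollify n (U.indicator G) x := by
  have hFi : LocallyIntegrable (U.indicator F) volume :=
    ((integrable_indicator_iff hU.measurableSet).2 hF).locallyIntegrable
  have hρ : ContDiff ℝ (⊤ : ℕ∞) ((bump n).normed (volume : Measure Plane)) := (bump n).contDiff_normed
  have hd := (bump n).hasCompactSupport_normed.hasFDerivAt_convolution_left
    (ContinuousLinearMap.lsmul ℝ ℝ) (hρ.of_le (by simp)) hFi x
  have hex : ConvolutionExistsAt (fderiv ℝ ((bump n).normed (volume : Measure Plane)))
      (U.indicator F) x (ContinuousLinearMap.precompL Plane (ContinuousLinearMap.lsmul ℝ ℝ :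
        ℝ →L[ℝ] Space →L[ℝ] Space)) volume :=
    ((bump n).hasCompactSupport_normed.fderiv ℝ).convolutionExists_left _
      (hρ.continuous_fderiv (by simp)) hFi x
  have e1 : fderiv ℝ (mollify n (U.indicator F)) x (EuclideanSpace.single i 1)
      = ∫ y in U, (fderiv ℝ ((bump n).normed volume) (x - y) (EuclideanSpace.single i 1)) • F y := by
    rw [mollify, hd.fderiv, convolution_eq_swap, ContinuousLinearMap.integral_apply hex.integrable_swap,
      ← integral_indicator hU.measurableSet]
    congr 1
    ext1 y
    by_cases hy : y ∈ U <;> simp [hy, ContinuousLinearMap.precompL_apply]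
  rw [e1, mollify_indicator hU]
  -- The reflected and shifted kernel is a test function on `U` by `hx`.
  set φ : Plane → ℝ := fun y => (bump n).normed volume (x - y) with hφ
  have hφs : ContDiff ℝ (⊤ : ℕ∞) φ := hρ.comp (contDiff_const.sub contDiff_id)
  have hsupp : tsupport φ ⊆ Metric.closedBall x (bump n).rOut := by
    refine closure_minimal (fun y hy => ?_) Metric.isClosed_closedBall
    by_contra hn
    refine hy (bump_eq_zero n fun h => hn ?_)
    rw [mem_closedBall_zero_iff] at h
    rwa [Metric.mem_closedBall, dist_comm, dist_eq_norm]
  have hcs : HasCompactSupport φ :=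
    (isCompact_closedBall x _).of_isClosed_subset (isClosed_tsupport _) hsupp
  have h1 := hG.2.2 φ hφs hcs (hsupp.trans hx)
  have hfd : ∀ y, fderiv ℝ φ y (EuclideanSpace.single i 1)
      = -(fderiv ℝ ((bump n).normed volume) (x - y) (EuclideanSpace.single i 1)) := by
    intro y
    have h2 : HasFDerivAt (fun y : Plane => x - y) (-ContinuousLinearMap.id ℝ Plane) y := by
      simpa using (hasFDerivAt_id y).const_sub x
    have h3 := ((hρ.differentiable (by simp)).differentiableAt (x := x - y)).hasFDerivAt.comp y h2
    rw [show φ = (bump n).normed volume ∘ fun y => x - y from rfl, h3.fderiv]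
    simp
  simp only [hfd, neg_smul, integral_neg, neg_inj] at h1
  exact h1

/-- The set where the mollification only sees `U`. -/
theorem eventually_closedBall_subset (hU : IsOpen U) {K : Set Plane} (hK : IsCompact K)
    (hKU : K ⊆ U) (c : ℝ) : ∀ᶠ n in atTop, ∀ x ∈ K,
      Metric.closedBall x (c * (bump n).rOut) ⊆ U := by
  obtain ⟨δ, hδ, hsub⟩ := hK.exists_cthickening_subset_open hU hKU
  have ht : Tendsto (fun n => c * (bump n).rOut) atTop (𝓝 0) := by
    simpa using tendsto_bump_rOut.const_mul c
  filter_upwards [ht.eventually (gt_mem_nhds hδ)] with n hn x hx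
  exact ((Metric.closedBall_subset_closedBall hn.le).trans
    (Metric.closedBall_subset_cthickening hx δ)).trans hsub

theorem eq_sum_single (e : Plane) :
    e = e 0 • EuclideanSpace.single 0 1 + e 1 • EuclideanSpace.single 1 1 := by
  ext i; fin_cases i <;> simp

/-- With orthonormal columns the differential preserves norms, which turns the isometry constraint
into a gradient bound for mollifications. -/
theorem norm_combination {G : Fin 2 → Plane → Space} {y : Plane}
    (h : ∀ j k, inner ℝ (G j y) (G k y) = if j = k then (1 : ℝ) else 0) (e : Plane) :
    ‖e 0 • G 0 y + e 1 • G 1 y‖ = ‖e‖ := by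
  have h1 : ‖e 0 • G 0 y + e 1 • G 1 y‖ ^ 2 = ‖e‖ ^ 2 := by
    rw [← real_inner_self_eq_norm_sq, EuclideanSpace.norm_sq_eq, Fin.sum_univ_two]
    simp only [inner_add_left, inner_add_right, real_inner_smul_left, real_inner_smul_right, h]
    simp [pow_two]
  exact (sq_eq_sq₀ (norm_nonneg _) (norm_nonneg _)).1 h1

end Mollify

end Folding

/-! ### Continuous representatives and integration by parts -/

namespace Folding

section Representative

theorem norm_le_sum_norm (y : Space) : ‖y‖ ≤ ∑ k, ‖y k‖ := by
  have : y = ∑ k, EuclideanSpace.single k (y k) := by ext j; simp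
  conv_lhs => rw [this]
  refine (norm_sum_le _ _).trans (Finset.sum_le_sum fun k _ => ?_)
  simp

variable {U : Set Plane} {i : Fin 2}

theorem mollify_add_smul {F G : Plane → Space} (hF : LocallyIntegrable F volume)
    (hG : LocallyIntegrable G volume) (a c : ℝ) (n : ℕ) (x : Plane) :
    mollify n (fun y => a • F y + c • G y) x = a • mollify n F x + c • mollify n G x := by
  have h1 : Integrable (fun t => a • (bump n).normed volume t • F (x - t)) volume :=
    (bump_integrable n hF x).smul a
  have h2 : Integrable (fun t => c • (bump n).normed volume t • G (x - t)) volume :=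
    (bump_integrable n hG x).smul c
  rw [mollify_apply', mollify_apply', mollify_apply', ← integral_smul, ← integral_smul,
    ← integral_add h1 h2]
  congr 1
  ext1 t
  module

/-- Mollifications of isometries do not increase distances. -/
theorem eventually_norm_mollify_sub_le (hU : IsOpen U) {v : Plane → Space}
    (hv : IntegrableOn v U volume) {G : Fin 2 → Plane → Space} (hG : IsWeakGradient U v G)
    (hGi : ∀ j, IntegrableOn (G j) U volume)
    (hiso : ∀ᵐ x ∂(volume.restrict U), (jacobian G x)ᵀ * jacobian G x = 1) {x y : Plane}
    (hxy : segment ℝ x y ⊆ U) :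
    ∀ᶠ n in atTop, ‖mollify n (U.indicator v) x - mollify n (U.indicator v) y‖ ≤ ‖x - y‖ := by
  have hloc : ∀ F : Plane → Space, IntegrableOn F U volume →
      LocallyIntegrable (U.indicator F) volume := fun F hF =>
    ((integrable_indicator_iff hU.measurableSet).2 hF).locallyIntegrable
  have hseg : IsCompact (segment ℝ x y) := by
    rw [segment_eq_image_lineMap]
    exact isCompact_Icc.image (by fun_prop)
  filter_upwards [eventually_closedBall_subset hU hseg hxy 1] with n hn
  simp only [one_mul] at hn
  have hsm := contDiff_mollify n (hloc v hv)
  -- The derivative in direction `e` is the mollification of `e 0 • G 0 + e 1 • G 1`, whose norm is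
  -- `‖e‖` almost everywhere.
  have hbound : ∀ z ∈ segment ℝ x y, ‖fderiv ℝ (mollify n (U.indicator v)) z‖ ≤ 1 := by
    intro z hz
    refine ContinuousLinearMap.opNorm_le_bound _ zero_le_one fun e => ?_
    rw [one_mul]
    have he : fderiv ℝ (mollify n (U.indicator v)) z e
        = mollify n (fun y => e 0 • U.indicator (G 0) y + e 1 • U.indicator (G 1) y) z := by
      rw [mollify_add_smul (hloc _ (hGi 0)) (hloc _ (hGi 1)),
        ← fderiv_mollify hU hv (hG 0) (hn z hz), ← fderiv_mollify hU hv (hG 1) (hn z hz)]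
      conv_lhs => rw [eq_sum_single e]
      rw [map_add, map_smul, map_smul]
    rw [he]
    refine norm_mollify_le ?_
    rw [ae_restrict_iff' hU.measurableSet] at hiso
    filter_upwards [hiso] with w hw hwb
    have hwU := hn z hz hwb
    rw [indicator_of_mem hwU, indicator_of_mem hwU,
      norm_combination (jacobian_eq_one_iff.1 (hw hwU))]
  have := (convex_segment x y).norm_image_sub_le_of_norm_fderiv_le (𝕜 := ℝ)
    (fun z _ => (hsm.differentiable (by simp)).differentiableAt) hbound
    (right_mem_segment ℝ x y) (left_mem_segment ℝ x y)
  rwa [one_mul] at this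

theorem norm_eq_one_of_jacobian {G : Fin 2 → Plane → Space} {x : Plane}
    (h : (jacobian G x)ᵀ * jacobian G x = 1) (j : Fin 2) : ‖G j x‖ = 1 := by
  have := jacobian_eq_one_iff.1 h j j
  rw [if_pos rfl, real_inner_self_eq_norm_sq] at this
  exact (pow_eq_one_iff_of_nonneg (norm_nonneg _) two_ne_zero).1 this

theorem integrableOn_of_norm_le {F : Plane → Space} (hUb : Bornology.IsBounded U)
    (hF : AEStronglyMeasurable F (volume.restrict U)) {C : ℝ}
    (hC : ∀ᵐ x ∂(volume.restrict U), ‖F x‖ ≤ C) : IntegrableOn F U volume := by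
  have : IsFiniteMeasure (volume.restrict U) := ⟨by
    rw [Measure.restrict_apply_univ]; exact hUb.measure_lt_top⟩
  exact Integrable.of_bound hF C hC

/-- An isometry has a representative that is `1`-Lipschitz along segments. -/
theorem IsIsometric.exists_segLip (hU : IsOpen U) (hUb : Bornology.IsBounded U)
    {v : Plane → Space} (hv : IntegrableOn v U volume) (hiso : IsIsometric U v) :
    ∃ f : Plane → Space, SegLip U f ∧ f =ᵐ[volume.restrict U] v := by
  obtain ⟨G, hG, hJ⟩ := hiso
  have hGi : ∀ j, IntegrableOn (G j) U volume := fun j =>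
    integrableOn_of_norm_le (C := 1) hUb (hG j).2.1.aestronglyMeasurable (by
      filter_upwards [hJ] with x hx
      exact (norm_eq_one_of_jacobian hx j).le)
  have hloc : LocallyIntegrable (U.indicator v) volume :=
    ((integrable_indicator_iff hU.measurableSet).2 hv).locallyIntegrable
  have hae := ae_tendsto_mollify hloc
  set m : ℕ → Plane → Space := fun n => mollify n (U.indicator v) with hm
  have hseg : ∀ {x y}, segment ℝ x y ⊆ U → ∀ᶠ n in atTop, ‖m n x - m n y‖ ≤ ‖x - y‖ :=
    fun hxy => eventually_norm_mollify_sub_le hU hv hG hGi hJ hxy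
  -- The mollifications converge at almost every point, and the bound along segments transfers the
  -- Cauchy property from such points to all nearby ones. The limit therefore exists everywhere in
  -- `U`.
  have hconv : ∀ x ∈ U, ∃ y, Tendsto (fun n => m n x) atTop (𝓝 y) := by
    intro x hx
    refine cauchySeq_tendsto_of_complete ?_
    obtain ⟨r, hr, hball⟩ := Metric.isOpen_iff.1 hU x hx
    rw [Metric.cauchySeq_iff']
    intro ε hε
    have hpos : (volume : Measure Plane) (Metric.ball x (min r (ε / 4))) ≠ 0 :=
      (Metric.measure_ball_pos _ _ (lt_min hr (by linarith))).ne'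
    obtain ⟨y, hyball, hy⟩ : ∃ y ∈ Metric.ball x (min r (ε / 4)),
        Tendsto (fun n => m n y) atTop (𝓝 (U.indicator v y)) := by
      by_contra hcon
      push Not at hcon
      exact hpos (measure_mono_null (fun y hy => hcon y hy) hae)
    have hxy : segment ℝ x y ⊆ U :=
      ((convex_ball x r).segment_subset (Metric.mem_ball_self hr)
        (Metric.ball_subset_ball (min_le_left _ _) hyball)).trans hball
    have hd : ‖x - y‖ < ε / 4 := by
      rw [← dist_eq_norm, dist_comm]
      exact lt_of_lt_of_le hyball (min_le_right _ _)
    obtain ⟨N₁, hN₁⟩ := eventually_atTop.1 (hseg hxy)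
    obtain ⟨N₂, hN₂⟩ := Metric.cauchySeq_iff.1 hy.cauchySeq (ε / 4) (by linarith)
    refine ⟨max N₁ N₂, fun n hn => ?_⟩
    have h1 := hN₁ n ((le_max_left _ _).trans hn)
    have h2 := hN₁ (max N₁ N₂) (le_max_left _ _)
    have h3 := hN₂ n ((le_max_right _ _).trans hn) (max N₁ N₂) (le_max_right _ _)
    rw [← dist_eq_norm] at h1 h2
    rw [dist_comm] at h2
    have := dist_triangle4 (m n x) (m n y) (m (max N₁ N₂) y) (m (max N₁ N₂) x)
    linarith
  choose! f hf using hconv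
  refine ⟨f, fun x y hxy => ?_, ?_⟩
  · have hx := hf x (hxy (left_mem_segment ℝ x y))
    have hy := hf y (hxy (right_mem_segment ℝ x y))
    exact le_of_tendsto (hx.sub hy).norm (hseg hxy)
  · rw [EventuallyEq, ae_restrict_iff' hU.measurableSet]
    filter_upwards [hae] with x hx hxU
    rw [indicator_of_mem hxU] at hx
    exact tendsto_nhds_unique (hf x hxU) hx

/-- The definition of weak derivatives with vector valued test functions. -/
theorem HasWeakPartial.integral_inner {g h : Plane → Space} (hg : HasWeakPartial U i g h)
    {Ψ : Plane → Space} (h1 : ContDiff ℝ (⊤ : ℕ∞) Ψ) (h2 : HasCompactSupport Ψ)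
    (h3 : tsupport Ψ ⊆ U) :
    ∫ x in U, inner ℝ (fderiv ℝ Ψ x (EuclideanSpace.single i 1)) (g x)
      = -∫ x in U, inner ℝ (Ψ x) (h x) := by
  set π : Fin 3 → Space →L[ℝ] ℝ := fun k => EuclideanSpace.proj k with hπ
  have hΨk : ∀ k, ContDiff ℝ (⊤ : ℕ∞) fun x => Ψ x k := fun k =>
    (π k).contDiff.comp h1
  have hsup : ∀ k, tsupport (fun x => Ψ x k) ⊆ tsupport Ψ := fun k => by
    refine closure_mono fun x hx => ?_
    rw [Function.mem_support] at *
    intro e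
    exact hx (by simp [e])
  have hcs : ∀ k, HasCompactSupport fun x => Ψ x k := fun k =>
    h2.of_isClosed_subset (isClosed_tsupport _) (hsup k)
  have hfd : ∀ k x, fderiv ℝ (fun x => Ψ x k) x (EuclideanSpace.single i 1)
      = fderiv ℝ Ψ x (EuclideanSpace.single i 1) k := by
    intro k x
    have := ((π k).hasFDerivAt.comp x
      ((h1.differentiable (by simp)).differentiableAt (x := x)).hasFDerivAt).fderiv
    rw [show (fun x => Ψ x k) = π k ∘ Ψ from rfl, this]
    rfl
  have hcd : ∀ k, Continuous fun x => fderiv ℝ (fun x => Ψ x k) x (EuclideanSpace.single i 1) :=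
    fun k => ((hΨk k).continuous_fderiv (by simp)).clm_apply continuous_const
  have hi1 : ∀ k, Integrable (fun x => fderiv ℝ (fun x => Ψ x k) x (EuclideanSpace.single i 1) • g x)
      (volume.restrict U) := fun k =>
    (integrable_smul_of_locallyIntegrableOn (hcs k) ((hsup k).trans h3) (hcd k)
      (fun x hx => by rw [fderiv_eq_zero_of_notMem_tsupport hx]; rfl) hg.1).integrableOn
  have hi2 : ∀ k, Integrable (fun x => Ψ x k • h x) (volume.restrict U) := fun k =>
    (integrable_smul_of_locallyIntegrableOn (hcs k) ((hsup k).trans h3) (hΨk k).continuous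
      (fun x hx => image_eq_zero_of_notMem_tsupport (f := fun x => Ψ x k) hx) hg.2.1).integrableOn
  have key : ∀ k, ∫ x in U, fderiv ℝ Ψ x (EuclideanSpace.single i 1) k * g x k
      = -∫ x in U, Ψ x k * h x k := by
    intro k
    have := congrArg (π k) (hg.2.2 _ (hΨk k) (hcs k) ((hsup k).trans h3))
    rw [map_neg, ← (π k).integral_comp_comm (hi1 k), ← (π k).integral_comp_comm (hi2 k)] at this
    simpa [hπ, hfd] using this
  have e1 : ∀ x, inner ℝ (fderiv ℝ Ψ x (EuclideanSpace.single i 1)) (g x)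
      = ∑ k, fderiv ℝ Ψ x (EuclideanSpace.single i 1) k * g x k := fun x => by
    simp [PiLp.inner_apply, mul_comm]
  have e2 : ∀ x, inner ℝ (Ψ x) (h x) = ∑ k, Ψ x k * h x k := fun x => by
    simp [PiLp.inner_apply, mul_comm]
  simp only [e1, e2]
  rw [integral_finsetSum, integral_finsetSum, ← Finset.sum_neg_distrib]
  · exact Finset.sum_congr rfl fun k _ => key k
  · intro k _
    simpa [hπ] using (π k).integrable_comp (hi2 k)
  · intro k _
    simpa [hπ, hfd] using (π k).integrable_comp (hi1 k)

/-- Weak derivatives tested with a cut off function that is `1`-Lipschitz along segments. -/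
theorem SegLip.integral_inner (hU : IsOpen U) (hUb : Bornology.IsBounded U) {u Gi g h : Plane → Space}
    (hu : SegLip U u) {C : ℝ} (hC : ∀ x ∈ U, ‖u x‖ ≤ C) (hGi : HasWeakPartial U i u Gi)
    (hGint : IntegrableOn Gi U volume)
    (hg : HasWeakPartial U i g h) (hgi : IntegrableOn g U volume) (hhi : IntegrableOn h U volume)
    {φ : Plane → ℝ} (h1 : ContDiff ℝ (⊤ : ℕ∞) φ) (h2 : HasCompactSupport φ)
    (h3 : tsupport φ ⊆ U) :
    ∫ x in U, inner ℝ (φ x • Gi x + fderiv ℝ φ x (EuclideanSpace.single i 1) • u x) (g x)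
      = -∫ x in U, inner ℝ (φ x • u x) (h x) := by
  rcases U.eq_empty_or_nonempty with hUe | ⟨x₀, hx₀⟩
  · simp [hUe]
  have hC0 : 0 ≤ C := (norm_nonneg _).trans (hC x₀ hx₀)
  have hui : IntegrableOn u U volume := integrableOn_of_norm_le (C := C) hUb
    ((hu.continuousOn hU).aestronglyMeasurable hU.measurableSet)
    ((ae_restrict_iff' hU.measurableSet).2 (Eventually.of_forall hC))
  have hloc : ∀ F : Plane → Space, IntegrableOn F U volume →
      LocallyIntegrable (U.indicator F) volume := fun F hF =>
    ((integrable_indicator_iff hU.measurableSet).2 hF).locallyIntegrable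
  set ei : Plane := EuclideanSpace.single i 1 with hei
  have hei1 : ‖ei‖ = 1 := by rw [hei]; simp
  -- The field `φ • u` is not smooth and is replaced by `φ • w n`. For large `n`, values and
  -- derivatives of `w n` are bounded uniformly on `tsupport φ`, so dominated convergence applies.
  set w : ℕ → Plane → Space := fun n => mollify n (U.indicator u) with hw
  have hws : ∀ n, ContDiff ℝ (⊤ : ℕ∞) (w n) := fun n => contDiff_mollify n (hloc u hui)
  have hwC : ∀ n x, ‖w n x‖ ≤ C := fun n x => norm_mollify_le (Eventually.of_forall fun y _ => by
    by_cases hy : y ∈ U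
    · rw [indicator_of_mem hy]; exact hC y hy
    · rw [indicator_of_notMem hy, norm_zero]; exact hC0)
  have hdφ : Continuous fun x => fderiv ℝ φ x ei :=
    (h1.continuous_fderiv (by simp)).clm_apply continuous_const
  obtain ⟨A, hA⟩ := h1.continuous.bounded_above_of_compact_support h2
  obtain ⟨B, hB⟩ := hdφ.bounded_above_of_compact_support (h2.fderiv_apply ℝ ei)
  have hA0 : 0 ≤ A := (norm_nonneg _).trans (hA x₀)
  have hB0 : 0 ≤ B := (norm_nonneg _).trans (hB x₀)
  have hφ0 : ∀ x ∉ tsupport φ, φ x = 0 := fun x hx => image_eq_zero_of_notMem_tsupport hx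
  have hdφ0 : ∀ x ∉ tsupport φ, fderiv ℝ φ x ei = 0 := fun x hx => by
    rw [fderiv_eq_zero_of_notMem_tsupport hx]; rfl
  -- The factor `2` leaves room for difference quotients, which also involve the mollification at
  -- points near `x`.
  have hball := eventually_closedBall_subset hU (show IsCompact (tsupport φ) from h2) h3 2
  have hgrad : ∀ᶠ n in atTop, ∀ x ∈ tsupport φ, ‖fderiv ℝ (w n) x ei‖ ≤ 1 ∧
      fderiv ℝ (w n) x ei = mollify n (U.indicator Gi) x := by
    filter_upwards [hball] with n hn x hx
    have hr := (bump n).rOut_pos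
    constructor
    · refine (ContinuousLinearMap.le_opNorm _ _).trans ?_
      rw [hei1, mul_one]
      refine norm_fderiv_le_of_lip' ℝ zero_le_one ?_
      filter_upwards [Metric.ball_mem_nhds x hr] with y hy
      rw [one_mul]
      refine norm_mollify_sub_le (hloc u hui) fun t ht => ?_
      have hmem : ∀ z ∈ Metric.closedBall x (bump n).rOut,
          z - t ∈ Metric.closedBall x (2 * (bump n).rOut) := by
        intro z hz
        rw [mem_closedBall_iff_norm] at *
        rw [sub_zero] at ht
        have : z - t - x = (z - x) - t := by abel
        rw [this]
        linarith [norm_sub_le (z - x) t]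
      have hy' := hmem y (Metric.ball_subset_closedBall hy)
      have hx' := hmem x (Metric.mem_closedBall_self hr.le)
      have hs := ((convex_closedBall x (2 * (bump n).rOut)).segment_subset hy' hx').trans (hn x hx)
      rw [indicator_of_mem (hn x hx hy'), indicator_of_mem (hn x hx hx')]
      have := hu _ _ hs
      rwa [sub_sub_sub_cancel_right] at this
    · exact fderiv_mollify hU hui hGi
        ((Metric.closedBall_subset_closedBall (by linarith)).trans (hn x hx))
  have hfd : ∀ n x, fderiv ℝ (fun x => φ x • w n x) x ei
      = φ x • fderiv ℝ (w n) x ei + fderiv ℝ φ x ei • w n x := by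
    intro n x
    have hφd := (h1.differentiable (by simp)).differentiableAt (x := x)
    have hwd := ((hws n).differentiable (by simp)).differentiableAt (x := x)
    rw [fderiv_fun_smul hφd hwd]
    simp
  have hsupp : ∀ n, tsupport (fun x => φ x • w n x) ⊆ tsupport φ := fun n =>
    closure_mono fun x hx => by
      rw [Function.mem_support] at *
      intro e
      exact hx (by simp [e])
  have hid : ∀ n, ∫ x in U, inner ℝ (φ x • fderiv ℝ (w n) x ei + fderiv ℝ φ x ei • w n x) (g x)
      = -∫ x in U, inner ℝ (φ x • w n x) (h x) := by
    intro n
    have := hg.integral_inner (Ψ := fun x => φ x • w n x) (h1.smul (hws n))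
      (h2.of_isClosed_subset (isClosed_tsupport _) (hsupp n)) ((hsupp n).trans h3)
    simpa only [← hei, hfd] using this
  have hcu : ∀ᵐ x ∂(volume.restrict U), Tendsto (fun n => w n x) atTop (𝓝 (u x)) := by
    rw [ae_restrict_iff' hU.measurableSet]
    filter_upwards [ae_tendsto_mollify (hloc u hui)] with x hx hxU
    rwa [indicator_of_mem hxU] at hx
  have hcG : ∀ᵐ x ∂(volume.restrict U),
      Tendsto (fun n => φ x • fderiv ℝ (w n) x ei) atTop (𝓝 (φ x • Gi x)) := by
    rw [ae_restrict_iff' hU.measurableSet]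
    filter_upwards [ae_tendsto_mollify (hloc Gi hGint)] with x hx hxU
    rw [indicator_of_mem hxU] at hx
    by_cases hxs : x ∈ tsupport φ
    · refine (hx.congr' ?_).const_smul (φ x)
      filter_upwards [hgrad] with n hn
      exact (hn x hxs).2.symm
    · simp only [hφ0 x hxs, zero_smul]; exact tendsto_const_nhds
  have hL := tendsto_integral_filter_of_dominated_convergence (μ := volume.restrict U)
    (l := atTop)
    (F := fun n x => inner ℝ (φ x • fderiv ℝ (w n) x ei + fderiv ℝ φ x ei • w n x) (g x))
    (f := fun x => inner ℝ (φ x • Gi x + fderiv ℝ φ x ei • u x) (g x))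
    (fun x => (A + B * C) * ‖g x‖)
    (Eventually.of_forall fun n => by
      refine AEStronglyMeasurable.inner (Continuous.aestronglyMeasurable ?_) hgi.aestronglyMeasurable
      have hc1 : Continuous fun x => fderiv ℝ (w n) x ei :=
        ((hws n).continuous_fderiv (by simp)).clm_apply continuous_const
      exact (h1.continuous.smul hc1).add (hdφ.smul (hws n).continuous))
    (by
      filter_upwards [hgrad] with n hn
      refine Eventually.of_forall fun x => (norm_inner_le_norm _ _).trans
        (mul_le_mul_of_nonneg_right ?_ (norm_nonneg _))
      refine (norm_add_le _ _).trans (add_le_add ?_ ?_)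
      · by_cases hxs : x ∈ tsupport φ
        · rw [norm_smul]
          calc ‖φ x‖ * ‖fderiv ℝ (w n) x ei‖ ≤ A * 1 :=
                mul_le_mul (hA x) (hn x hxs).1 (norm_nonneg _) hA0
            _ = A := mul_one A
        · rw [hφ0 x hxs, zero_smul, norm_zero]; exact hA0
      · rw [norm_smul]
        exact mul_le_mul (hB x) (hwC n x) (norm_nonneg _) hB0)
    (hgi.norm.const_mul _)
    (by
      filter_upwards [hcu, hcG] with x hx hx'
      exact (hx'.add (hx.const_smul _)).inner tendsto_const_nhds)
  have hR := tendsto_integral_filter_of_dominated_convergence (μ := volume.restrict U)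
    (l := atTop)
    (F := fun n x => inner ℝ (φ x • w n x) (h x)) (f := fun x => inner ℝ (φ x • u x) (h x))
    (fun x => (A * C) * ‖h x‖)
    (Eventually.of_forall fun n => by
      refine AEStronglyMeasurable.inner (Continuous.aestronglyMeasurable ?_) hhi.aestronglyMeasurable
      exact h1.continuous.smul (hws n).continuous)
    (Eventually.of_forall fun n => Eventually.of_forall fun x => (norm_inner_le_norm _ _).trans
        (mul_le_mul_of_nonneg_right (by
          rw [norm_smul]
          exact mul_le_mul (hA x) (hwC n x) (norm_nonneg _) hA0) (norm_nonneg _)))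
    (hhi.norm.const_mul _)
    (by
      filter_upwards [hcu] with x hx
      exact (hx.const_smul _).inner tendsto_const_nhds)
  simp only [hid] at hL
  exact tendsto_nhds_unique hL hR.neg

/-- Lipschitz functions have bounded weak derivatives. -/
theorem exists_hasWeakPartial_of_lipschitz (hU : IsOpen U) {u : Plane → Space} {C : ℝ≥0}
    (hu : LipschitzOnWith C u U) (i : Fin 2) : ∃ g : Plane → Space, HasWeakPartial U i u g := by
  -- The coordinates extend to Lipschitz functions on the whole plane, whose line derivatives are
  -- bounded and satisfy the integration by parts formula.
  have hk : ∀ k : Fin 3, ∃ F : Plane → ℝ, LipschitzWith C F ∧ EqOn (fun x => u x k) F U := by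
    intro k
    refine LipschitzOnWith.extend_real (LipschitzOnWith.of_dist_le_mul fun x hx y hy => ?_)
    refine le_trans ?_ (hu.dist_le_mul x hx y hy)
    rw [dist_eq_norm, dist_eq_norm]
    have := PiLp.norm_apply_le (u x - u y) k
    simpa using this
  choose F hF hFe using hk
  set ei : Plane := EuclideanSpace.single i 1 with hei
  set g : Plane → Space := fun x => WithLp.toLp 2 fun k => lineDeriv ℝ (F k) x ei with hg
  have hgm : Measurable g := by
    refine (WithLp.measurable_toLp 2 _).comp (measurable_pi_lambda _ fun k => ?_)
    exact measurable_lineDeriv (hF k).continuous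
  have hgb : ∀ k x, ‖g x k‖ ≤ C * ‖ei‖ := fun k x => norm_lineDeriv_le_of_lipschitz ℝ (hF k)
  have hgl : LocallyIntegrable g volume := by
    have hb : ∀ x, ‖g x‖ ≤ 3 * (C * ‖ei‖) := by
      intro x
      refine (norm_le_sum_norm (g x)).trans ((Finset.sum_le_sum fun k _ => hgb k x).trans ?_)
      simp
    rw [locallyIntegrable_iff]
    intro K hK
    have : IsFiniteMeasure (volume.restrict K) := ⟨by
      rw [Measure.restrict_apply_univ]; exact hK.measure_lt_top⟩
    exact Integrable.of_bound hgm.aestronglyMeasurable _ (Eventually.of_forall hb)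
  refine ⟨g, hu.continuousOn.locallyIntegrableOn hU.measurableSet, hgl.locallyIntegrableOn U,
    fun φ h1 h2 h3 => ?_⟩
  have hdφ : Continuous fun x => fderiv ℝ φ x ei :=
    (h1.continuous_fderiv (by simp)).clm_apply continuous_const
  have hdφ0 : ∀ x ∉ tsupport φ, fderiv ℝ φ x ei = 0 := fun x hx => by
    rw [fderiv_eq_zero_of_notMem_tsupport hx]; rfl
  have hi1 : Integrable (fun x => fderiv ℝ φ x ei • u x) (volume.restrict U) :=
    (integrable_smul_of_locallyIntegrableOn h2 h3 hdφ hdφ0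
      (hu.continuousOn.locallyIntegrableOn hU.measurableSet)).integrableOn
  have hi2 : Integrable (fun x => φ x • g x) (volume.restrict U) :=
    (integrable_smul_of_locallyIntegrableOn h2 h3 h1.continuous
      (fun x hx => image_eq_zero_of_notMem_tsupport hx) (hgl.locallyIntegrableOn U)).integrableOn
  ext k
  obtain ⟨D, hD⟩ := ContDiff.lipschitzWith_of_hasCompactSupport h2 h1 (by simp)
  have hmain := (hF k).integral_lineDeriv_mul_eq (μ := volume) hD h2 ei
  have e1 : (∫ x in U, fderiv ℝ φ x ei • u x) k = ∫ x, fderiv ℝ φ x ei * F k x := by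
    have := (EuclideanSpace.proj k : Space →L[ℝ] ℝ).integral_comp_comm hi1
    rw [show (∫ x in U, fderiv ℝ φ x ei • u x) k
      = (EuclideanSpace.proj k : Space →L[ℝ] ℝ) (∫ x in U, fderiv ℝ φ x ei • u x) from rfl, ← this,
      ← setIntegral_eq_integral_of_forall_compl_eq_zero (s := U)
        (f := fun x => fderiv ℝ φ x ei * F k x)
        (fun x hx => by rw [hdφ0 x fun h => hx (h3 h), zero_mul])]
    refine setIntegral_congr_fun hU.measurableSet fun x hx => ?_
    have := hFe k hx
    simp only at this
    simp [this]
  have e2 : (∫ x in U, φ x • g x) k = ∫ x, lineDeriv ℝ (F k) x ei * φ x := by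
    have := (EuclideanSpace.proj k : Space →L[ℝ] ℝ).integral_comp_comm hi2
    rw [show (∫ x in U, φ x • g x) k
      = (EuclideanSpace.proj k : Space →L[ℝ] ℝ) (∫ x in U, φ x • g x) from rfl, ← this,
      ← setIntegral_eq_integral_of_forall_compl_eq_zero (s := U)
        (f := fun x => lineDeriv ℝ (F k) x ei * φ x)
        (fun x hx => by rw [image_eq_zero_of_notMem_tsupport fun h => hx (h3 h), mul_zero])]
    refine setIntegral_congr_fun hU.measurableSet fun x hx => ?_
    simp [hg, mul_comm]
  rw [PiLp.neg_apply, e1, e2, hmain, ← integral_neg]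
  congr 1
  ext1 x
  rw [((h1.differentiable (by simp)).differentiableAt).lineDeriv_eq_fderiv, map_neg]
  ring

end Representative

end Folding

namespace Folding

/-! ### Weak convergence in `L²` -/

section WeakConvergence

/-- Bounded families in a Hilbert space converge weakly along ultrafilters. -/
theorem exists_weak_limit {E : Type*} [NormedAddCommGroup E] [InnerProductSpace ℝ E]
    [CompleteSpace E] {ι : Type*} (𝒰 : Ultrafilter ι) (x : ι → E) {C : ℝ}
    (hC : ∀ᶠ m in (𝒰 : Filter ι), ‖x m‖ ≤ C) :
    ∃ x₀ : E, ∀ y : E, Tendsto (fun m => inner ℝ y (x m)) 𝒰 (𝓝 (inner ℝ y x₀)) := by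
  have hC0 : 0 ≤ C := by
    obtain ⟨m, hm⟩ := hC.exists
    exact (norm_nonneg _).trans hm
  -- The scalar products are bounded, so they converge along the ultrafilter. Their limits form a
  -- bounded linear functional of `y`, which is represented by a vector.
  have hlim : ∀ y : E, ∃ a ∈ Icc (-(‖y‖ * C)) (‖y‖ * C),
      Tendsto (fun m => inner ℝ y (x m)) 𝒰 (𝓝 a) := by
    intro y
    refine isCompact_Icc.ultrafilter_le_nhds (𝒰.map fun m => inner ℝ y (x m)) ?_
    rw [le_principal_iff]
    change ∀ᶠ m in (𝒰 : Filter ι), _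
    filter_upwards [hC] with m hm
    exact abs_le.1 ((abs_real_inner_le_norm _ _).trans
      (mul_le_mul_of_nonneg_left hm (norm_nonneg _)))
  choose ℓ hℓ hT using hlim
  let Λ : E →ₗ[ℝ] ℝ :=
    { toFun := ℓ
      map_add' := fun y z => tendsto_nhds_unique (hT (y + z))
        (by simpa only [inner_add_left] using (hT y).add (hT z))
      map_smul' := fun a y => tendsto_nhds_unique (hT (a • y))
        (by simpa only [real_inner_smul_left, RingHom.id_apply, smul_eq_mul] using (hT y).const_mul a) }
  let Λ' : E →L[ℝ] ℝ := Λ.mkContinuous C fun y => by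
    rw [mul_comm]; exact abs_le.2 (hℓ y)
  refine ⟨(InnerProductSpace.toDual ℝ E).symm Λ', fun y => ?_⟩
  rw [real_inner_comm, InnerProductSpace.toDual_symm_apply]
  exact hT y

variable {μ : Measure Plane}

theorem integral_inner_eq_toLp {f g : Plane → Space} (hf : MemLp f 2 μ) (hg : MemLp g 2 μ) :
    ∫ x, inner ℝ (f x) (g x) ∂μ = inner ℝ (hf.toLp f) (hg.toLp g) := by
  rw [L2.inner_def]
  refine integral_congr_ae ?_
  filter_upwards [hf.coeFn_toLp, hg.coeFn_toLp] with x h1 h2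
  rw [h1, h2]

theorem integrable_inner {f g : Plane → Space} (hf : MemLp f 2 μ) (hg : MemLp g 2 μ) :
    Integrable (fun x => inner ℝ (f x) (g x)) μ := by
  refine (L2.integrable_inner (𝕜 := ℝ) (hf.toLp f) (hg.toLp g)).congr ?_
  filter_upwards [hf.coeFn_toLp, hg.coeFn_toLp] with x h1 h2
  rw [h1, h2]

theorem abs_integral_inner_le {f g : Plane → Space} (hf : MemLp f 2 μ) (hg : MemLp g 2 μ) :
    |∫ x, inner ℝ (f x) (g x) ∂μ| ≤ (eLpNorm f 2 μ).toReal * (eLpNorm g 2 μ).toReal := by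
  rw [integral_inner_eq_toLp hf hg, ← Lp.norm_toLp f hf, ← Lp.norm_toLp g hg]
  exact abs_real_inner_le_norm _ _

/-- Weak convergence in `L²` along a filter. -/
def WeakTendsto (μ : Measure Plane) (l : Filter ℕ) (F : ℕ → Plane → Space) (F₀ : Plane → Space) :
    Prop :=
  ∀ ψ : Plane → Space, MemLp ψ 2 μ →
    Tendsto (fun m => ∫ x, inner ℝ (ψ x) (F m x) ∂μ) l (𝓝 (∫ x, inner ℝ (ψ x) (F₀ x) ∂μ))

theorem exists_weakTendsto (𝒰 : Ultrafilter ℕ) {F : ℕ → Plane → Space}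
    (hF : ∀ m, MemLp (F m) 2 μ) {C : ℝ≥0} (hC : ∀ᶠ m in (𝒰 : Filter ℕ), eLpNorm (F m) 2 μ ≤ C) :
    ∃ F₀ : Plane → Space, MemLp F₀ 2 μ ∧ WeakTendsto μ 𝒰 F F₀ := by
  obtain ⟨x₀, hx₀⟩ := exists_weak_limit 𝒰 (fun m => (hF m).toLp (F m)) (C := C) (by
    filter_upwards [hC] with m hm
    rw [Lp.norm_toLp]
    exact ENNReal.toReal_le_coe_of_le_coe hm)
  refine ⟨x₀, Lp.memLp x₀, fun ψ hψ => ?_⟩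
  have := hx₀ (hψ.toLp ψ)
  rw [integral_inner_eq_toLp hψ (Lp.memLp x₀), Lp.toLp_coeFn]
  exact this.congr fun m => (integral_inner_eq_toLp hψ (hF m)).symm

theorem WeakTendsto.of_strong {l : Filter ℕ} {F : ℕ → Plane → Space} {F₀ : Plane → Space}
    (hF : ∀ m, MemLp (F m) 2 μ) (hF₀ : MemLp F₀ 2 μ)
    (h : Tendsto (fun m => eLpNorm (F m - F₀) 2 μ) l (𝓝 0)) : WeakTendsto μ l F F₀ := by
  intro ψ hψ
  rw [← tendsto_sub_nhds_zero_iff]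
  have h1 : Tendsto (fun m => (eLpNorm ψ 2 μ).toReal * (eLpNorm (F m - F₀) 2 μ).toReal) l (𝓝 0) := by
    have := (ENNReal.tendsto_toReal ENNReal.zero_ne_top).comp h
    simpa using this.const_mul (eLpNorm ψ 2 μ).toReal
  refine squeeze_zero_norm (fun m => ?_) h1
  rw [← integral_sub (integrable_inner hψ (hF m)) (integrable_inner hψ hF₀)]
  refine le_trans (le_of_eq ?_) (abs_integral_inner_le hψ ((hF m).sub hF₀))
  rw [Real.norm_eq_abs]
  congr 2
  ext1 x
  rw [Pi.sub_apply, inner_sub_right]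

/-- Pairings of strongly and weakly convergent sequences converge. -/
theorem WeakTendsto.inner_strong {l : Filter ℕ} {F : ℕ → Plane → Space} {F₀ : Plane → Space}
    (hF : WeakTendsto μ l F F₀) (hFm : ∀ m, MemLp (F m) 2 μ)
    {C : ℝ≥0} (hC : ∀ᶠ m in l, eLpNorm (F m) 2 μ ≤ C) {ψ : ℕ → Plane → Space}
    {ψ₀ : Plane → Space} (hψ : ∀ᶠ m in l, MemLp (ψ m) 2 μ) (hψ₀ : MemLp ψ₀ 2 μ)
    (h : Tendsto (fun m => eLpNorm (ψ m - ψ₀) 2 μ) l (𝓝 0)) :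
    Tendsto (fun m => ∫ x, inner ℝ (ψ m x) (F m x) ∂μ) l (𝓝 (∫ x, inner ℝ (ψ₀ x) (F₀ x) ∂μ)) := by
  have h2 : Tendsto (fun m => ∫ x, inner ℝ (ψ m x) (F m x) ∂μ - ∫ x, inner ℝ (ψ₀ x) (F m x) ∂μ) l
      (𝓝 0) := by
    have h1 : Tendsto (fun m => (eLpNorm (ψ m - ψ₀) 2 μ).toReal * (C : ℝ)) l (𝓝 0) := by
      have := (ENNReal.tendsto_toReal ENNReal.zero_ne_top).comp h
      simpa using this.mul_const (C : ℝ)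
    refine squeeze_zero_norm' ?_ h1
    filter_upwards [hC, hψ] with m hm hψm
    rw [← integral_sub (integrable_inner hψm (hFm m)) (integrable_inner hψ₀ (hFm m))]
    have h3 := abs_integral_inner_le (hψm.sub hψ₀) (hFm m)
    refine le_trans (le_of_eq ?_) (h3.trans (mul_le_mul_of_nonneg_left
      (ENNReal.toReal_le_coe_of_le_coe hm) ENNReal.toReal_nonneg))
    rw [Real.norm_eq_abs]
    congr 2
    ext1 x
    rw [Pi.sub_apply, inner_sub_left]
  have := h2.add (hF ψ₀ hψ₀)
  simpa using this

theorem integral_norm_sq_eq {f : Plane → Space} (hf : MemLp f 2 μ) :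
    ∫⁻ x, ‖f x‖ₑ ^ 2 ∂μ = ENNReal.ofReal (∫ x, inner ℝ (f x) (f x) ∂μ) := by
  rw [ofReal_integral_eq_lintegral_ofReal (integrable_inner hf hf)
    (Eventually.of_forall fun x => real_inner_self_nonneg)]
  refine lintegral_congr fun x => ?_
  rw [real_inner_self_eq_norm_sq, ENNReal.ofReal_pow (norm_nonneg _), ofReal_norm]

/-- Lower semicontinuity of the `L²` norm of finite families under weak convergence. -/
theorem WeakTendsto.lintegral_sum_le {ι : Type*} [Fintype ι] {l : Filter ℕ} [l.NeBot]
    {F : ι → ℕ → Plane → Space} {F₀ : ι → Plane → Space} (hF : ∀ a, WeakTendsto μ l (F a) (F₀ a))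
    (hFm : ∀ a m, MemLp (F a m) 2 μ) (hF₀ : ∀ a, MemLp (F₀ a) 2 μ) {A : ℝ≥0∞} (hA : A ≠ ∞)
    (hle : ∀ᶠ m in l, ∑ a, ∫⁻ x, ‖F a m x‖ₑ ^ 2 ∂μ ≤ A) :
    ∑ a, ∫⁻ x, ‖F₀ a x‖ₑ ^ 2 ∂μ ≤ A := by
  have hsum : ∀ f : ι → Plane → Space, (∀ a, MemLp (f a) 2 μ) →
      ∑ a, ∫⁻ x, ‖f a x‖ₑ ^ 2 ∂μ = ENNReal.ofReal (∑ a, ∫ x, inner ℝ (f a x) (f a x) ∂μ) := by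
    intro f hf
    rw [ENNReal.ofReal_sum_of_nonneg fun a _ => integral_nonneg fun x => real_inner_self_nonneg]
    exact Finset.sum_congr rfl fun a _ => integral_norm_sq_eq (hf a)
  set S := ∑ a, ∫ x, inner ℝ (F₀ a x) (F₀ a x) ∂μ with hS
  have hT : Tendsto (fun m => ∑ a, ∫ x, inner ℝ (F₀ a x) (F a m x) ∂μ) l (𝓝 S) :=
    tendsto_finsetSum _ fun a _ => hF a (F₀ a) (hF₀ a)
  -- Twice a scalar product is at most the sum of the squared norms. In the limit this reads `S ≤ (S
  -- + A) / 2`.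
  have hb : ∀ᶠ m in l, ∑ a, ∫ x, inner ℝ (F₀ a x) (F a m x) ∂μ ≤ (S + A.toReal) / 2 := by
    filter_upwards [hle] with m hm
    rw [hsum (fun a => F a m) fun a => hFm a m, ← ENNReal.ofReal_toReal hA,
      ENNReal.ofReal_le_ofReal_iff ENNReal.toReal_nonneg] at hm
    have h1 : ∀ a, ∫ x, inner ℝ (F₀ a x) (F a m x) ∂μ ≤
        (∫ x, inner ℝ (F₀ a x) (F₀ a x) ∂μ + ∫ x, inner ℝ (F a m x) (F a m x) ∂μ) / 2 := by
      intro a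
      rw [← integral_add (integrable_inner (hF₀ a) (hF₀ a)) (integrable_inner (hFm a m) (hFm a m)),
        ← integral_div]
      refine integral_mono (integrable_inner (hF₀ a) (hFm a m))
        (((integrable_inner (hF₀ a) (hF₀ a)).add (integrable_inner (hFm a m) (hFm a m))).div_const 2)
        fun x => ?_
      have h2 := real_inner_self_nonneg (x := F₀ a x - F a m x)
      rw [inner_sub_left, inner_sub_right, inner_sub_right,
        real_inner_comm (F₀ a x) (F a m x)] at h2
      simp only
      linarith
    calc ∑ a, ∫ x, inner ℝ (F₀ a x) (F a m x) ∂μ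
        ≤ ∑ a, (∫ x, inner ℝ (F₀ a x) (F₀ a x) ∂μ + ∫ x, inner ℝ (F a m x) (F a m x) ∂μ) / 2 :=
          Finset.sum_le_sum fun a _ => h1 a
      _ = (S + ∑ a, ∫ x, inner ℝ (F a m x) (F a m x) ∂μ) / 2 := by
          rw [← Finset.sum_div, Finset.sum_add_distrib]
      _ ≤ (S + A.toReal) / 2 := by linarith
  have := le_of_tendsto hT hb
  rw [hsum F₀ hF₀, ← ENNReal.ofReal_toReal hA]
  exact ENNReal.ofReal_le_ofReal (by linarith)

end WeakConvergence

end Folding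

namespace Folding

/-! ### Limits of sequences of isometries -/

section Points

variable {U : Set Plane} {v f : Plane → Space} {p : Plane}

/-- A continuous representative of a function that is continuous in `p` has a limit in `p`. -/
theorem ContinuousInPoint.exists_tendsto (hU : IsOpen U) (hf : ContinuousOn f U)
    (hfv : f =ᵐ[volume.restrict U] v) (h : ContinuousInPoint U v p) :
    ∃ y, Tendsto f (𝓝[U] p) (𝓝 y) := by
  obtain ⟨y, hy⟩ := h
  refine ⟨y, ?_⟩
  rw [Metric.tendsto_nhds]
  intro ε hε
  have h1 : ∀ᶠ x in 𝓝 p ⊓ ae (volume.restrict U), v x ∈ Metric.closedBall y (ε / 2) :=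
    hy (Metric.closedBall_mem_nhds y (by linarith))
  rw [eventually_inf] at h1
  obtain ⟨s, hs, t, ht, hst⟩ := h1
  obtain ⟨O, hOs, hO, hpO⟩ := mem_nhds_iff.1 hs
  filter_upwards [self_mem_nhdsWithin, mem_nhdsWithin_of_mem_nhds (hO.mem_nhds hpO)] with x hxU hxO
  refine lt_of_le_of_lt ?_ (half_lt_self hε)
  have hcont : ContinuousAt f x := hf.continuousAt (hU.mem_nhds hxU)
  -- Otherwise `f` would be outside the closed ball on a neighbourhood of `x`, which has positive
  -- measure, although `f` agrees with `v` almost everywhere.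
  refine (Metric.isClosed_closedBall (x := y) (ε := ε / 2)).mem_of_frequently_of_tendsto ?_ hcont
  rw [Filter.Frequently]
  intro hev
  obtain ⟨W, hWsub, hW, hxW⟩ := mem_nhds_iff.1
    (inter_mem hev ((hU.inter hO).mem_nhds ⟨hxU, hxO⟩))
  have hpos := hW.measure_pos volume ⟨x, hxW⟩
  have hnull : ∀ᵐ z ∂(volume.restrict U), z ∉ W := by
    filter_upwards [ht, hfv] with z hzt hz hzW
    obtain ⟨h2, h3⟩ := hWsub hzW
    apply h2
    rw [hz]
    exact hst z ⟨hOs h3.2, hzt⟩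
  rw [ae_restrict_iff' hU.measurableSet] at hnull
  refine hpos.ne' (measure_mono_null (fun z hz => ?_) hnull)
  exact fun hn => hn (hWsub hz).2.1 hz

theorem ContinuousInPoint.of_tendsto (hU : IsOpen U) (hfv : f =ᵐ[volume.restrict U] v) {y : Space}
    (h : Tendsto f (𝓝[U] p) (𝓝 y)) : ContinuousInPoint U v p := by
  refine ⟨y, ?_⟩
  have hle : 𝓝 p ⊓ ae (volume.restrict U) ≤ 𝓝[U] p :=
    inf_le_inf_left _ (le_principal_iff.2 (ae_restrict_mem hU.measurableSet))
  refine (h.mono_left hle).congr' ?_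
  exact hfv.filter_mono inf_le_right

end Points

/-- A sequence of maps off the fattened creases that do not increase lengths, have limits in the
vertices of the polygonal creases, and are uniformly bounded. -/
structure SheetSequence (ω ω₁ ω₂ : Set Plane) (b : ℝ → Plane) (α β : ℝ) (M : ℕ → CreaseMesh)
    (f : ℕ → Plane → Space) (C : ℝ) : Prop where
  creased : IsCreased ω ω₁ ω₂ b α β
  adm : ∀ m, (M m).IsAdmissible ω ω₁ ω₂ b α β
  regular : ShapeRegular M
  size : VanishingMeshSize M
  segLip : ∀ m, SegLip (ω \ (M m).fatCrease) (f m)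
  limit : ∀ m i, ∃ y, Tendsto (f m) (𝓝[ω \ (M m).fatCrease] (b ((M m).node i))) (𝓝 y)
  bound : ∀ᶠ m in atTop, ∀ x ∈ ω \ (M m).fatCrease, ‖f m x‖ ≤ C

theorem isPinned_coord {M : CreaseMesh} {ω : Set Plane} {b : ℝ → Plane} {f : Plane → Space}
    (hf : SegLip (ω \ M.fatCrease) f)
    (hl : ∀ i, ∃ y, Tendsto f (𝓝[ω \ M.fatCrease] (b (M.node i))) (𝓝 y)) (k : Fin 3) :
    IsPinned M ω b fun x => f x k := by
  refine ⟨hf.coord k, fun i => ?_⟩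
  obtain ⟨y, hy⟩ := hl i
  exact ⟨y k, ((EuclideanSpace.proj k : Space →L[ℝ] ℝ).continuous.tendsto y).comp hy⟩

/-! ### Extension across the crease -/

section Topology

variable {ω ω₁ ω₂ : Set Plane} {b : ℝ → Plane} {α β : ℝ}

theorem IsCreased.isOpen_diff (hω : IsCreased ω ω₁ ω₂ b α β) : IsOpen (ω \ b '' Icc α β) :=
  hω.lipschitz.isOpen.sdiff hω.isCompact_crease.isClosed

theorem IsCreased.subset_closure_diff (hω : IsCreased ω ω₁ ω₂ b α β) :
    ω ⊆ closure (ω \ b '' Icc α β) := by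
  intro x hx
  rw [mem_closure_iff]
  intro O hO hxO
  have hpos : 0 < volume (O ∩ ω) := (hO.inter hω.lipschitz.isOpen).measure_pos volume ⟨x, hxO, hx⟩
  have hns : ¬ O ∩ ω ⊆ b '' Icc α β := fun h =>
    hpos.ne' (measure_mono_null h hω.volume_crease)
  obtain ⟨z, hz, hzγ⟩ := not_subset.1 hns
  exact ⟨z, hz.1, hz.2, hzγ⟩

/-- A function that is Lipschitz along segments of `ω` with end points off the crease extends to
a Lipschitz function on `ω`. -/
theorem IsCreased.exists_lipschitz_extension (hω : IsCreased ω ω₁ ω₂ b α β) {u₀ : Plane → Space}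
    {K : ℝ} (hK : 0 < K) (hu : ∀ x ∈ ω \ b '' Icc α β, ∀ y ∈ ω \ b '' Icc α β,
      segment ℝ x y ⊆ ω → ‖u₀ x - u₀ y‖ ≤ K * ‖x - y‖) :
    ∃ (u : Plane → Space) (C : ℝ≥0), LipschitzOnWith C u ω ∧ EqOn u u₀ (ω \ b '' Icc α β) := by
  set A := ω \ b '' Icc α β with hA
  have hAo : IsOpen A := hω.isOpen_diff
  have hdense := hω.subset_closure_diff
  -- Small balls in `ω` are convex, so `hu` applies to all their points off the crease and makes the
  -- values Cauchy at every point of `ω`.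
  have hlim : ∀ x ∈ ω, Tendsto u₀ (𝓝[A] x) (𝓝 (extendFrom A u₀ x)) := by
    intro x hx
    refine tendsto_extendFrom ?_
    have : (𝓝[A] x).NeBot := mem_closure_iff_nhdsWithin_neBot.1 (hdense hx)
    refine cauchy_map_iff_exists_tendsto.1 ?_
    obtain ⟨r, hr, hball⟩ := Metric.isOpen_iff.1 hω.lipschitz.isOpen x hx
    rw [Metric.cauchy_iff]
    refine ⟨this.map _, fun ε hε => ?_⟩
    set δ := min r (ε / (4 * K)) with hδ
    have hδ0 : 0 < δ := lt_min hr (by positivity)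
    refine ⟨u₀ '' (A ∩ Metric.ball x δ), image_mem_map (inter_mem self_mem_nhdsWithin
      (mem_nhdsWithin_of_mem_nhds (Metric.ball_mem_nhds x hδ0))), ?_⟩
    rintro _ ⟨y, ⟨hyA, hy⟩, rfl⟩ _ ⟨z, ⟨hzA, hz⟩, rfl⟩
    have hseg : segment ℝ y z ⊆ ω :=
      ((convex_ball x δ).segment_subset hy hz).trans
        ((Metric.ball_subset_ball (min_le_left _ _)).trans hball)
    rw [dist_eq_norm]
    refine (hu y hyA z hzA hseg).trans_lt ?_
    have h1 : ‖y - z‖ < 2 * (ε / (4 * K)) := by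
      rw [← dist_eq_norm]
      have h2 := dist_triangle_right y z x
      have h3 : dist y x < ε / (4 * K) := lt_of_lt_of_le hy (min_le_right _ _)
      have h4 : dist z x < ε / (4 * K) := lt_of_lt_of_le hz (min_le_right _ _)
      linarith
    calc K * ‖y - z‖ < K * (2 * (ε / (4 * K))) := mul_lt_mul_of_pos_left h1 hK
      _ = ε / 2 := by field_simp; ring
      _ < ε := by linarith
  have hEq : EqOn (extendFrom A u₀) u₀ A := by
    intro x hx
    refine extendFrom_eq (subset_closure hx) ?_
    obtain ⟨r, hr, hball⟩ := Metric.isOpen_iff.1 hAo x hx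
    rw [Metric.tendsto_nhdsWithin_nhds]
    intro ε hε
    refine ⟨min r (ε / K), lt_min hr (by positivity), fun {y} hyA hy => ?_⟩
    have hseg : segment ℝ y x ⊆ ω :=
      ((convex_ball x r).segment_subset (lt_of_lt_of_le hy (min_le_left _ _) : y ∈ Metric.ball x r)
        (Metric.mem_ball_self hr)).trans (hball.trans sdiff_subset)
    rw [dist_eq_norm]
    refine (hu y hyA x hx hseg).trans_lt ?_
    have : ‖y - x‖ < ε / K := by
      rw [← dist_eq_norm]; exact lt_of_lt_of_le hy (min_le_right _ _)
    rwa [lt_div_iff₀ hK, mul_comm] at this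
  -- After scaling by `K⁻¹` the uniform estimate for `ω` applies. Points off the crease close to the
  -- end points of a segment are joined by segments that still lie in `ω`.
  have hseg : SegLip ω fun x => K⁻¹ • extendFrom A u₀ x := by
    intro x y hxy
    have hx := hxy (left_mem_segment ℝ x y)
    have hy := hxy (right_mem_segment ℝ x y)
    have hcs : IsCompact (segment ℝ x y) := by
      rw [segment_eq_image_lineMap]
      exact isCompact_Icc.image (by fun_prop)
    obtain ⟨δ, hδ, hsub⟩ := hcs.exists_thickening_subset_open hω.lipschitz.isOpen hxy
    have : (𝓝[A] x).NeBot := mem_closure_iff_nhdsWithin_neBot.1 (hdense hx)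
    have : (𝓝[A] y).NeBot := mem_closure_iff_nhdsWithin_neBot.1 (hdense hy)
    have hT : Tendsto (fun z : Plane × Plane => ‖u₀ z.1 - u₀ z.2‖) (𝓝[A] x ×ˢ 𝓝[A] y)
        (𝓝 ‖extendFrom A u₀ x - extendFrom A u₀ y‖) :=
      (((hlim x hx).comp tendsto_fst).sub ((hlim y hy).comp tendsto_snd)).norm
    have hT' : Tendsto (fun z : Plane × Plane => K * ‖z.1 - z.2‖) (𝓝[A] x ×ˢ 𝓝[A] y)
        (𝓝 (K * ‖x - y‖)) := by
      have h1 : Tendsto (fun z : Plane => z) (𝓝[A] x) (𝓝 x) := tendsto_id.mono_right nhdsWithin_le_nhds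
      have h2 : Tendsto (fun z : Plane => z) (𝓝[A] y) (𝓝 y) := tendsto_id.mono_right nhdsWithin_le_nhds
      exact ((h1.comp tendsto_fst).sub (h2.comp tendsto_snd)).norm.const_mul K
    have hev : ∀ᶠ z : Plane × Plane in 𝓝[A] x ×ˢ 𝓝[A] y, ‖u₀ z.1 - u₀ z.2‖ ≤ K * ‖z.1 - z.2‖ := by
      have e1 : ∀ᶠ z in 𝓝[A] x, z ∈ A ∧ z ∈ Metric.ball x δ :=
        (eventually_mem_nhdsWithin).and
          (mem_nhdsWithin_of_mem_nhds (Metric.ball_mem_nhds x hδ))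
      have e2 : ∀ᶠ z in 𝓝[A] y, z ∈ A ∧ z ∈ Metric.ball y δ :=
        (eventually_mem_nhdsWithin).and
          (mem_nhdsWithin_of_mem_nhds (Metric.ball_mem_nhds y hδ))
      filter_upwards [e1.prod_mk e2] with z hz
      refine hu _ hz.1.1 _ hz.2.1 (Subset.trans ?_ hsub)
      refine ((convex_segment x y).thickening δ).segment_subset ?_ ?_
      · exact Metric.mem_thickening_iff.2 ⟨x, left_mem_segment ℝ x y, hz.1.2⟩
      · exact Metric.mem_thickening_iff.2 ⟨y, right_mem_segment ℝ x y, hz.2.2⟩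
    have := le_of_tendsto_of_tendsto hT hT' hev
    rw [← smul_sub, norm_smul, Real.norm_of_nonneg (by positivity)]
    rwa [inv_mul_le_iff₀ hK]
  obtain ⟨C, hC⟩ := hω.lipschitz.exists_lipschitz
  have h1 := hC Space _ hseg
  refine ⟨extendFrom A u₀, K.toNNReal * C, LipschitzOnWith.of_dist_le_mul fun x hx y hy => ?_, hEq⟩
  have h2 := h1.dist_le_mul x hx y hy
  rw [dist_smul₀, Real.norm_of_nonneg (by positivity), inv_mul_le_iff₀ hK] at h2
  rw [NNReal.coe_mul, Real.coe_toNNReal K hK.le, mul_assoc]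
  exact h2

end Topology

/-! ### Limits of sheet sequences -/

namespace SheetSequence

variable {ω ω₁ ω₂ : Set Plane} {b : ℝ → Plane} {α β : ℝ} {M : ℕ → CreaseMesh}
  {f : ℕ → Plane → Space} {C : ℝ}

theorem eventually_subset (h : SheetSequence ω ω₁ ω₂ b α β M f C) {K : Set Plane}
    (hK : IsCompact K) (hKs : K ⊆ ω \ b '' Icc α β) :
    ∀ᶠ m in atTop, K ⊆ ω \ (M m).fatCrease := by
  filter_upwards [h.creased.eventually_disjoint_fatCrease h.adm h.size hK
    (disjoint_sdiff_self_left.mono_left hKs)] with m hm x hx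
  exact ⟨(hKs hx).1, fun hf => hm.le_bot ⟨hx, hf⟩⟩

/-- The pointwise limit along an ultrafilter. -/
theorem exists_limit (h : SheetSequence ω ω₁ ω₂ b α β M f C) {𝒰 : Ultrafilter ℕ}
    (h𝒰 : (𝒰 : Filter ℕ) ≤ atTop) :
    ∃ u : Plane → Space, ∀ x ∈ ω \ b '' Icc α β,
      ‖u x‖ ≤ C ∧ Tendsto (fun m => f m x) 𝒰 (𝓝 (u x)) := by
  have key : ∀ x ∈ ω \ b '' Icc α β, ∃ y : Space, ‖y‖ ≤ C ∧ Tendsto (fun m => f m x) 𝒰 (𝓝 y) := by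
    intro x hx
    have hev : ∀ᶠ m in (𝒰 : Filter ℕ), f m x ∈ Metric.closedBall (0 : Space) C := by
      filter_upwards [h𝒰 h.bound, h𝒰 (h.eventually_subset isCompact_singleton
        (singleton_subset_iff.2 hx))] with m h1 h2
      rw [mem_closedBall_zero_iff]
      exact h1 x (h2 rfl)
    obtain ⟨y, hy, hT⟩ := (isCompact_closedBall (0 : Space) C).ultrafilter_le_nhds
      (𝒰.map fun m => f m x) (le_principal_iff.2 hev)
    exact ⟨y, mem_closedBall_zero_iff.1 hy, hT⟩
  choose! u hu using key
  exact ⟨u, hu⟩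

variable {l : Filter ℕ} {u : Plane → Space}

/-- A segment off the crease is compact and eventually avoids the fattened creases. -/
theorem segLip_limit (h : SheetSequence ω ω₁ ω₂ b α β M f C) [l.NeBot] (hl : l ≤ atTop)
    (hu : ∀ x ∈ ω \ b '' Icc α β, Tendsto (fun m => f m x) l (𝓝 (u x))) :
    SegLip (ω \ b '' Icc α β) u := by
  intro x y hxy
  have hcs : IsCompact (segment ℝ x y) := by
    rw [segment_eq_image_lineMap]
    exact isCompact_Icc.image (by fun_prop)
  refine le_of_tendsto ((hu x (hxy (left_mem_segment ℝ x y))).sub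
    (hu y (hxy (right_mem_segment ℝ x y)))).norm ?_
  filter_upwards [hl (h.eventually_subset hcs hxy)] with m hm
  exact h.segLip m x y hm

/-- The limit does not jump across the crease. -/
theorem lipschitz_limit (h : SheetSequence ω ω₁ ω₂ b α β M f C) [l.NeBot] (hl : l ≤ atTop)
    (hu : ∀ x ∈ ω \ b '' Icc α β, Tendsto (fun m => f m x) l (𝓝 (u x))) :
    ∃ K > 0, ∀ x ∈ ω \ b '' Icc α β, ∀ y ∈ ω \ b '' Icc α β,
      segment ℝ x y ⊆ ω → ‖u x - u y‖ ≤ K * ‖x - y‖ := by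
  have hω := h.creased
  have hseg := h.segLip_limit hl hu
  have hpart := hω.partition
  have hs1 : ω₁ ⊆ ω \ b '' Icc α β := by rw [hpart]; exact subset_union_left
  have hs2 : ω₂ ⊆ ω \ b '' Icc α β := by rw [hpart]; exact subset_union_right
  obtain ⟨C₁, hC₁⟩ := hω.lipschitz₁.exists_lipschitz
  obtain ⟨C₂, hC₂⟩ := hω.lipschitz₂.exists_lipschitz
  have hL1 := hC₁ Space u (hseg.mono hs1)
  have hL2 := hC₂ Space u (hseg.mono hs2)
  set K : ℝ := max (C₁ : ℝ) C₂ + 1 with hK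
  have hK0 : 0 < K := by positivity
  have hK1 : ∀ x ∈ ω₁, ∀ y ∈ ω₁, ‖u x - u y‖ ≤ K * ‖x - y‖ := fun x hx y hy => by
    have := hL1.dist_le_mul x hx y hy
    rw [dist_eq_norm, dist_eq_norm] at this
    refine this.trans (mul_le_mul_of_nonneg_right ?_ (norm_nonneg _))
    have := le_max_left (C₁ : ℝ) C₂
    linarith
  have hK2 : ∀ x ∈ ω₂, ∀ y ∈ ω₂, ‖u x - u y‖ ≤ K * ‖x - y‖ := fun x hx y hy => by
    have := hL2.dist_le_mul x hx y hy
    rw [dist_eq_norm, dist_eq_norm] at this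
    refine this.trans (mul_le_mul_of_nonneg_right ?_ (norm_nonneg _))
    have := le_max_right (C₁ : ℝ) C₂
    linarith
  -- The segment contains a point `q` in the closures of both sides. Near it there is a nice point,
  -- and near this there are points `x'`, `y'` of the two sides with almost equal values; the
  -- remaining distances stay within one side each.
  have hcross : ∀ x ∈ ω₁, ∀ y ∈ ω₂, segment ℝ x y ⊆ ω → ‖u x - u y‖ ≤ K * ‖x - y‖ := by
    intro x hx y hy hxy
    obtain ⟨q, hqs, hq1, hq2⟩ := isPreconnected_closed_iff.1
      (convex_segment x y).isPreconnected _ _ isClosed_closure isClosed_closure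
      (show segment ℝ x y ⊆ closure ω₁ ∪ closure ω₂ by
        rw [← closure_union, ← hpart]
        exact hxy.trans hω.subset_closure_diff)
      ⟨x, left_mem_segment ℝ x y, subset_closure hx⟩
      ⟨y, right_mem_segment ℝ x y, subset_closure hy⟩
    have hsum : ‖x - q‖ + ‖q - y‖ = ‖x - y‖ := by
      rw [← dist_eq_norm, ← dist_eq_norm, ← dist_eq_norm]
      exact dist_add_dist_of_mem_segment hqs
    refine le_of_forall_pos_le_add fun ε hε => ?_
    -- Two detours of length `2 * η` cost `4 * K * η`, and the jump costs `2 * η` in each of three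
    -- coordinates.
    set η := ε / (4 * K + 6) with hη
    have hη0 : 0 < η := by positivity
    obtain ⟨p, hpq, hp⟩ := hω.exists_nicePoint (hxy hqs) hq1 hq2 hη0
    obtain ⟨x', hx', y', hy', hxp, hyp, hev⟩ :=
      hp.eventually_near hω h.adm h.size h.regular hη0
    have hmid : ‖u x' - u y'‖ ≤ 6 * η := by
      refine le_of_tendsto ((hu x' (hs1 hx')).sub (hu y' (hs2 hy'))).norm ?_
      filter_upwards [hl hev] with m hm
      refine (norm_le_sum_norm _).trans ?_
      have : ∀ k, ‖(f m x' - f m y') k‖ ≤ 2 * η := fun k =>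
        hm _ (isPinned_coord (h.segLip m) (h.limit m) k)
      refine (Finset.sum_le_sum fun k _ => this k).trans (le_of_eq ?_)
      simp; ring
    have h1 := hK1 x hx x' hx'
    have h2 := hK2 y' hy' y hy
    have d1 : ‖x - x'‖ ≤ ‖x - q‖ + 2 * η := by
      rw [← dist_eq_norm, ← dist_eq_norm]
      have := dist_triangle4 x q p x'
      rw [dist_comm q p, dist_comm p x'] at this
      linarith
    have d2 : ‖y' - y‖ ≤ ‖q - y‖ + 2 * η := by
      rw [← dist_eq_norm, ← dist_eq_norm]
      have := dist_triangle4 y' p q y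
      linarith
    have h3 : ‖u x - u y‖ ≤ ‖u x - u x'‖ + ‖u x' - u y'‖ + ‖u y' - u y‖ := by
      have e : u x - u y = (u x - u x') + (u x' - u y') + (u y' - u y) := by abel
      rw [e]
      exact norm_add₃_le
    have h4 := mul_le_mul_of_nonneg_left d1 hK0.le
    have h5 := mul_le_mul_of_nonneg_left d2 hK0.le
    have h6 : η * (4 * K + 6) = ε := div_mul_cancel₀ _ (by positivity)
    have h7 : K * ‖x - y‖ = K * ‖x - q‖ + K * ‖q - y‖ := by rw [← hsum]; ring
    linarith
  refine ⟨K, hK0, fun x hx y hy hxy => ?_⟩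
  rw [hpart] at hx hy
  rcases hx with hx | hx <;> rcases hy with hy | hy
  · exact hK1 x hx y hy
  · exact hcross x hx y hy hxy
  · rw [norm_sub_rev, norm_sub_rev x y]
    exact hcross y hy x hx (by rwa [segment_symm])
  · exact hK2 x hx y hy

/-- On small balls off the crease all functions are `1`-Lipschitz, so convergence at the centre
controls the whole ball. -/
theorem tendstoLocallyUniformlyOn_limit (h : SheetSequence ω ω₁ ω₂ b α β M f C) [l.NeBot]
    (hl : l ≤ atTop)
    (hu : ∀ x ∈ ω \ b '' Icc α β, Tendsto (fun m => f m x) l (𝓝 (u x))) :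
    TendstoLocallyUniformlyOn f u l (ω \ b '' Icc α β) := by
  have hseg := h.segLip_limit hl hu
  rw [Metric.tendstoLocallyUniformlyOn_iff]
  intro ε hε x hx
  obtain ⟨r, hr, hball⟩ := Metric.nhds_basis_closedBall.mem_iff.1
    (h.creased.isOpen_diff.mem_nhds hx)
  set δ := min r (ε / 4) with hδ
  have hδ0 : 0 < δ := lt_min hr (by linarith)
  refine ⟨Metric.ball x δ, mem_nhdsWithin_of_mem_nhds (Metric.ball_mem_nhds x hδ0), ?_⟩
  filter_upwards [hl (h.eventually_subset (isCompact_closedBall x r) hball),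
    (Metric.tendsto_nhds.1 (hu x hx)) (ε / 4) (by linarith)] with m hm hmx y hy
  have hys : segment ℝ x y ⊆ Metric.closedBall x r :=
    (convex_closedBall x r).segment_subset (Metric.mem_closedBall_self hr.le)
      (Metric.ball_subset_closedBall (Metric.ball_subset_ball (min_le_left _ _) hy))
  have h1 := h.segLip m x y (hys.trans hm)
  have h2 := hseg x y (hys.trans hball)
  have hd : ‖x - y‖ < ε / 4 := by
    rw [← dist_eq_norm, dist_comm]; exact lt_of_lt_of_le hy (min_le_right _ _)
  rw [← dist_eq_norm] at h1 h2
  rw [dist_comm] at h2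
  rw [dist_comm] at hmx
  have := dist_triangle4 (u y) (u x) (f m x) (f m y)
  linarith

/-- Convergence in `L²`. -/
theorem tendsto_eLpNorm (h : SheetSequence ω ω₁ ω₂ b α β M f C) [l.NeBot]
    (hl : l ≤ atTop) (huC : ∀ x ∈ ω \ b '' Icc α β, ‖u x‖ ≤ C)
    (hu : ∀ x ∈ ω \ b '' Icc α β, Tendsto (fun m => f m x) l (𝓝 (u x))) :
    Tendsto (fun m => eLpNorm ((ω \ (M m).fatCrease).indicator (f m) - u) 2 (volume.restrict ω)) l
      (𝓝 0) := by
  have hω := h.creased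
  have hseg := h.segLip_limit hl hu
  set A := ω \ b '' Icc α β with hA
  have hAo : IsOpen A := hω.isOpen_diff
  have hAae : volume.restrict ω = volume.restrict A :=
    (Measure.restrict_congr_set (sdiff_null_ae_eq_self hω.volume_crease)).symm
  have hAfin : volume A < ∞ := (hω.lipschitz.isBounded.subset sdiff_subset).measure_lt_top
  have hC0 : 0 ≤ C := by
    obtain ⟨x, hx⟩ := hω.lipschitz₁.isConnected.nonempty
    exact (norm_nonneg _).trans (huC x (by rw [hA, hω.partition]; exact Or.inl hx))
  have hlu := h.tendstoLocallyUniformlyOn_limit hl hu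
  have hVfin : volume A ^ (2 : ℝ)⁻¹ ≠ ∞ := ENNReal.rpow_ne_top_of_nonneg (by norm_num) hAfin.ne
  rw [ENNReal.tendsto_nhds_zero]
  intro ε hε
  obtain ⟨a, ha0, ha⟩ : ∃ a : ℝ, 0 < a ∧ ENNReal.ofReal a * volume A ^ (2 : ℝ)⁻¹ ≤ ε / 2 := by
    have ht : Tendsto (fun a : ℝ => ENNReal.ofReal a * volume A ^ (2 : ℝ)⁻¹) (𝓝[>] 0) (𝓝 0) := by
      have h1 : Tendsto (fun a : ℝ => ENNReal.ofReal a) (𝓝[>] 0) (𝓝 0) := by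
        have := (ENNReal.continuous_ofReal.tendsto 0).mono_left
          (nhdsWithin_le_nhds (s := Ioi (0 : ℝ)))
        simpa using this
      have := ENNReal.Tendsto.mul_const (b := volume A ^ (2 : ℝ)⁻¹) h1 (Or.inr hVfin)
      simpa using this
    obtain ⟨a, h1, h2⟩ := ((ht.eventually (Iic_mem_nhds (ENNReal.half_pos hε.ne'))).and
      self_mem_nhdsWithin).exists
    exact ⟨a, h2, h1⟩
  obtain ⟨η, hη0, hη⟩ : ∃ η : ℝ≥0∞, η ≠ 0 ∧ ENNReal.ofReal (2 * C) * η ^ (2 : ℝ)⁻¹ ≤ ε / 2 := by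
    have ht : Tendsto (fun η : ℝ≥0∞ => ENNReal.ofReal (2 * C) * η ^ (2 : ℝ)⁻¹) (𝓝[≠] 0) (𝓝 0) := by
      have h1 : Tendsto (fun η : ℝ≥0∞ => η ^ (2 : ℝ)⁻¹) (𝓝[≠] 0) (𝓝 0) := by
        have := ((ENNReal.continuous_rpow_const (y := (2 : ℝ)⁻¹)).tendsto 0).mono_left
          (nhdsWithin_le_nhds (s := {0}ᶜ))
        simpa using this
      have := ENNReal.Tendsto.const_mul (a := ENNReal.ofReal (2 * C)) h1 (Or.inr ENNReal.ofReal_ne_top)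
      simpa using this
    obtain ⟨η, h1, h2⟩ := ((ht.eventually (Iic_mem_nhds (ENNReal.half_pos hε.ne'))).and
      self_mem_nhdsWithin).exists
    exact ⟨η, h2, h1⟩
  -- Convergence is uniform on the compact set `K`; on the rest, of measure below `η`, the
  -- difference is at most `2 * C`.
  obtain ⟨K, hKA, hK, hKη⟩ := hAo.measurableSet.exists_isCompact_sdiff_lt hAfin.ne hη0
  have huni := (tendstoLocallyUniformlyOn_iff_tendstoUniformlyOn_of_compact hK).1 (hlu.mono hKA)
  filter_upwards [hl h.bound, hl (h.eventually_subset hK hKA),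
    Metric.tendstoUniformlyOn_iff.1 huni a ha0] with m hmC hmK hma
  set D := ω \ (M m).fatCrease with hD
  have hDo : IsOpen D := (h.adm m).isOpen_diff hω.lipschitz.isOpen
  rw [hAae]
  set F := D.indicator (f m) - u with hF
  have hFm : AEStronglyMeasurable F (volume.restrict A) := by
    refine AEStronglyMeasurable.sub ?_ ((hseg.continuousOn hAo).aestronglyMeasurable hAo.measurableSet)
    refine AEStronglyMeasurable.mono_measure ?_ Measure.restrict_le_self
    rw [aestronglyMeasurable_indicator_iff hDo.measurableSet]
    exact ((h.segLip m).continuousOn hDo).aestronglyMeasurable hDo.measurableSet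
  have hsplit : F = K.indicator F + Kᶜ.indicator F := (indicator_self_add_compl K F).symm
  have hb1 : eLpNorm (K.indicator F) 2 (volume.restrict A) ≤ ε / 2 := by
    refine le_trans ?_ ha
    have := eLpNorm_le_of_ae_bound (p := 2) (μ := volume.restrict A) (f := K.indicator F) (C := a)
      (Eventually.of_forall fun x => by
        by_cases hx : x ∈ K
        · rw [indicator_of_mem hx, hF, Pi.sub_apply, indicator_of_mem (hmK hx), ← dist_eq_norm,
            dist_comm]
          exact (hma x hx).le
        · rw [indicator_of_notMem hx, norm_zero]; exact ha0.le)
    rw [mul_comm]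
    simpa using this
  have hb2 : eLpNorm (Kᶜ.indicator F) 2 (volume.restrict A) ≤ ε / 2 := by
    refine le_trans ?_ hη
    rw [eLpNorm_indicator_eq_eLpNorm_restrict hK.measurableSet.compl,
      Measure.restrict_restrict hK.measurableSet.compl]
    have := eLpNorm_le_of_ae_bound (p := 2) (μ := volume.restrict (Kᶜ ∩ A)) (f := F) (C := 2 * C)
      ((ae_restrict_iff' (hK.measurableSet.compl.inter hAo.measurableSet)).2
        (Eventually.of_forall fun x hx => by
          have h1 := huC x hx.2
          have h2 : ‖D.indicator (f m) x‖ ≤ C := by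
            by_cases hxD : x ∈ D
            · rw [indicator_of_mem hxD]; exact hmC x hxD
            · rw [indicator_of_notMem hxD, norm_zero]; exact hC0
          rw [hF, Pi.sub_apply]
          linarith [norm_sub_le (D.indicator (f m) x) (u x)]))
    rw [Measure.restrict_apply_univ, mul_comm] at this
    have e : Kᶜ ∩ A = A \ K := by rw [sdiff_eq, inter_comm]
    rw [e] at this ⊢
    refine this.trans (mul_le_mul_right ?_ _)
    simpa using ENNReal.rpow_le_rpow hKη.le (by norm_num : (0 : ℝ) ≤ (2 : ℝ)⁻¹)
  calc eLpNorm F 2 (volume.restrict A)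
      = eLpNorm (K.indicator F + Kᶜ.indicator F) 2 (volume.restrict A) := by rw [← hsplit]
    _ ≤ eLpNorm (K.indicator F) 2 (volume.restrict A)
        + eLpNorm (Kᶜ.indicator F) 2 (volume.restrict A) :=
        eLpNorm_add_le (hFm.indicator hK.measurableSet) (hFm.indicator hK.measurableSet.compl)
          (by norm_num)
    _ ≤ ε / 2 + ε / 2 := add_le_add hb1 hb2
    _ = ε := ENNReal.add_halves ε

end SheetSequence

end Folding

namespace Folding

/-! ### Passage to the limit in weak derivatives -/

section Indicator

variable {A D : Set Plane}

theorem restrict_restrict_of_subset (hD : IsOpen D) (hDA : D ⊆ A) :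
    ((volume : Measure Plane).restrict A).restrict D = volume.restrict D := by
  rw [Measure.restrict_restrict hD.measurableSet, inter_eq_left.2 hDA]

theorem memLp_indicator_of_subset (hD : IsOpen D) (hDA : D ⊆ A) {F : Plane → Space} {q : ℝ≥0∞}
    (hF : MemLp F q (volume.restrict D)) : MemLp (D.indicator F) q (volume.restrict A) := by
  rw [memLp_indicator_iff_restrict hD.measurableSet, restrict_restrict_of_subset hD hDA]
  exact hF

theorem setIntegral_eq_indicator (hD : IsOpen D) (hDA : D ⊆ A) (F : Plane → ℝ) :
    ∫ x in D, F x = ∫ x in A, D.indicator F x := by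
  rw [integral_indicator hD.measurableSet, restrict_restrict_of_subset hD hDA]

theorem lintegral_enorm_indicator (hD : IsOpen D) (hDA : D ⊆ A) (F : Plane → Space) :
    ∫⁻ x in A, ‖D.indicator F x‖ₑ ^ 2 = ∫⁻ x in D, ‖F x‖ₑ ^ 2 := by
  rw [← restrict_restrict_of_subset hD hDA, ← lintegral_indicator hD.measurableSet]
  refine lintegral_congr fun x => ?_
  by_cases hx : x ∈ D <;> simp [hx]

/-- A crude bound that avoids square roots: the norm is at most one or at most its square. -/
theorem eLpNorm_two_le {μ : Measure Plane} {F : Plane → Space} {B : ℝ≥0∞}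
    (h : ∫⁻ x, ‖F x‖ₑ ^ 2 ∂μ ≤ B) : eLpNorm F 2 μ ≤ 1 + B := by
  have h1 : eLpNorm F 2 μ ^ 2 ≤ B := by
    refine le_trans (le_of_eq ?_) h
    have := eLpNorm_nnreal_pow_eq_lintegral (f := F) (μ := μ) (p := 2) two_ne_zero
    simpa using this
  rcases le_total (eLpNorm F 2 μ) 1 with h2 | h2
  · exact h2.trans le_self_add
  · refine le_trans ?_ (h1.trans le_add_self)
    rw [sq]
    exact le_mul_of_one_le_left' h2

theorem inner_integral_smul (hD : IsOpen D) (hDA : D ⊆ A) {K : Set Plane} (hK : IsCompact K)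
    (hKD : K ⊆ D) {ψ : Plane → ℝ} (hψ : Continuous ψ) (h0 : ∀ x ∉ K, ψ x = 0) {F : Plane → Space}
    (hF : LocallyIntegrableOn F D volume) (e : Space) :
    inner ℝ e (∫ x in D, ψ x • F x) = ∫ x in A, inner ℝ (ψ x • e) (D.indicator F x) := by
  have hi : Integrable (fun x => ψ x • F x) (volume.restrict D) :=
    (integrable_smul_of_locallyIntegrableOn hK hKD hψ h0 hF).integrableOn
  rw [← integral_inner hi, setIntegral_eq_indicator hD hDA]
  congr 1
  ext1 x
  by_cases hx : x ∈ D
  · simp only [indicator_of_mem hx, real_inner_smul_left, real_inner_smul_right]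
  · simp [hx]

theorem memLp_of_continuous_of_compact {ψ : Plane → ℝ} (hψ : Continuous ψ)
    (hc : HasCompactSupport ψ) (e : Space) (A : Set Plane) :
    MemLp (fun x => ψ x • e) 2 (volume.restrict A) :=
  ((hψ.smul continuous_const).memLp_of_hasCompactSupport (hc.smul_right)).mono_measure
    Measure.restrict_le_self

/-- Weak derivatives pass to weak limits. -/
theorem HasWeakPartial.of_weakTendsto {l : Filter ℕ} [l.NeBot] (hA : IsOpen A)
    (hAb : Bornology.IsBounded A) {D : ℕ → Set Plane} (hD : ∀ m, IsOpen (D m))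
    (hDA : ∀ m, D m ⊆ A) (hsub : ∀ K, IsCompact K → K ⊆ A → ∀ᶠ m in l, K ⊆ D m) {j : Fin 2}
    {F Φ : ℕ → Plane → Space} (hp : ∀ m, HasWeakPartial (D m) j (F m) (Φ m)) {F₀ Φ₀ : Plane → Space}
    (hF₀ : MemLp F₀ 2 (volume.restrict A)) (hΦ₀ : MemLp Φ₀ 2 (volume.restrict A))
    (hF : WeakTendsto (volume.restrict A) l (fun m => (D m).indicator (F m)) F₀)
    (hΦ : WeakTendsto (volume.restrict A) l (fun m => (D m).indicator (Φ m)) Φ₀) :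
    HasWeakPartial A j F₀ Φ₀ := by
  have : IsFiniteMeasure (volume.restrict A) := ⟨by
    rw [Measure.restrict_apply_univ]; exact hAb.measure_lt_top⟩
  have hFi : IntegrableOn F₀ A volume := hF₀.integrable (by norm_num)
  have hΦi : IntegrableOn Φ₀ A volume := hΦ₀.integrable (by norm_num)
  refine ⟨hFi.locallyIntegrableOn, hΦi.locallyIntegrableOn, fun φ h1 h2 h3 => ?_⟩
  have hdφ : Continuous fun x => fderiv ℝ φ x (EuclideanSpace.single j 1) :=
    (h1.continuous_fderiv (by simp)).clm_apply continuous_const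
  have hdφc := h2.fderiv_apply ℝ (EuclideanSpace.single j (1 : ℝ))
  have hdφ0 : ∀ x ∉ tsupport φ, fderiv ℝ φ x (EuclideanSpace.single j 1) = 0 := fun x hx => by
    rw [fderiv_eq_zero_of_notMem_tsupport hx]; rfl
  have hφ0 : ∀ x ∉ tsupport φ, φ x = 0 := fun x hx => image_eq_zero_of_notMem_tsupport hx
  refine ext_inner_left ℝ fun e => ?_
  have hind : ∀ (ψ : Plane → ℝ) (F₀ : Plane → Space),
      ∫ x in A, inner ℝ (ψ x • e) (A.indicator F₀ x) = ∫ x in A, inner ℝ (ψ x • e) (F₀ x) :=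
    fun ψ F₀ => setIntegral_congr_fun hA.measurableSet fun x hx => by
      simp only [indicator_of_mem hx]
  rw [inner_neg_right, inner_integral_smul hA subset_rfl h2 h3 hdφ hdφ0 hFi.locallyIntegrableOn,
    inner_integral_smul hA subset_rfl h2 h3 h1.continuous hφ0 hΦi.locallyIntegrableOn, hind, hind]
  have t1 := hF _ (memLp_of_continuous_of_compact hdφ hdφc e A)
  have t2 := (hΦ _ (memLp_of_continuous_of_compact h1.continuous h2 e A)).neg
  -- The support of the test function eventually lies in `D m`, where the identity holds.
  refine tendsto_nhds_unique (t1.congr' ?_) t2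
  filter_upwards [hsub _ h2 h3] with m hm
  rw [← inner_integral_smul (hD m) (hDA m) h2 hm hdφ hdφ0 (hp m).1,
    ← inner_integral_smul (hD m) (hDA m) h2 hm h1.continuous hφ0 (hp m).2.1,
    (hp m).2.2 φ h1 h2 hm, inner_neg_right]

theorem IsIsometric.jacobian_eq_one {U : Set Plane} (hU : IsOpen U) {v : Plane → Space}
    (h : IsIsometric U v) {G : Fin 2 → Plane → Space} (hG : IsWeakGradient U v G) :
    ∀ᵐ x ∂(volume.restrict U), (jacobian G x)ᵀ * jacobian G x = 1 := by
  obtain ⟨G', hG', hJ⟩ := h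
  have hall : ∀ᵐ x ∂(volume.restrict U), ∀ j, G j x = G' j x :=
    ae_all_iff.2 fun j => (hG j).unique hU (hG' j)
  filter_upwards [hJ, hall] with x hx hx'
  have : jacobian G x = jacobian G' x := by
    ext k j; simp only [jacobian, Matrix.of_apply, hx']
  rw [this, hx]

theorem tendsto_eLpNorm_smul {μ : Measure Plane} {l : Filter ℕ} {ψ : Plane → ℝ} {B : ℝ}
    (hB : ∀ x, ‖ψ x‖ ≤ B) {F : ℕ → Plane → Space} {F₀ : Plane → Space}
    (h : Tendsto (fun m => eLpNorm (F m - F₀) 2 μ) l (𝓝 0)) :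
    Tendsto (fun m => eLpNorm ((fun x => ψ x • F m x) - fun x => ψ x • F₀ x) 2 μ) l (𝓝 0) := by
  have h1 : Tendsto (fun m => ENNReal.ofReal B * eLpNorm (F m - F₀) 2 μ) l (𝓝 0) := by
    simpa using ENNReal.Tendsto.const_mul h (Or.inr ENNReal.ofReal_ne_top)
  refine tendsto_of_tendsto_of_tendsto_of_le_of_le tendsto_const_nhds h1 (fun _ => bot_le)
    fun m => eLpNorm_le_mul_eLpNorm_of_ae_le_mul (Eventually.of_forall fun x => ?_) 2
  simp only [Pi.sub_apply]
  rw [← smul_sub, norm_smul]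
  exact mul_le_mul_of_nonneg_right (hB x) (norm_nonneg _)

theorem memLp_smul {μ : Measure Plane} {ψ : Plane → ℝ} (hψ : Continuous ψ) {B : ℝ}
    (hB : ∀ x, ‖ψ x‖ ≤ B) {F : Plane → Space} (hF : MemLp F 2 μ) :
    MemLp (fun x => ψ x • F x) 2 μ := by
  refine hF.of_le_mul (c := B) (hψ.aestronglyMeasurable.smul hF.aestronglyMeasurable)
    (Eventually.of_forall fun x => ?_)
  rw [norm_smul]
  exact mul_le_mul_of_nonneg_right (hB x) (norm_nonneg _)

/-- The isometry constraint passes to the limit. -/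
theorem jacobian_eq_one_of_weakTendsto {l : Filter ℕ} [l.NeBot] (hA : IsOpen A)
    (hAb : Bornology.IsBounded A) {D : ℕ → Set Plane} (hD : ∀ m, IsOpen (D m))
    (hDA : ∀ m, D m ⊆ A) (hsub : ∀ K, IsCompact K → K ⊆ A → ∀ᶠ m in l, K ⊆ D m)
    {f : ℕ → Plane → Space} {u : Plane → Space} {C : ℝ} (hf : ∀ m, SegLip (D m) (f m))
    (hfC : ∀ᶠ m in l, ∀ x ∈ D m, ‖f m x‖ ≤ C) (hu : SegLip A u) (huC : ∀ x ∈ A, ‖u x‖ ≤ C)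
    (hfm : ∀ m, MemLp (f m) 2 (volume.restrict (D m))) (hum : MemLp u 2 (volume.restrict A))
    (hfu : Tendsto (fun m => eLpNorm ((D m).indicator (f m) - u) 2 (volume.restrict A)) l (𝓝 0))
    {G : ℕ → Fin 2 → Plane → Space} {H : ℕ → Fin 2 → Fin 2 → Plane → Space}
    (hG : ∀ m, IsWeakGradient (D m) (f m) (G m)) (hH : ∀ m j, IsWeakGradient (D m) (G m j) (H m j))
    (hGm : ∀ m j, MemLp (G m j) 2 (volume.restrict (D m)))
    (hHm : ∀ m j k, MemLp (H m j k) 2 (volume.restrict (D m)))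
    (hJ : ∀ m, ∀ᵐ x ∂(volume.restrict (D m)), (jacobian (G m) x)ᵀ * jacobian (G m) x = 1)
    {G₀ : Fin 2 → Plane → Space} {H₀ : Fin 2 → Fin 2 → Plane → Space}
    (hG₀ : IsWeakGradient A u G₀) (hH₀ : ∀ j, IsWeakGradient A (G₀ j) (H₀ j))
    (hG₀m : ∀ j, MemLp (G₀ j) 2 (volume.restrict A))
    (hH₀m : ∀ j k, MemLp (H₀ j k) 2 (volume.restrict A))
    (hGw : ∀ j, WeakTendsto (volume.restrict A) l (fun m => (D m).indicator (G m j)) (G₀ j))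
    (hHw : ∀ j k, WeakTendsto (volume.restrict A) l (fun m => (D m).indicator (H m j k)) (H₀ j k))
    {B : ℝ≥0}
    (hGB : ∀ j, ∀ᶠ m in l, eLpNorm ((D m).indicator (G m j)) 2 (volume.restrict A) ≤ B)
    (hHB : ∀ j k, ∀ᶠ m in l, eLpNorm ((D m).indicator (H m j k)) 2 (volume.restrict A) ≤ B) :
    ∀ᵐ x ∂(volume.restrict A), (jacobian G₀ x)ᵀ * jacobian G₀ x = 1 := by
  have hfinite : ∀ U : Set Plane, U ⊆ A → IsFiniteMeasure (volume.restrict U) := fun U hU => ⟨by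
    rw [Measure.restrict_apply_univ]; exact (hAb.subset hU).measure_lt_top⟩
  have := hfinite A subset_rfl
  have key : ∀ i j : Fin 2, ∀ᵐ x ∂(volume.restrict A),
      inner ℝ (G₀ i x) (G₀ j x) = if i = j then (1 : ℝ) else 0 := by
    -- Weak convergence of gradients does not pass to products. Integration by parts with the field
    -- `φ • f m` expresses `∫ φ * ⟨∂ᵢ f, ∂ⱼ f⟩` by pairings of `f m` with `∂ⱼ f` and `∂ᵢ ∂ⱼ f`; each
    -- has one strongly and one weakly convergent factor.
    intro i j
    set d : ℝ := if i = j then 1 else 0 with hd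
    have hli : LocallyIntegrableOn (fun x => inner ℝ (G₀ i x) (G₀ j x) - d) A volume := by
      have h1 : IntegrableOn (fun x => inner ℝ (G₀ i x) (G₀ j x) - d) A volume :=
        (integrable_inner (hG₀m i) (hG₀m j)).sub (integrable_const d)
      exact h1.locallyIntegrableOn
    have hz := hA.ae_eq_zero_of_integral_contDiff_smul_eq_zero hli (μ := volume) ?_
    · rw [ae_restrict_iff' hA.measurableSet]
      filter_upwards [hz] with x hx hxA
      exact sub_eq_zero.1 (hx hxA)
    intro φ h1 h2 h3
    set ei : Plane := EuclideanSpace.single i 1 with hei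
    have hdφ : Continuous fun x => fderiv ℝ φ x ei :=
      (h1.continuous_fderiv (by simp)).clm_apply continuous_const
    have hdφc := h2.fderiv_apply ℝ ei
    have hφ0 : ∀ x ∉ tsupport φ, φ x = 0 := fun x hx => image_eq_zero_of_notMem_tsupport hx
    obtain ⟨B₁, hB₁⟩ := h1.continuous.bounded_above_of_compact_support h2
    obtain ⟨B₂, hB₂⟩ := hdφ.bounded_above_of_compact_support hdφc
    have hφi : Integrable φ volume := h1.continuous.integrable_of_hasCompactSupport h2
    have hsplit : ∀ (U : Set Plane) (w g₁ g₂ : Plane → Space), U ⊆ A →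
        MemLp w 2 (volume.restrict U) → MemLp g₁ 2 (volume.restrict U) →
        MemLp g₂ 2 (volume.restrict U) →
        ∫ x in U, inner ℝ (φ x • g₁ x + fderiv ℝ φ x ei • w x) (g₂ x)
          = (∫ x in U, φ x * inner ℝ (g₁ x) (g₂ x))
            + ∫ x in U, inner ℝ (fderiv ℝ φ x ei • w x) (g₂ x) := by
      intro U w g₁ g₂ hU hw hg₁ hg₂
      have i1 := integrable_inner (memLp_smul h1.continuous hB₁ hg₁) hg₂
      have i2 := integrable_inner (memLp_smul hdφ hB₂ hw) hg₂
      simp only [real_inner_smul_left] at i1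
      rw [← integral_add i1 i2]
      refine integral_congr_ae (Eventually.of_forall fun x => ?_)
      simp only [inner_add_left, real_inner_smul_left]
    have hlim1 := (hGw j).inner_strong (fun m => memLp_indicator_of_subset (hD m) (hDA m) (hGm m j))
      (hGB j) (ψ := fun m x => fderiv ℝ φ x ei • (D m).indicator (f m) x)
      (ψ₀ := fun x => fderiv ℝ φ x ei • u x)
      (Eventually.of_forall fun m =>
        memLp_smul hdφ hB₂ (memLp_indicator_of_subset (hD m) (hDA m) (hfm m)))
      (memLp_smul hdφ hB₂ hum) (tendsto_eLpNorm_smul hB₂ hfu)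
    have hlim2 := (hHw j i).inner_strong
      (fun m => memLp_indicator_of_subset (hD m) (hDA m) (hHm m j i))
      (hHB j i) (ψ := fun m x => φ x • (D m).indicator (f m) x)
      (ψ₀ := fun x => φ x • u x)
      (Eventually.of_forall fun m =>
        memLp_smul h1.continuous hB₁ (memLp_indicator_of_subset (hD m) (hDA m) (hfm m)))
      (memLp_smul h1.continuous hB₁ hum) (tendsto_eLpNorm_smul hB₁ hfu)
    have hid : ∀ᶠ m in l,
        (∫ x in A, inner ℝ (fderiv ℝ φ x ei • (D m).indicator (f m) x) ((D m).indicator (G m j) x))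
        + ∫ x in A, inner ℝ (φ x • (D m).indicator (f m) x) ((D m).indicator (H m j i) x)
        = -(d * ∫ x in A, φ x) := by
      filter_upwards [hfC, hsub _ h2 h3] with m hmC hmK
      have := hfinite (D m) (hDA m)
      have e0 := (hf m).integral_inner (hD m) (hAb.subset (hDA m)) hmC (hG m i)
        ((hGm m i).integrable (by norm_num)) (hH m j i) ((hGm m j).integrable (by norm_num))
        ((hHm m j i).integrable (by norm_num)) h1 h2 hmK
      rw [← hei, hsplit (D m) (f m) (G m i) (G m j) (hDA m) (hfm m) (hGm m i) (hGm m j)] at e0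
      have e1 : ∫ x in D m, φ x * inner ℝ (G m i x) (G m j x) = d * ∫ x in A, φ x := by
        have : ∫ x in D m, φ x * inner ℝ (G m i x) (G m j x) = ∫ x in D m, d * φ x := by
          refine integral_congr_ae ?_
          filter_upwards [hJ m] with x hx
          rw [jacobian_eq_one_iff.1 hx i j, mul_comm]
        rw [this, integral_const_mul]
        congr 1
        exact (setIntegral_eq_of_subset_of_forall_sdiff_eq_zero hA.measurableSet (hDA m)
          fun x hx => hφ0 x fun h => hx.2 (hmK h)).symm
      have e2 : ∀ (ψ : Plane → ℝ) (F : Plane → Space),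
          ∫ x in A, inner ℝ (ψ x • (D m).indicator (f m) x) ((D m).indicator F x)
          = ∫ x in D m, inner ℝ (ψ x • f m x) (F x) := by
        intro ψ F
        rw [setIntegral_eq_indicator (hD m) (hDA m)]
        congr 1
        ext1 x
        by_cases hx : x ∈ D m <;> simp [hx]
      rw [e2, e2 φ]
      rw [e1] at e0
      linarith
    -- The limit of the identities for `f m` is compared with the same integration by parts for `u`.
    have hfinal := tendsto_nhds_unique ((hlim1.add hlim2).congr' hid) tendsto_const_nhds
    have e0 := hu.integral_inner hA hAb huC (hG₀ i) ((hG₀m i).integrable (by norm_num))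
      (hH₀ j i) ((hG₀m j).integrable (by norm_num)) ((hH₀m j i).integrable (by norm_num)) h1 h2 h3
    rw [← hei, hsplit A u (G₀ i) (G₀ j) subset_rfl hum (hG₀m i) (hG₀m j)] at e0
    have e3 : ∫ x, φ x • (inner ℝ (G₀ i x) (G₀ j x) - d)
        = (∫ x in A, φ x * inner ℝ (G₀ i x) (G₀ j x)) - d * ∫ x in A, φ x := by
      rw [← setIntegral_eq_integral_of_forall_compl_eq_zero (s := A)
        (f := fun x => φ x • (inner ℝ (G₀ i x) (G₀ j x) - d))
        (fun x hx => by rw [hφ0 x fun h => hx (h3 h), zero_smul]), ← integral_const_mul]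
      have i1 := integrable_inner (memLp_smul h1.continuous hB₁ (hG₀m i)) (hG₀m j)
      simp only [real_inner_smul_left] at i1
      rw [← integral_sub i1 (hφi.integrableOn.const_mul d)]
      congr 1
      ext1 x
      rw [smul_eq_mul]; ring
    rw [e3]
    linarith
  have hall := ae_all_iff.2 fun i => ae_all_iff.2 fun j => key i j
  filter_upwards [hall] with x hx
  exact jacobian_eq_one_iff.2 hx

end Indicator

end Folding

/-! ### Compactness and lower semicontinuity -/

namespace Folding

section Compactness

variable {ω ω₁ ω₂ : Set Plane} {b : ℝ → Plane} {α β : ℝ}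

theorem IsCreased.restrict_eq (hω : IsCreased ω ω₁ ω₂ b α β) :
    (volume : Measure Plane).restrict ω = volume.restrict (ω \ b '' Icc α β) :=
  (Measure.restrict_congr_set (sdiff_null_ae_eq_self hω.volume_crease)).symm

theorem CreaseMesh.IsAdmissible.diff_subset {M : CreaseMesh} (h : M.IsAdmissible ω ω₁ ω₂ b α β) :
    ω \ M.fatCrease ⊆ ω \ b '' Icc α β :=
  sdiff_subset_sdiff_right h.crease_subset

theorem isFiniteMeasure_restrict {U : Set Plane} (hU : Bornology.IsBounded U) :
    IsFiniteMeasure ((volume : Measure Plane).restrict U) :=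
  ⟨by rw [Measure.restrict_apply_univ]; exact hU.measure_lt_top⟩

theorem lintegral_hessian {U : Set Plane} {H : Fin 2 → Fin 2 → Plane → Space}
    (hH : ∀ j k, MemLp (H j k) 2 (volume.restrict U)) :
    ∫⁻ x in U, ∑ j, ∑ k, ‖H j k x‖ₑ ^ 2 = ∑ a : Fin 2 × Fin 2, ∫⁻ x in U, ‖H a.1 a.2 x‖ₑ ^ 2 := by
  rw [← lintegral_finsetSum' _ fun a _ => ((hH a.1 a.2).aestronglyMeasurable.enorm.pow_const 2)]
  refine lintegral_congr fun x => ?_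
  rw [Fintype.sum_prod_type]

theorem le_sum_pair (g : Fin 2 × Fin 2 → ℝ≥0∞) (j k : Fin 2) : g (j, k) ≤ ∑ a, g a :=
  Finset.single_le_sum (f := g) (fun _ _ => bot_le) (Finset.mem_univ (j, k))

theorem tendsto_inv_nat_add_one : Tendsto (fun n : ℕ => ((n : ℝ≥0∞) + 1)⁻¹) atTop (𝓝 0) := by
  have := ENNReal.tendsto_inv_nat_nhds_zero.comp (tendsto_add_atTop_nat 1)
  refine this.congr fun n => ?_
  simp

/-- An ultrafilter along which a sequence does not exceed its lower limit. -/
theorem exists_ultrafilter_le_liminf {e : ℕ → ℝ≥0∞} (hℓ : liminf e atTop ≠ ∞) :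
    ∃ 𝒰 : Ultrafilter ℕ, (𝒰 : Filter ℕ) ≤ atTop ∧
      ∀ n : ℕ, ∀ᶠ m in (𝒰 : Filter ℕ), e m ≤ liminf e atTop + ((n : ℝ≥0∞) + 1)⁻¹ := by
  -- A subsequence realises the lower limit; a nonprincipal ultrafilter on its indices is pushed
  -- forward.
  obtain ⟨σ, hσ, hσe⟩ := extraction_forall_of_frequently
    (P := fun n m => e m < liminf e atTop + ((n : ℝ≥0∞) + 1)⁻¹) fun n =>
      frequently_lt_of_liminf_lt (by isBoundedDefault)
        (ENNReal.lt_add_right hℓ (by simp))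
  have hT : Tendsto σ (hyperfilter ℕ : Filter ℕ) atTop :=
    hσ.tendsto_atTop.mono_left Nat.hyperfilter_le_atTop
  refine ⟨(hyperfilter ℕ).map σ, by rw [Ultrafilter.coe_map]; exact hT, fun n => ?_⟩
  rw [Ultrafilter.coe_map, eventually_map]
  filter_upwards [Nat.hyperfilter_le_atTop (eventually_ge_atTop n)] with k hk
  refine (hσe k).le.trans ?_
  gcongr

theorem exists_strictMono_tendsto_zero {e : ℕ → ℝ≥0∞} {l : Filter ℕ} [l.NeBot] (hl : l ≤ atTop)
    (h : Tendsto e l (𝓝 0)) : ∃ φ : ℕ → ℕ, StrictMono φ ∧ Tendsto (fun n => e (φ n)) atTop (𝓝 0) := by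
  obtain ⟨φ, hφ, hφe⟩ := extraction_forall_of_frequently
    (P := fun (n : ℕ) m => e m ≤ ((n : ℝ≥0∞) + 1)⁻¹) fun n =>
      ((h.eventually (Iic_mem_nhds (show (0 : ℝ≥0∞) < ((n : ℝ≥0∞) + 1)⁻¹ by simp))).frequently).filter_mono
        hl
  exact ⟨φ, hφ, tendsto_of_tendsto_of_tendsto_of_le_of_le tendsto_const_nhds tendsto_inv_nat_add_one
      (fun _ => bot_le) hφe⟩

theorem sum_lintegral_hessian_eq {A D : Set Plane} (hD : IsOpen D) (hDA : D ⊆ A) {v : Plane → Space}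
    {H : Fin 2 → Fin 2 → Plane → Space} (hH : IsWeakHessian D v H)
    (hHm : ∀ j k, MemLp (H j k) 2 (volume.restrict D)) :
    ∑ a : Fin 2 × Fin 2, ∫⁻ x in A, ‖D.indicator (H a.1 a.2) x‖ₑ ^ 2 = 2 * bendingEnergy D v := by
  rw [bendingEnergy_eq hD hH, lintegral_hessian hHm, ← mul_assoc,
    ENNReal.mul_inv_cancel two_ne_zero ENNReal.ofNat_ne_top, one_mul]
  exact Finset.sum_congr rfl fun a _ => lintegral_enorm_indicator hD hDA _

/-- The columns of the Jacobian are unit vectors, so gradients are bounded by the constraint alone.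
-/
theorem eLpNorm_gradient_le {A D : Set Plane} (hD : IsOpen D) (hDA : D ⊆ A)
    {G : Fin 2 → Plane → Space}
    (hJ : ∀ᵐ x ∂(volume.restrict D), (jacobian G x)ᵀ * jacobian G x = 1) (j : Fin 2) :
    eLpNorm (D.indicator (G j)) 2 (volume.restrict A) ≤ 1 + volume A := by
  refine eLpNorm_two_le ?_
  rw [lintegral_enorm_indicator hD hDA]
  calc ∫⁻ x in D, ‖G j x‖ₑ ^ 2 = ∫⁻ x in D, 1 := by
        refine lintegral_congr_ae ?_
        filter_upwards [hJ] with x hx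
        rw [← ofReal_norm, norm_eq_one_of_jacobian hx j]; simp
    _ ≤ volume A := by
        rw [setLIntegral_one]; exact measure_mono hDA

theorem eLpNorm_hessian_le {A D : Set Plane} (hD : IsOpen D) (hDA : D ⊆ A) {v : Plane → Space}
    {H : Fin 2 → Fin 2 → Plane → Space} (hH : IsWeakHessian D v H)
    (hHm : ∀ j k, MemLp (H j k) 2 (volume.restrict D)) (j k : Fin 2) :
    eLpNorm (D.indicator (H j k)) 2 (volume.restrict A) ≤ 1 + 2 * bendingEnergy D v := by
  refine eLpNorm_two_le ?_
  rw [← sum_lintegral_hessian_eq hD hDA hH hHm]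
  exact le_sum_pair (fun a => ∫⁻ x in A, ‖D.indicator (H a.1 a.2) x‖ₑ ^ 2) j k

theorem indicator_ae_eq {D A : Set Plane} (hD : IsOpen D) {f v : Plane → Space}
    (h : f =ᵐ[volume.restrict D] v) :
    D.indicator f =ᵐ[volume.restrict A] D.indicator v := by
  rw [EventuallyEq, ae_restrict_iff' hD.measurableSet] at h
  filter_upwards [ae_restrict_of_ae h] with x hx
  by_cases hxD : x ∈ D
  · rw [indicator_of_mem hxD, indicator_of_mem hxD, hx hxD]
  · rw [indicator_of_notMem hxD, indicator_of_notMem hxD]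

/-- Lipschitz functions that are isometric off the crease are isometric. -/
theorem IsCreased.isWeakGradient_of_lipschitz (hω : IsCreased ω ω₁ ω₂ b α β) {u : Plane → Space}
    {C : ℝ≥0} (hu : LipschitzOnWith C u ω) {G : Fin 2 → Plane → Space}
    (hG : IsWeakGradient (ω \ b '' Icc α β) u G) : IsWeakGradient ω u G := by
  intro j
  -- A Lipschitz function has a weak gradient on all of `ω`. Off the crease it is `G` by uniqueness,
  -- and the crease is a null set.
  obtain ⟨g, hg⟩ := exists_hasWeakPartial_of_lipschitz hω.lipschitz.isOpen hu j
  have h1 := (hg.mono hω.lipschitz.isOpen sdiff_subset).unique hω.isOpen_diff (hG j)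
  rw [← hω.restrict_eq] at h1
  exact hg.congr (EventuallyEq.refl _ _) h1

variable {M : ℕ → CreaseMesh}

/-- Compactness of bounded sequences with bounded energies. -/
theorem SheetSequence.compactness {f v : ℕ → Plane → Space} {C : ℝ}
    (h : SheetSequence ω ω₁ ω₂ b α β M f C)
    (hfv : ∀ m, f m =ᵐ[volume.restrict (ω \ (M m).fatCrease)] v m)
    (hv : ∀ m, MemH2 (ω \ (M m).fatCrease) (v m))
    (hiso : ∀ m, IsIsometric (ω \ (M m).fatCrease) (v m)) {c : ℝ≥0}
    (he : ∀ m, bendingEnergy (ω \ (M m).fatCrease) (v m) ≤ c) :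
    ∃ (u : Plane → Space) (φ : ℕ → ℕ), StrictMono φ ∧
      TendstoL2 ω (fun k => (ω \ (M (φ k)).fatCrease).indicator (v (φ k))) u ∧
      MemV ω (b '' Icc α β) u ∧
      bendingEnergy (ω \ b '' Icc α β) u ≤
        liminf (fun m => bendingEnergy (ω \ (M m).fatCrease) (v m)) atTop := by
  have hω := h.creased
  set A := ω \ b '' Icc α β with hA
  set D : ℕ → Set Plane := fun m => ω \ (M m).fatCrease with hDdef
  have hAo : IsOpen A := hω.isOpen_diff
  have hAb : Bornology.IsBounded A := hω.lipschitz.isBounded.subset sdiff_subset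
  have hDo : ∀ m, IsOpen (D m) := fun m => (h.adm m).isOpen_diff hω.lipschitz.isOpen
  have hDA : ∀ m, D m ⊆ A := fun m => (h.adm m).diff_subset
  have := isFiniteMeasure_restrict hAb
  have := isFiniteMeasure_restrict hω.lipschitz.isBounded
  set e : ℕ → ℝ≥0∞ := fun m => bendingEnergy (D m) (v m) with he'
  set ℓ := liminf e atTop with hℓ
  have hℓc : ℓ ≤ c := by
    refine (liminf_le_liminf (Eventually.of_forall he)).trans ?_
    rw [liminf_const]
  have hℓtop : ℓ ≠ ∞ := ne_top_of_le_ne_top ENNReal.coe_ne_top hℓc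
  -- All limits are taken along one ultrafilter on which the energies do not exceed the lower limit
  -- of the full sequence asymptotically. This replaces repeated extraction of subsequences.
  obtain ⟨𝒰, h𝒰, hen⟩ := exists_ultrafilter_le_liminf hℓtop
  choose hvm G H hG hGm hH hHm using hv
  have hGf : ∀ m, IsWeakGradient (D m) (f m) (G m) := fun m j =>
    (hG m j).congr (hfv m).symm (EventuallyEq.refl _ _)
  have hJ : ∀ m, ∀ᵐ x ∂(volume.restrict (D m)), (jacobian (G m) x)ᵀ * jacobian (G m) x = 1 :=
    fun m => (hiso m).jacobian_eq_one (hDo m) (hG m)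
  have hfm : ∀ m, MemLp (f m) 2 (volume.restrict (D m)) := fun m =>
    (memLp_congr_ae (hfv m)).2 (hvm m)
  -- the limit map
  obtain ⟨u₀, hu₀⟩ := h.exists_limit h𝒰
  obtain ⟨K, hK, hKu⟩ := h.lipschitz_limit h𝒰 fun x hx => (hu₀ x hx).2
  obtain ⟨u, Cu, hLip, hEq⟩ := hω.exists_lipschitz_extension hK hKu
  have huC : ∀ x ∈ A, ‖u x‖ ≤ C := fun x hx => by rw [hEq hx]; exact (hu₀ x hx).1
  have huT : ∀ x ∈ A, Tendsto (fun m => f m x) 𝒰 (𝓝 (u x)) := fun x hx => by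
    rw [hEq hx]; exact (hu₀ x hx).2
  have huSeg : SegLip A u := h.segLip_limit h𝒰 huT
  have hfu := h.tendsto_eLpNorm h𝒰 huC huT
  have huAE : AEStronglyMeasurable u (volume.restrict A) :=
    (huSeg.continuousOn hAo).aestronglyMeasurable hAo.measurableSet
  have huB : ∀ᵐ x ∂(volume.restrict A), ‖u x‖ ≤ C :=
    (ae_restrict_iff' hAo.measurableSet).2 (Eventually.of_forall huC)
  have hum : MemLp u 2 (volume.restrict A) := MemLp.of_bound huAE C huB
  have hum' : MemLp u ∞ (volume.restrict A) := MemLp.of_bound huAE C huB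
  -- weak limits of the derivatives
  have hen2 : ∀ m, ∑ a : Fin 2 × Fin 2, ∫⁻ x in A, ‖(D m).indicator (H m a.1 a.2) x‖ₑ ^ 2
      = 2 * e m := by
    exact fun m => sum_lintegral_hessian_eq (hDo m) (hDA m) ⟨G m, hG m, hH m⟩ (hHm m)
  obtain ⟨B, hB⟩ : ∃ B : ℝ≥0, 1 + volume A ≤ B ∧ 1 + 2 * (c : ℝ≥0∞) ≤ B := by
    refine ⟨(1 + volume A).toNNReal + (1 + 2 * c), ?_, ?_⟩
    · rw [ENNReal.coe_add, ENNReal.coe_toNNReal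
        (ENNReal.add_ne_top.2 ⟨ENNReal.one_ne_top, hAb.measure_lt_top.ne⟩)]
      exact le_self_add
    · rw [ENNReal.coe_add]
      exact le_trans (by simp) le_add_self
  have hGB : ∀ j m, eLpNorm ((D m).indicator (G m j)) 2 (volume.restrict A) ≤ B := fun j m =>
    (eLpNorm_gradient_le (hDo m) (hDA m) (hJ m) j).trans hB.1
  have hHB : ∀ j k m, eLpNorm ((D m).indicator (H m j k)) 2 (volume.restrict A) ≤ B := fun j k m =>
    ((eLpNorm_hessian_le (hDo m) (hDA m) ⟨G m, hG m, hH m⟩ (hHm m) j k).trans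
      (by gcongr; exact he m)).trans hB.2
  have hGi : ∀ m j, MemLp ((D m).indicator (G m j)) 2 (volume.restrict A) := fun m j =>
    memLp_indicator_of_subset (hDo m) (hDA m) (hGm m j)
  have hHi : ∀ m j k, MemLp ((D m).indicator (H m j k)) 2 (volume.restrict A) := fun m j k =>
    memLp_indicator_of_subset (hDo m) (hDA m) (hHm m j k)
  have hexG : ∀ j, ∃ g, MemLp g 2 (volume.restrict A) ∧
      WeakTendsto (volume.restrict A) 𝒰 (fun m => (D m).indicator (G m j)) g := fun j =>
    exists_weakTendsto 𝒰 (fun m => hGi m j) (Eventually.of_forall (hGB j))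
  have hexH : ∀ j k, ∃ g, MemLp g 2 (volume.restrict A) ∧
      WeakTendsto (volume.restrict A) 𝒰 (fun m => (D m).indicator (H m j k)) g := fun j k =>
    exists_weakTendsto 𝒰 (fun m => hHi m j k) (Eventually.of_forall (hHB j k))
  choose G₀ hG₀m hGw using hexG
  choose H₀ hH₀m hHw using hexH
  have hsub : ∀ K, IsCompact K → K ⊆ A → ∀ᶠ m in (𝒰 : Filter ℕ), K ⊆ D m := fun K hK hKA =>
    h𝒰 (h.eventually_subset hK hKA)
  rw [hω.restrict_eq, ← hA] at hfu
  have hfw : WeakTendsto (volume.restrict A) 𝒰 (fun m => (D m).indicator (f m)) u :=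
    WeakTendsto.of_strong (fun m => memLp_indicator_of_subset (hDo m) (hDA m) (hfm m)) hum hfu
  have hG₀ : IsWeakGradient A u G₀ := fun j =>
    HasWeakPartial.of_weakTendsto hAo hAb hDo hDA hsub (fun m => hGf m j) hum (hG₀m j) hfw (hGw j)
  have hH₀ : ∀ j, IsWeakGradient A (G₀ j) (H₀ j) := fun j k =>
    HasWeakPartial.of_weakTendsto hAo hAb hDo hDA hsub (fun m => hH m j k) (hG₀m j) (hH₀m j k)
      (hGw j) (hHw j k)
  have hJ₀ := jacobian_eq_one_of_weakTendsto hAo hAb hDo hDA hsub h.segLip (h𝒰 h.bound) huSeg huC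
    hfm hum hfu hGf hH hGm hHm hJ hG₀ hH₀ hG₀m hH₀m hGw hHw
    (fun j => Eventually.of_forall (hGB j)) (fun j k => Eventually.of_forall (hHB j k))
  have hGω : IsWeakGradient ω u G₀ := hω.isWeakGradient_of_lipschitz hLip hG₀
  -- the subsequence
  have hvu : Tendsto (fun m => eLpNorm ((D m).indicator (v m) - u) 2 (volume.restrict ω)) 𝒰 (𝓝 0) := by
    rw [hω.restrict_eq, ← hA]
    refine hfu.congr fun m => eLpNorm_congr_ae ?_
    exact (indicator_ae_eq (hDo m) (hfv m)).sub (EventuallyEq.refl _ _)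
  obtain ⟨φ, hφ, hφu⟩ := exists_strictMono_tendsto_zero h𝒰 hvu
  refine ⟨u, φ, hφ, hφu, ⟨?_, ?_, ?_⟩, ?_⟩
  · exact ⟨hum, G₀, H₀, hG₀, hG₀m, hH₀, hH₀m⟩
  · refine ⟨by rw [hω.restrict_eq]; exact hum', G₀, hGω, fun j => ?_⟩
    rw [hω.restrict_eq]
    refine MemLp.of_bound (hG₀m j).aestronglyMeasurable 1 ?_
    filter_upwards [hJ₀] with x hx
    exact (norm_eq_one_of_jacobian hx j).le
  · exact ⟨G₀, hGω, by rw [hω.restrict_eq]; exact hJ₀⟩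
  · rw [bendingEnergy_eq hAo ⟨G₀, hG₀, hH₀⟩, lintegral_hessian hH₀m]
    have hbound : ∀ n : ℕ, 2⁻¹ * ∑ a : Fin 2 × Fin 2, ∫⁻ x in A, ‖H₀ a.1 a.2 x‖ₑ ^ 2
        ≤ ℓ + ((n : ℝ≥0∞) + 1)⁻¹ := by
      intro n
      have h1 := WeakTendsto.lintegral_sum_le (ι := Fin 2 × Fin 2) (l := (𝒰 : Filter ℕ))
        (F := fun a m => (D m).indicator (H m a.1 a.2)) (F₀ := fun a => H₀ a.1 a.2)
        (fun a => hHw a.1 a.2) (fun a m => hHi m a.1 a.2) (fun a => hH₀m a.1 a.2)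
        (A := 2 * (ℓ + ((n : ℝ≥0∞) + 1)⁻¹))
        (ENNReal.mul_ne_top ENNReal.ofNat_ne_top (ENNReal.add_ne_top.2 ⟨hℓtop, by simp⟩))
        (by
          filter_upwards [hen n] with m hm
          rw [hen2 m]
          gcongr)
      calc 2⁻¹ * ∑ a : Fin 2 × Fin 2, ∫⁻ x in A, ‖H₀ a.1 a.2 x‖ₑ ^ 2
          ≤ 2⁻¹ * (2 * (ℓ + ((n : ℝ≥0∞) + 1)⁻¹)) := by gcongr
        _ = ℓ + ((n : ℝ≥0∞) + 1)⁻¹ := by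
          rw [← mul_assoc, ENNReal.inv_mul_cancel two_ne_zero ENNReal.ofNat_ne_top, one_mul]
    have hlim : Tendsto (fun n : ℕ => ℓ + ((n : ℝ≥0∞) + 1)⁻¹) atTop (𝓝 ℓ) := by
      simpa using tendsto_inv_nat_add_one.const_add ℓ
    exact ge_of_tendsto' hlim hbound

end Compactness

end Folding

/-! ### Representatives, uniform bounds and recovery sequences -/

namespace Folding

section Sequences

variable {ω ω₁ ω₂ : Set Plane} {b : ℝ → Plane} {α β : ℝ}

/-- Admissible maps have representatives that do not increase lengths and have limits in the
vertices of the polygonal crease. -/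
theorem MemVTilde.exists_representative {M : CreaseMesh} (hω : IsCreased ω ω₁ ω₂ b α β)
    (hM : M.IsAdmissible ω ω₁ ω₂ b α β) {v : Plane → Space} (hv : MemVTilde ω b M v) :
    ∃ f : Plane → Space, SegLip (ω \ M.fatCrease) f ∧
      f =ᵐ[volume.restrict (ω \ M.fatCrease)] v ∧
      ∀ i, ∃ y, Tendsto f (𝓝[ω \ M.fatCrease] (b (M.node i))) (𝓝 y) := by
  have hDo : IsOpen (ω \ M.fatCrease) := hM.isOpen_diff hω.lipschitz.isOpen
  have hDb : Bornology.IsBounded (ω \ M.fatCrease) := hω.lipschitz.isBounded.subset sdiff_subset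
  have := isFiniteMeasure_restrict hDb
  obtain ⟨f, hf, hfv⟩ := hv.2.1.exists_segLip hDo hDb (hv.1.1.integrable (by norm_num))
  exact ⟨f, hf, hfv, fun i => (hv.2.2 i).exists_tendsto hDo (hf.continuousOn hDo) hfv⟩

theorem MemH2.sub_const {U : Set Plane} (hU : Bornology.IsBounded U) {v : Plane → Space}
    (hv : MemH2 U v) (a : Space) : MemH2 U fun x => v x - a := by
  have := isFiniteMeasure_restrict hU
  obtain ⟨h1, G, H, hG, hGm, hH, hHm⟩ := hv
  exact ⟨h1.sub (memLp_const a), G, H, fun j => (hG j).sub_const a, hGm, hH, hHm⟩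

theorem IsIsometric.sub_const {U : Set Plane} {v : Plane → Space} (hv : IsIsometric U v)
    (a : Space) : IsIsometric U fun x => v x - a := by
  obtain ⟨G, hG, hJ⟩ := hv
  exact ⟨G, fun j => (hG j).sub_const a, hJ⟩

theorem MemH2.bendingEnergy_sub_const {U : Set Plane} (hU : IsOpen U) {v : Plane → Space}
    (hv : MemH2 U v) (a : Space) : bendingEnergy U (fun x => v x - a) = bendingEnergy U v := by
  obtain ⟨-, G, H, hG, -, hH, -⟩ := hv
  have h : IsWeakHessian U v H := ⟨G, hG, hH⟩
  rw [bendingEnergy_eq hU h, bendingEnergy_eq hU (h.sub_const a)]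

variable {M : ℕ → CreaseMesh}

/-- The scalar oscillation bound is used in each of the three coordinates. -/
theorem IsCreased.eventually_norm_sub_le (hω : IsCreased ω ω₁ ω₂ b α β)
    (hM : ∀ m, (M m).IsAdmissible ω ω₁ ω₂ b α β) (hreg : ShapeRegular M)
    (hs : VanishingMeshSize M) {f : ℕ → Plane → Space}
    (hf : ∀ m, SegLip (ω \ (M m).fatCrease) (f m))
    (hl : ∀ m i, ∃ y, Tendsto (f m) (𝓝[ω \ (M m).fatCrease] (b ((M m).node i))) (𝓝 y)) :
    ∃ C : ℝ, ∀ᶠ m in atTop, ∀ x ∈ ω \ (M m).fatCrease, ∀ y ∈ ω \ (M m).fatCrease,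
      ‖f m x - f m y‖ ≤ C := by
  obtain ⟨C, hC⟩ := hω.eventually_oscillation_le hM hs hreg
  refine ⟨3 * C, ?_⟩
  filter_upwards [hC] with m hm x hx y hy
  refine (norm_le_sum_norm _).trans ?_
  have : ∀ k, ‖(f m x - f m y) k‖ ≤ C := fun k =>
    hm _ (isPinned_coord (hf m) (hl m) k) x hx y hy
  refine (Finset.sum_le_sum fun k _ => this k).trans (le_of_eq ?_)
  simp

/-- Bounds in `L²` and for the oscillation imply uniform bounds. -/
theorem IsCreased.exists_bound_of_eLpNorm_le (hω : IsCreased ω ω₁ ω₂ b α β)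
    (hM : ∀ m, (M m).IsAdmissible ω ω₁ ω₂ b α β) (hs : VanishingMeshSize M)
    {f : ℕ → Plane → Space} {C : ℝ}
    (hC : ∀ᶠ m in atTop, ∀ x ∈ ω \ (M m).fatCrease, ∀ y ∈ ω \ (M m).fatCrease,
      ‖f m x - f m y‖ ≤ C) {B : ℝ≥0}
    (hB : ∀ m, eLpNorm (f m) 2 (volume.restrict (ω \ (M m).fatCrease)) ≤ B) :
    ∃ C' : ℝ, ∀ᶠ m in atTop, ∀ x ∈ ω \ (M m).fatCrease, ‖f m x‖ ≤ C' := by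
  obtain ⟨x₀, hx₀⟩ := hω.lipschitz₁.isConnected.nonempty
  have hx₀A : x₀ ∈ ω \ b '' Icc α β := by rw [hω.partition]; exact Or.inl hx₀
  obtain ⟨r, hr, hball⟩ := Metric.nhds_basis_closedBall.mem_iff.1 (hω.isOpen_diff.mem_nhds hx₀A)
  set Q := Metric.closedBall x₀ r with hQ
  have hQc : IsCompact Q := isCompact_closedBall x₀ r
  have hpos : 0 < volume Q := Metric.measure_closedBall_pos _ _ hr
  set κ : ℝ≥0∞ := volume Q ^ (2 : ℝ)⁻¹ with hκ
  have hκ0 : κ ≠ 0 := (ENNReal.rpow_pos hpos hQc.measure_lt_top.ne).ne'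
  have hκtop : κ ≠ ∞ := ENNReal.rpow_ne_top_of_nonneg (by norm_num) hQc.measure_lt_top.ne
  -- A function with norm above `T` on all of the fixed ball `Q` would have an `L²` norm of at least
  -- `B + 1`. So some value is at most `T`, and the oscillation bound does the rest.
  set T : ℝ := ((B + 1 : ℝ≥0∞) / κ).toReal with hT
  have hTtop : (B + 1 : ℝ≥0∞) / κ ≠ ∞ := ENNReal.div_ne_top (by simp) hκ0
  refine ⟨T + C, ?_⟩
  filter_upwards [hC, hω.eventually_disjoint_fatCrease hM hs hQc
    (disjoint_sdiff_self_left.mono_left hball)] with m hm hdis x hx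
  have hQD : Q ⊆ ω \ (M m).fatCrease := fun z hz =>
    ⟨(hball hz).1, fun h => hdis.le_bot ⟨hz, h⟩⟩
  obtain ⟨z, hzQ, hz⟩ : ∃ z ∈ Q, ‖f m z‖ ≤ T := by
    by_contra hcon
    push Not at hcon
    have h1 : eLpNorm (fun _ : Plane => T) 2 (volume.restrict Q) ≤ eLpNorm (f m) 2 (volume.restrict Q) := by
      refine eLpNorm_mono_ae ((ae_restrict_iff' hQc.measurableSet).2 (Eventually.of_forall
        fun z hz => ?_))
      rw [Real.norm_of_nonneg ENNReal.toReal_nonneg]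
      exact (hcon z hz).le
    have h2 : eLpNorm (f m) 2 (volume.restrict Q) ≤ B :=
      (eLpNorm_mono_measure _ (Measure.restrict_mono hQD le_rfl)).trans (hB m)
    have h3 : eLpNorm (fun _ : Plane => T) 2 (volume.restrict Q) = B + 1 := by
      rw [eLpNorm_const' T two_ne_zero ENNReal.ofNat_ne_top, Measure.restrict_apply_univ,
        Real.enorm_of_nonneg ENNReal.toReal_nonneg, ENNReal.ofReal_toReal hTtop]
      have e : (1 / (2 : ℝ≥0∞).toReal) = (2 : ℝ)⁻¹ := by norm_num
      rw [e, ← hκ, ENNReal.div_mul_cancel hκ0 hκtop]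
    rw [h3] at h1
    have := h1.trans h2
    exact absurd this (not_le.2 (ENNReal.lt_add_right ENNReal.coe_ne_top one_ne_zero))
  have h1 := hm x hx z (hQD hzQ)
  have h2 := norm_sub_norm_le (f m x) (f m z)
  linarith

/-- Compactness of sequences that are bounded in `L²`. -/
theorem IsCreased.compactness (hω : IsCreased ω ω₁ ω₂ b α β)
    (hM : ∀ m, (M m).IsAdmissible ω ω₁ ω₂ b α β) (hreg : ShapeRegular M)
    (hs : VanishingMeshSize M) {v : ℕ → Plane → Space} {c : ℝ≥0}
    (hv : ∀ m, MemVTilde ω b (M m) (v m))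
    (he : ∀ m, bendingEnergy (ω \ (M m).fatCrease) (v m) ≤ c) {B : ℝ≥0}
    (hB : ∀ m, eLpNorm (v m) 2 (volume.restrict (ω \ (M m).fatCrease)) ≤ B) :
    ∃ (u : Plane → Space) (φ : ℕ → ℕ), StrictMono φ ∧
      TendstoL2 ω (fun k => (ω \ (M (φ k)).fatCrease).indicator (v (φ k))) u ∧
      MemV ω (b '' Icc α β) u ∧
      bendingEnergy (ω \ b '' Icc α β) u ≤
        liminf (fun m => bendingEnergy (ω \ (M m).fatCrease) (v m)) atTop := by
  choose f hf hfv hl using fun m => (hv m).exists_representative hω (hM m)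
  obtain ⟨C, hC⟩ := hω.eventually_norm_sub_le hM hreg hs hf hl
  obtain ⟨C', hC'⟩ := hω.exists_bound_of_eLpNorm_le hM hs hC
    (fun m => (eLpNorm_congr_ae (hfv m)).le.trans (hB m))
  exact SheetSequence.compactness (C := C')
    { creased := hω, adm := hM, regular := hreg, size := hs, segLip := hf, limit := hl, bound := hC' }
    hfv (fun m => (hv m).1) (fun m => (hv m).2.1) he

/-- Compactness up to translations. -/
theorem IsCreased.compactness_translation (hω : IsCreased ω ω₁ ω₂ b α β)
    (hM : ∀ m, (M m).IsAdmissible ω ω₁ ω₂ b α β) (hreg : ShapeRegular M)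
    (hs : VanishingMeshSize M) {v : ℕ → Plane → Space} {c : ℝ≥0}
    (hv : ∀ m, MemVTilde ω b (M m) (v m))
    (he : ∀ m, bendingEnergy (ω \ (M m).fatCrease) (v m) ≤ c) :
    ∃ (a : ℕ → Space) (u : Plane → Space) (φ : ℕ → ℕ), StrictMono φ ∧
      TendstoL2 ω (fun k => (ω \ (M (φ k)).fatCrease).indicator fun x => v (φ k) x - a (φ k)) u ∧
      MemV ω (b '' Icc α β) u ∧
      bendingEnergy (ω \ b '' Icc α β) u ≤
        liminf (fun m => bendingEnergy (ω \ (M m).fatCrease) (v m)) atTop := by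
  choose f hf hfv hl using fun m => (hv m).exists_representative hω (hM m)
  obtain ⟨C, hC⟩ := hω.eventually_norm_sub_le hM hreg hs hf hl
  have hne : ∀ m, ∃ x, x ∈ ω \ (M m).fatCrease := fun m => by
    obtain ⟨x, hx⟩ := (hM m).connected₁.nonempty
    exact ⟨x, hω.subset₁ hx.1, hx.2⟩
  choose x₀ hx₀ using hne
  -- After subtraction of the value at one point, the oscillation bound is a uniform bound.
  set a : ℕ → Space := fun m => f m (x₀ m) with ha
  have hDo : ∀ m, IsOpen (ω \ (M m).fatCrease) := fun m => (hM m).isOpen_diff hω.lipschitz.isOpen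
  have hDb : ∀ m, Bornology.IsBounded (ω \ (M m).fatCrease) := fun m =>
    hω.lipschitz.isBounded.subset sdiff_subset
  have hen : ∀ m, bendingEnergy (ω \ (M m).fatCrease) (fun x => v m x - a m)
      = bendingEnergy (ω \ (M m).fatCrease) (v m) := fun m =>
    (hv m).1.bendingEnergy_sub_const (hDo m) (a m)
  obtain ⟨u, φ, h1, h2, h3, h4⟩ := SheetSequence.compactness (C := C)
    (f := fun m x => f m x - a m) (v := fun m x => v m x - a m) (c := c)
    { creased := hω
      adm := hM
      regular := hreg
      size := hs
      segLip := fun m => (hf m).sub_const (a m)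
      limit := fun m i => by
        obtain ⟨y, hy⟩ := hl m i
        exact ⟨y - a m, hy.sub_const (a m)⟩
      bound := by
        filter_upwards [hC] with m hm x hx
        exact hm x hx _ (hx₀ m) }
    (fun m => (hfv m).sub (EventuallyEq.refl _ fun _ => a m))
    (fun m => (hv m).1.sub_const (hDb m) (a m)) (fun m => (hv m).2.1.sub_const (a m))
    (fun m => (hen m).le.trans (he m))
  refine ⟨a, u, φ, h1, h2, h3, h4.trans (le_of_eq ?_)⟩
  exact congrArg (fun e => liminf e atTop) (funext hen)

/-- Restrictions of maps in `V` are recovery sequences. -/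
theorem IsCreased.recovery (hω : IsCreased ω ω₁ ω₂ b α β)
    (hM : ∀ m, (M m).IsAdmissible ω ω₁ ω₂ b α β) (hreg : ShapeRegular M)
    (hs : VanishingMeshSize M) {v : Plane → Space} (hv : MemV ω (b '' Icc α β) v) :
    (∀ m, MemVTilde ω b (M m) ((ω \ (M m).fatCrease).indicator v)) ∧
    TendstoL2 ω (fun m => (ω \ (M m).fatCrease).indicator v) v ∧
    Tendsto (fun m => bendingEnergy (ω \ (M m).fatCrease) ((ω \ (M m).fatCrease).indicator v))
      atTop (𝓝 (bendingEnergy (ω \ b '' Icc α β) v)) := by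
  obtain ⟨⟨hv2, G, H, hG, hGm, hH, hHm⟩, ⟨hvi, -⟩, hiso⟩ := hv
  set A := ω \ b '' Icc α β with hA
  have hωo := hω.lipschitz.isOpen
  have hAo : IsOpen A := hω.isOpen_diff
  have hDo : ∀ m, IsOpen (ω \ (M m).fatCrease) := fun m => (hM m).isOpen_diff hωo
  have hDA : ∀ m, ω \ (M m).fatCrease ⊆ A := fun m => (hM m).diff_subset
  have := isFiniteMeasure_restrict hω.lipschitz.isBounded
  obtain ⟨f, hf, hfv⟩ := hiso.exists_segLip hωo hω.lipschitz.isBounded (hvi.integrable (by simp))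
  obtain ⟨C, hC⟩ := hω.lipschitz.exists_lipschitz
  have hfL := hC Space f hf
  -- The Lipschitz extension to the whole plane supplies the limits in the vertices.
  obtain ⟨F, hF, hFf⟩ := hfL.extend_finite_dimension
  have hfD : ∀ m, f =ᵐ[volume.restrict (ω \ (M m).fatCrease)] v := fun m =>
    ae_restrict_of_ae_restrict_of_subset sdiff_subset hfv
  have hlim : ∀ (m : ℕ) (p : Plane), Tendsto f (𝓝[ω \ (M m).fatCrease] p) (𝓝 (F p)) := by
    intro m p
    refine ((hF.continuous.tendsto p).mono_left nhdsWithin_le_nhds).congr' ?_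
    filter_upwards [self_mem_nhdsWithin] with x hx
    exact (hFf hx.1).symm
  have hind : ∀ m, v =ᵐ[volume.restrict (ω \ (M m).fatCrease)] (ω \ (M m).fatCrease).indicator v :=
    fun m => (indicator_ae_eq_restrict (hDo m).measurableSet).symm
  obtain ⟨B, hB⟩ : ∃ B : ℝ, ∀ x ∈ ω, ‖f x‖ ≤ B := by
    obtain ⟨B, hB⟩ := ((hF.isBounded_image hω.lipschitz.isBounded)).exists_norm_le
    exact ⟨B, fun x hx => by rw [hFf hx]; exact hB _ (mem_image_of_mem F hx)⟩
  -- The constant sequence `f` fits the compactness framework, which yields the `L²` convergence.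
  have hseq : SheetSequence ω ω₁ ω₂ b α β M (fun _ => f) B :=
    { creased := hω
      adm := hM
      regular := hreg
      size := hs
      segLip := fun m => hf.mono sdiff_subset
      limit := fun m i => ⟨_, hlim m _⟩
      bound := Eventually.of_forall fun m x hx => hB x hx.1 }
  refine ⟨fun m => ⟨?_, ?_, fun i => ?_⟩, ?_, ?_⟩
  · refine ⟨(memLp_congr_ae (hind m)).1 (hv2.mono_measure (Measure.restrict_mono (hDA m) le_rfl)),
      G, H, fun j => ((hG j).mono hAo (hDA m)).congr (hind m) (EventuallyEq.refl _ _),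
      fun j => (hGm j).mono_measure (Measure.restrict_mono (hDA m) le_rfl),
      fun j k => (hH j k).mono hAo (hDA m),
      fun j k => (hHm j k).mono_measure (Measure.restrict_mono (hDA m) le_rfl)⟩
  · obtain ⟨G', hG', hJ⟩ := hiso
    exact ⟨G', fun j => ((hG' j).mono hωo sdiff_subset).congr (hind m) (EventuallyEq.refl _ _),
      ae_restrict_of_ae_restrict_of_subset sdiff_subset hJ⟩
  · exact ContinuousInPoint.of_tendsto (hDo m) ((hfD m).trans (hind m)) (hlim m _)
  · refine (hseq.tendsto_eLpNorm le_rfl (u := f) (fun x hx => hB x hx.1)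
      fun x _ => tendsto_const_nhds).congr fun m => eLpNorm_congr_ae ?_
    exact (indicator_ae_eq (hDo m) (hfD m)).sub hfv
  · have hHess : IsWeakHessian A v H := ⟨G, hG, hH⟩
    rw [bendingEnergy_eq hAo hHess]
    have hm : ∀ m, bendingEnergy (ω \ (M m).fatCrease) ((ω \ (M m).fatCrease).indicator v)
        = 2⁻¹ * ∫⁻ x in A, (ω \ (M m).fatCrease).indicator
          (fun x => ∑ j, ∑ k, ‖H j k x‖ₑ ^ 2) x := by
      intro m
      rw [bendingEnergy_eq (hDo m) ((hHess.mono hAo (hDA m)).congr (hind m)),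
        lintegral_indicator (hDo m).measurableSet, restrict_restrict_of_subset (hDo m) (hDA m)]
    simp only [hm]
    refine ENNReal.Tendsto.const_mul ?_ (Or.inr (by simp))
    have hmeas : AEMeasurable (fun x => ∑ j, ∑ k, ‖H j k x‖ₑ ^ 2) (volume.restrict A) :=
      Finset.aemeasurable_fun_sum _ fun j _ => Finset.aemeasurable_fun_sum _ fun k _ =>
        (hHm j k).aestronglyMeasurable.enorm.pow_const 2
    refine tendsto_lintegral_of_dominated_convergence' (fun x => ∑ j, ∑ k, ‖H j k x‖ₑ ^ 2)
      (fun m => hmeas.indicator (hDo m).measurableSet)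
      (fun m => Eventually.of_forall fun x => indicator_le_self' (fun _ _ => bot_le) x) ?_ ?_
    · rw [lintegral_hessian hHm]
      refine (ENNReal.sum_lt_top.2 fun a _ => ?_).ne
      rw [integral_norm_sq_eq (hHm a.1 a.2)]
      exact ENNReal.ofReal_lt_top
    · rw [ae_restrict_iff' hAo.measurableSet]
      -- A point off the crease is eventually off the fattened creases, so the indicators converge
      -- pointwise.
      refine Eventually.of_forall fun x hx => tendsto_const_nhds.congr' ?_
      filter_upwards [hseq.eventually_subset isCompact_singleton (singleton_subset_iff.2 hx)]
        with m hm
      rw [indicator_of_mem (hm rfl)]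

end Sequences

end Folding

/-! ### The Gamma convergence theorem -/

theorem proposition2p2
    (ω ω₁ ω₂ : Set Folding.Plane) (b : ℝ → Folding.Plane) (α β : ℝ)
    (hω : Folding.IsCreased ω ω₁ ω₂ b α β)
    (M : ℕ → Folding.CreaseMesh)
    (hM : ∀ m, (M m).IsAdmissible ω ω₁ ω₂ b α β)
    (hreg : Folding.ShapeRegular M) (hsize : Folding.VanishingMeshSize M) :
    -- (i)
    (∀ (v : ℕ → Folding.Plane → Folding.Space) (c : ℝ≥0),
      (∀ m, Folding.MemVTilde ω b (M m) (v m)) →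
      (∀ m, Folding.bendingEnergy (ω \ (M m).fatCrease) (v m) ≤ c) →
      -- bounded sequences are compact
      ((∃ C : ℝ≥0, ∀ m, eLpNorm (v m) 2 (volume.restrict (ω \ (M m).fatCrease)) ≤ C) →
        ∃ (u : Folding.Plane → Folding.Space) (φ : ℕ → ℕ), StrictMono φ ∧
          Folding.TendstoL2 ω
            (fun k => (ω \ (M (φ k)).fatCrease).indicator (v (φ k))) u ∧
          Folding.MemV ω (b '' Icc α β) u ∧
          Folding.bendingEnergy (ω \ b '' Icc α β) u ≤
            liminf (fun m => Folding.bendingEnergy (ω \ (M m).fatCrease) (v m)) atTop) ∧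
      -- arbitrary sequences are compact up to translations
      (∃ (a : ℕ → Folding.Space) (u : Folding.Plane → Folding.Space) (φ : ℕ → ℕ), StrictMono φ ∧
          Folding.TendstoL2 ω
            (fun k => (ω \ (M (φ k)).fatCrease).indicator (fun x => v (φ k) x - a (φ k))) u ∧
          Folding.MemV ω (b '' Icc α β) u ∧
          Folding.bendingEnergy (ω \ b '' Icc α β) u ≤
            liminf (fun m => Folding.bendingEnergy (ω \ (M m).fatCrease) (v m)) atTop)) ∧
    -- (ii)
    (∀ v : Folding.Plane → Folding.Space, Folding.MemV ω (b '' Icc α β) v →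
      (∀ m, Folding.MemVTilde ω b (M m) ((ω \ (M m).fatCrease).indicator v)) ∧
      Folding.TendstoL2 ω (fun m => (ω \ (M m).fatCrease).indicator v) v ∧
      Tendsto (fun m => Folding.bendingEnergy (ω \ (M m).fatCrease)
          ((ω \ (M m).fatCrease).indicator v))
        atTop (𝓝 (Folding.bendingEnergy (ω \ b '' Icc α β) v))) := by
  refine ⟨fun v c hv he => ⟨fun ⟨_, hB⟩ => hω.compactness hM hreg hsize hv he hB,
    hω.compactness_translation hM hreg hsize hv he⟩, fun v hv => hω.recovery hM hreg hsize hv⟩
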